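/- Let $\nu\ge 1$, let $\{u_j\}_{j\ge1}$ be a stationary Poisson process on $\mathbb{R}^\nu$ with unit intensity, and let $\Xi,\Xi_1,\Xi_2,\dots$ be i.i.d. random closed subsets of $\mathbb{R}^\nu$ (with the Borel $\sigma$-algebra of the Fell topology), independent of $\{u_j\}$. Put $$\mathcal X=\bigcup_{j}(u_j+\Xi_j),\quad X(t)=\sum_j \mathbb I(t\in u_j+\Xi_j),\quad \widehat X(t)=\mathbb I(t\in\mathcal X),\quad \widehat X_k(t)=\mathbb I(X(t)\ge k),$$ $$\widehat X_{\lambda,k}(\phi)=\int_{\mathbb{R}^\nu}\phi(t/\lambda)\,\widehat X_k(t)\,dt,\quad \widehat p_{\lambda,A}=\frac{\mathrm{Leb}(\mathcal X\cap\lambda A)}{\mathrm{Leb}(\lambda A)},\quad p=\mathrm E\,\mathrm{Leb}\big(\mathcal X\cap(0,1]^\nu\big),\quad \mu=\mathrm E\,\mathrm{Leb}(\Xi).$$ Assume $\mathrm E\,\mathrm{Leb}(\Xi)^2<\infty$. Let $W$ be standard Gaussian white noise on $\mathbb{R}^\nu$, so that $W(\phi)\sim N(0,\int\phi^2)$ for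 $\phi\in L^2(\mathbb{R}^\nu)$ and $W(A)=W(\mathbb I_A)\sim N(0,\mathrm{Leb}(A))$. Then: (1) For every integer $k\ge1$, the function $t\mapsto\mathrm{Cov}(\widehat X_k(0),\widehat X_k(t))$ is integrable on $\mathbb{R}^\nu$, the number $$\sigma_k^2:=\int_{\mathbb{R}^\nu}\mathrm{Cov}(\widehat X_k(0),\widehat X_k(t))\,dt$$ is nonnegative and finite, and for every real $\phi\in L^1(\mathbb{R}^\nu)\cap L^\infty(\mathbb{R}^\nu)$, with $\sigma_k\ge 0$, $$\lambda^{-\nu/2}\big(\widehat X_{\lambda,k}(\phi)-\mathrm E\widehat X_{\lambda,k}(\phi)\big)\ \xrightarrow{d}\ \sigma_k W(\phi),\qquad\lambda\to\infty .$$ (2) In particular, for every bounded Borel set $A\subset\mathbb{R}^\nu$ with $\mathrm{Leb}(A)>0$, $$\lambda^{\nu/2}\big(\widehat p_{\lambda,A}-p\big)\ \xrightarrow{d}\ \sigma W(A)/\mathrm{Leb}(A),\qquad\lambda\to\infty,$$ where $\sigma\ge0$ and, both integrands being integrable, $$\sigma^2:=\int_{\mathbb{R}^\nu}\mathrm{Cov}(\widehat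 X(0),\widehat X(t))\,dt=e^{-2\mu}\int_{\mathbb{R}^\nu}\Big(e^{\mathrm E\,\mathrm{Leb}(\Xi\cap(\Xi-t))}-1\Big)\,dt .$$ -/

import Mathlib

open MeasureTheory ProbabilityTheory Filter Topology
open scoped ENNReal NNReal Pointwise

noncomputable section

namespace BooleanModel

/-- The Euclidean space `ℝ^ν`. -/
abbrev Eucl (ν : ℕ) : Type := EuclideanSpace ℝ (Fin ν)

/-- The space of closed subsets of `ℝ^ν`. -/
abbrev ClosedSets (ν : ℕ) : Type := TopologicalSpace.Closeds (Eucl ν)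

/-- The Fell topology on the closed subsets of `ℝ^ν`: it is generated by the sets
`{F | F ∩ K = ∅}` with `K` compact and the sets `{F | F ∩ G ≠ ∅}` with `G` open. -/
@[reducible] def fellTopology (ν : ℕ) : TopologicalSpace (ClosedSets ν) :=
  TopologicalSpace.generateFrom
    ({U | ∃ K : Set (Eucl ν), IsCompact K ∧ U = {F : ClosedSets ν | (F : Set (Eucl ν)) ∩ K = ∅}} ∪
     {U | ∃ G : Set (Eucl ν), IsOpen G ∧ U = {F : ClosedSets ν | ((F : Set (Eucl ν)) ∩ G).Nonempty}})

/-- The closed sets carry the Borel σ-algebra of the Fell topology. -/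
instance closedSetsMeasurableSpace (ν : ℕ) : MeasurableSpace (ClosedSets ν) :=
  @borel (ClosedSets ν) (fellTopology ν)

variable {Ω : Type*} [MeasurableSpace Ω] {ν : ℕ}

/-- The random points `u_0, u_1, …` enumerate a stationary Poisson process with unit intensity
on `ℝ^ν`: the number of points in a Borel set `B` of finite volume is Poisson distributed with
mean `Leb B`, and the numbers of points in disjoint such sets are independent. -/
structure IsUnitPoissonProcess (u : ℕ → Ω → Eucl ν) (P : Measure Ω) : Prop where
  measurable : ∀ j, Measurable (u j)
  count_law : ∀ B : Set (Eucl ν), MeasurableSet B → volume B ≠ ∞ →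
    HasLaw (fun ω => Set.encard {j | u j ω ∈ B})
      ((poissonMeasure (volume B).toNNReal).map (fun n : ℕ => (n : ℕ∞))) P
  count_indep : ∀ (n : ℕ) (B : Fin n → Set (Eucl ν)), (∀ i, MeasurableSet (B i)) →
    (∀ i, volume (B i) ≠ ∞) → Pairwise (fun i i' => Disjoint (B i) (B i')) →
    iIndepFun (fun i ω => Set.encard {j | u j ω ∈ B i}) P

/-- The data of a Boolean model: the germs `u_j` form a stationary Poisson process with unit
intensity, the grains `Ξ_j` are i.i.d. random closed sets with law `Q`, and the sequence of grains
is independent of the sequence of germs. -/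
structure IsBooleanModel (u : ℕ → Ω → Eucl ν) (Ξ : ℕ → Ω → ClosedSets ν)
    (Q : Measure (ClosedSets ν)) (P : Measure Ω) : Prop where
  germs : IsUnitPoissonProcess u P
  grains_measurable : ∀ j, Measurable (Ξ j)
  grains_law : ∀ j, HasLaw (Ξ j) Q P
  grains_indep : iIndepFun Ξ P
  germs_indep_grains : IndepFun (fun ω j => u j ω) (fun ω j => Ξ j ω) P

/-- The translated grain `u_j + Ξ_j`. -/
def shiftedGrain (u : ℕ → Ω → Eucl ν) (Ξ : ℕ → Ω → ClosedSets ν) (j : ℕ) (ω : Ω) :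
    Set (Eucl ν) :=
  u j ω +ᵥ (Ξ j ω : Set (Eucl ν))

/-- The Boolean set, the union of all translated grains. -/
def booleanSet (u : ℕ → Ω → Eucl ν) (Ξ : ℕ → Ω → ClosedSets ν) (ω : Ω) : Set (Eucl ν) :=
  ⋃ j, shiftedGrain u Ξ j ω

/-- The random grain field `X(t) = ∑_j 1(t ∈ u_j + Ξ_j)`, the number of grains that cover `t`. -/
def grainField (u : ℕ → Ω → Eucl ν) (Ξ : ℕ → Ω → ClosedSets ν) (t : Eucl ν) (ω : Ω) : ℕ∞ :=
  Set.encard {j | t ∈ shiftedGrain u Ξ j ω}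

/-- The excursion indicator `1(X(t) ≥ k)`. -/
def excursion (u : ℕ → Ω → Eucl ν) (Ξ : ℕ → Ω → ClosedSets ν) (k : ℕ) (t : Eucl ν) (ω : Ω) : ℝ :=
  Set.indicator {ω' | (k : ℕ∞) ≤ grainField u Ξ t ω'} (fun _ => (1 : ℝ)) ω

/-- The indicator `1(t ∈ 𝒳)` of the Boolean set. -/
def booleanIndicator (u : ℕ → Ω → Eucl ν) (Ξ : ℕ → Ω → ClosedSets ν) (t : Eucl ν) (ω : Ω) : ℝ :=
  Set.indicator (booleanSet u Ξ ω) (fun _ => (1 : ℝ)) t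

/-- The functional `∫ φ(t/λ) 1(X(t) ≥ k) dt`. -/
def excursionFunctional (u : ℕ → Ω → Eucl ν) (Ξ : ℕ → Ω → ClosedSets ν) (l : ℝ) (k : ℕ)
    (φ : Eucl ν → ℝ) (ω : Ω) : ℝ :=
  ∫ t, φ (l⁻¹ • t) * excursion u Ξ k t ω

/-- The unit cube `]0, 1]^ν`. -/
def unitCube (ν : ℕ) : Set (Eucl ν) := {t | ∀ i, 0 < t i ∧ t i ≤ 1}

/-- The volume fraction `p = E Leb(𝒳 ∩ ]0, 1]^ν)`. -/
def volumeFraction (u : ℕ → Ω → Eucl ν) (Ξ : ℕ → Ω → ClosedSets ν) (P : Measure Ω) : ℝ :=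
  ∫ ω, volume.real (booleanSet u Ξ ω ∩ unitCube ν) ∂P

/-- The sample volume fraction `Leb(𝒳 ∩ λA) / Leb(λA)`. -/
def sampleVolumeFraction (u : ℕ → Ω → Eucl ν) (Ξ : ℕ → Ω → ClosedSets ν) (l : ℝ)
    (A : Set (Eucl ν)) (ω : Ω) : ℝ :=
  volume.real (booleanSet u Ξ ω ∩ l • A) / volume.real (l • A)

/-- `σ_k² = ∫ Cov(1(X(0) ≥ k), 1(X(t) ≥ k)) dt`. -/
def excursionVariance (u : ℕ → Ω → Eucl ν) (Ξ : ℕ → Ω → ClosedSets ν) (P : Measure Ω)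
    (k : ℕ) : ℝ :=
  ∫ t, covariance (excursion u Ξ k 0) (excursion u Ξ k t) P

/-- `σ² = ∫ Cov(1(0 ∈ 𝒳), 1(t ∈ 𝒳)) dt`. -/
def volumeVariance (u : ℕ → Ω → Eucl ν) (Ξ : ℕ → Ω → ClosedSets ν) (P : Measure Ω) : ℝ :=
  ∫ t, covariance (booleanIndicator u Ξ 0) (booleanIndicator u Ξ t) P

/-- The mean volume `μ = E Leb(Ξ)` of a random closed set with law `Q`. -/
def meanVolume (Q : Measure (ClosedSets ν)) : ℝ :=
  (∫⁻ F, volume (F : Set (Eucl ν)) ∂Q).toReal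

/-- `E Leb(Ξ ∩ (Ξ - t))` for a random closed set `Ξ` with law `Q`. -/
def meanOverlap (Q : Measure (ClosedSets ν)) (t : Eucl ν) : ℝ :=
  (∫⁻ F, volume ((F : Set (Eucl ν)) ∩ (-t +ᵥ (F : Set (Eucl ν)))) ∂Q).toReal

/-- The law `N(0, ∫ φ²)` of the integral `W(φ)` of `φ ∈ L²(ℝ^ν)` with respect to standard
Gaussian white noise. -/
abbrev whiteNoiseLaw (φ : Eucl ν → ℝ) : Measure ℝ :=
  gaussianReal 0 (∫ t, φ t ^ 2).toNNReal

end BooleanModel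

end

/-!
The germs with their grains form a Poisson process on `ℝ^ν × closed sets` with intensity
`Leb ⊗ Q`, by the marking theorem (`IsBooleanModel.hasPoissonFunctional`). It is handled through its
generating functional `E ∏_j g(u_j, Ξ_j) = exp (∫ (g - 1))`, which yields the joint characteristic
functions of counts; hence counts in disjoint sets are independent and the model is stationary
(`HasPoissonFunctional.indepFun_pointCount`, `IsBooleanModel.identDistrib_coverField`). The field
`X(t)` is the count of the set `coverSet t` of the pairs that cover `t`. Away from an event of
probability at most `m(t - s) = E Leb(Ξ ∩ (Ξ - (t - s)))`, that some grain covers both `s` and `t`,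
the indicators at `s` and `t` agree with independent ones, so their covariance is at most
`6 m(t - s)` (`IsBooleanModel.abs_covariance_coverField_le`). As `∫ m = E Leb(Ξ)²`, the covariance
is integrable, and the variances of the rescaled functionals converge to `σ² ∫ φ²` by dominated
convergence and continuity of the autocorrelation of `φ` (`tendsto_integral_fieldIntegral_sq`).

For asymptotic normality, the grains with germ at distance more than `R` from the point are dropped.
The truncated field has values at distance more than `2 R` independent. For such a field `ξ` the
characteristic function `ψ` of `S = ∫ w ξ` satisfies `ψ'(s) ≈ -s Var(S) ψ(s)`: in
`ψ'(s) = i ∫ w(t) E[ξ_t exp (i s S)] dt` the contribution to `S` from far away from `t` is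
independent of `ξ_t`, and the exponential of the near contribution is expanded to first order. The
error is explicit (`IsFiniteRangeField.norm_charFun_sub_le`), and tends to `0` for the weights
`w(t) = λ^(-ν/2) φ(t/λ)` with bounded integrable `φ`. The covariance of the truncation error is
bounded both by a multiple of `m(t - s)` and by a multiple of the intensity `q(R)` of far germs, so
its integral tends to `0` as `R → ∞` and the truncation is negligible in `L²` uniformly in `λ`
(`tendsto_integral_cexp_fieldIntegral`). Lévy's continuity theorem concludes.

The volume fraction is the case `k = 1` with `φ` the indicator function of `A`, since
`Leb(𝒳 ∩ λA) = ∫ 1_A(t/λ) 1(X(t) ≥ 1) dt`; the formula for `σ²` comes from the void probabilities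
`P(X(0) = 0) = e^(-μ)` and `P(X(0) = X(t) = 0) = e^(-2μ + m(t))`.
-/

noncomputable section

namespace BooleanModel

/-! ### Generating functionals of point processes -/

section PointSequences

variable {Ω E : Type*} [MeasurableSpace Ω] [MeasurableSpace E]

lemma measurable_encard_setOf_mem {y : ℕ → Ω → E} (hy : ∀ j, Measurable (y j)) {G : Set E}
    (hG : MeasurableSet G) : Measurable fun ω => Set.encard {j | y j ω ∈ G} := by
  have h1 : ∀ ω, ((Set.encard {j | y j ω ∈ G} : ℕ∞) : ℝ≥0∞)
      = ∑' j, G.indicator (fun _ => (1 : ℝ≥0∞)) (y j ω) := by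
    intro ω
    have : (∑' j, G.indicator (fun _ => (1 : ℝ≥0∞)) (y j ω))
        = ∑' j, Set.indicator {j | y j ω ∈ G} (fun _ => (1 : ℝ≥0∞)) j := by
      rfl
    rw [this, ← tsum_subtype, ENNReal.tsum_set_one]
  have h2 : Measurable fun ω => ∑' j, G.indicator (fun _ => (1 : ℝ≥0∞)) (y j ω) :=
    Measurable.tsum fun j => (measurable_const.indicator hG).comp (hy j)
  rw [ENat.measurable_iff]
  intro n
  have : (fun ω => Set.encard {j | y j ω ∈ G}) ⁻¹' {(n : ℕ∞)}
      = (fun ω => ∑' j, G.indicator (fun _ => (1 : ℝ≥0∞)) (y j ω)) ⁻¹' {(n : ℝ≥0∞)} := by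
    ext ω
    simp only [Set.mem_preimage, Set.mem_singleton_iff, ← h1]
    constructor
    · intro h; rw [h]; simp
    · intro h
      have : ((Set.encard {j | y j ω ∈ G} : ℕ∞) : ℝ≥0∞) = ((n : ℕ∞) : ℝ≥0∞) := by simpa using h
      exact ENat.toENNReal_inj.1 this
  rw [this]
  exact h2 (measurableSet_singleton _)

lemma lintegral_encard_setOf_mem (P : Measure Ω) {y : ℕ → Ω → E} (hy : ∀ j, Measurable (y j))
    {G : Set E} (hG : MeasurableSet G) :
    ∫⁻ ω, ((Set.encard {j | y j ω ∈ G} : ℕ∞) : ℝ≥0∞) ∂P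
      = Measure.sum (fun j => P.map (y j)) G := by
  have h1 : ∀ ω, ((Set.encard {j | y j ω ∈ G} : ℕ∞) : ℝ≥0∞)
      = ∑' j, ((y j) ⁻¹' G).indicator (fun _ => (1 : ℝ≥0∞)) ω := by
    intro ω
    have : (∑' j, ((y j) ⁻¹' G).indicator (fun _ => (1 : ℝ≥0∞)) ω)
        = ∑' j, Set.indicator {j | y j ω ∈ G} (fun _ => (1 : ℝ≥0∞)) j := by
      rfl
    rw [this, ← tsum_subtype, ENNReal.tsum_set_one]
  simp_rw [h1]
  rw [lintegral_tsum fun j => (measurable_const.indicator (hy j hG)).aemeasurable,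
    Measure.sum_apply _ hG]
  congr 1 with j
  rw [lintegral_indicator (hy j hG), Measure.map_apply (hy j) hG]
  simp

/-- For complex numbers of modulus at most one, products differ by at most the sum of the
differences of the factors. -/
lemma norm_prod_sub_prod_le_sum {ι : Type*} (s : Finset ι) (a b : ι → ℂ) (ha : ∀ i, ‖a i‖ ≤ 1)
    (hb : ∀ i, ‖b i‖ ≤ 1) : ‖∏ i ∈ s, a i - ∏ i ∈ s, b i‖ ≤ ∑ i ∈ s, ‖a i - b i‖ := by
  classical
  induction s using Finset.induction_on with
  | empty => simp
  | insert i s hi ih =>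
    rw [Finset.prod_insert hi, Finset.prod_insert hi, Finset.sum_insert hi]
    have h1 : ‖∏ i ∈ s, b i‖ ≤ 1 := by
      rw [norm_prod]; exact Finset.prod_le_one (fun _ _ => norm_nonneg _) fun i _ => hb i
    calc ‖a i * ∏ i ∈ s, a i - b i * ∏ i ∈ s, b i‖
        = ‖a i * (∏ i ∈ s, a i - ∏ i ∈ s, b i) + (a i - b i) * ∏ i ∈ s, b i‖ := by ring_nf
      _ ≤ ‖a i‖ * ‖∏ i ∈ s, a i - ∏ i ∈ s, b i‖ + ‖a i - b i‖ * ‖∏ i ∈ s, b i‖ := by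
          refine (norm_add_le _ _).trans ?_; rw [norm_mul, norm_mul]
      _ ≤ 1 * ‖∏ i ∈ s, a i - ∏ i ∈ s, b i‖ + ‖a i - b i‖ * 1 := by
          gcongr; exact ha i
      _ ≤ _ := by linarith

/-- Changing the factors changes the expected product over the points of a point process by at most
the integral of the change against the intensity measure. -/
lemma norm_integral_prod_sub_le {P : Measure Ω} [IsProbabilityMeasure P] {M : Measure E}
    {y : ℕ → Ω → E} (hy : ∀ j, Measurable (y j)) (hM : Measure.sum (fun j => P.map (y j)) = M)
    {g h : E → ℂ} (hg : Measurable g) (hh : Measurable h) (hg1 : ∀ x, ‖g x‖ ≤ 1)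
    (hh1 : ∀ x, ‖h x‖ ≤ 1) (hfin : Integrable (fun x => g x - h x) M) (n : ℕ) :
    ‖∫ ω, ∏ j ∈ Finset.range n, g (y j ω) ∂P - ∫ ω, ∏ j ∈ Finset.range n, h (y j ω) ∂P‖
      ≤ ∫ x, ‖g x - h x‖ ∂M := by
  have hint : ∀ {k : E → ℂ}, Measurable k → (∀ x, ‖k x‖ ≤ 1) →
      Integrable (fun ω => ∏ j ∈ Finset.range n, k (y j ω)) P := by
    intro k hk hk1
    refine Integrable.of_bound (C := 1)
      (Finset.measurable_fun_prod _ fun j _ => hk.comp (hy j)).aestronglyMeasurable ?_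
    filter_upwards with ω
    rw [norm_prod]; exact Finset.prod_le_one (fun _ _ => norm_nonneg _) fun i _ => hk1 _
  have hj : ∀ j, Integrable (fun ω => ‖g (y j ω) - h (y j ω)‖) P := by
    intro j
    refine Integrable.of_bound (C := 2) ((hg.comp (hy j)).sub
      (hh.comp (hy j))).norm.aestronglyMeasurable ?_
    filter_upwards with ω
    rw [norm_norm]
    exact (norm_sub_le _ _).trans (by linarith [hg1 (y j ω), hh1 (y j ω)])
  rw [← integral_sub (hint hg hg1) (hint hh hh1)]
  calc _ ≤ ∫ ω, ‖∏ j ∈ Finset.range n, g (y j ω) - ∏ j ∈ Finset.range n, h (y j ω)‖ ∂P :=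
        norm_integral_le_integral_norm _
    _ ≤ ∫ ω, ∑ j ∈ Finset.range n, ‖g (y j ω) - h (y j ω)‖ ∂P := by
        refine integral_mono ((hint hg hg1).sub (hint hh hh1)).norm
          (integrable_finsetSum _ fun j _ => hj j) fun ω => ?_
        exact norm_prod_sub_prod_le_sum _ _ _ (fun _ => hg1 _) (fun _ => hh1 _)
    _ ≤ ∫ x, ‖g x - h x‖ ∂M := by
        rw [integral_eq_lintegral_of_nonneg_ae, integral_eq_lintegral_of_nonneg_ae]
        · refine ENNReal.toReal_mono ?_ ?_
          · simpa using hfin.2.ne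
          · rw [← hM, lintegral_sum_measure]
            calc _ = ∫⁻ ω, ∑ j ∈ Finset.range n, ‖g (y j ω) - h (y j ω)‖ₑ ∂P := by
                  congr 1 with ω
                  rw [ENNReal.ofReal_sum_of_nonneg fun _ _ => norm_nonneg _]
                  simp
              _ = ∑ j ∈ Finset.range n, ∫⁻ ω, ‖g (y j ω) - h (y j ω)‖ₑ ∂P := by
                  rw [lintegral_finsetSum]
                  exact fun j _ => ((hg.comp (hy j)).sub (hh.comp (hy j))).enorm
              _ = ∑ j ∈ Finset.range n, ∫⁻ x, ‖g x - h x‖ₑ ∂(P.map (y j)) := by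
                  refine Finset.sum_congr rfl fun j _ => ?_
                  exact (lintegral_map (hg.sub hh).enorm (hy j)).symm
              _ ≤ ∑' j, ∫⁻ x, ‖g x - h x‖ₑ ∂(P.map (y j)) := ENNReal.sum_le_tsum _
              _ = _ := by simp
        · filter_upwards with x using norm_nonneg _
        · exact (hg.sub hh).norm.aestronglyMeasurable
        · filter_upwards with x using Finset.sum_nonneg fun _ _ => norm_nonneg _
        · exact (integrable_finsetSum _ fun j _ => hj j).aestronglyMeasurable

/-- The points `y_0, y_1, …` form a Poisson process with intensity measure `M`, expressed through
the generating functional: `E ∏_j g(y_j) = exp (∫ (g - 1) dM)` for every measurable `g` with values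
in the closed complex unit disc for which `g - 1` is integrable. The infinite product is taken as
the limit of the products over the first `n` points. -/
structure HasPoissonFunctional (y : ℕ → Ω → E) (M : Measure E) (P : Measure Ω) : Prop where
  measurable : ∀ j, Measurable (y j)
  intensity : Measure.sum (fun j => P.map (y j)) = M
  tendsto_prod : ∀ g : E → ℂ, Measurable g → (∀ x, ‖g x‖ ≤ 1) → Integrable (fun x => g x - 1) M →
    Tendsto (fun n : ℕ => ∫ ω, ∏ j ∈ Finset.range n, g (y j ω) ∂P) atTop
      (𝓝 (Complex.exp (∫ x, (g x - 1) ∂M)))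

/-- The generating functional formula extends from simple functions to all functions. -/
lemma HasPoissonFunctional.of_simpleFunc {P : Measure Ω} [IsProbabilityMeasure P] {M : Measure E}
    {y : ℕ → Ω → E} (hy : ∀ j, Measurable (y j)) (hM : Measure.sum (fun j => P.map (y j)) = M)
    (H : ∀ g : SimpleFunc E ℂ, (∀ x, ‖1 + g x‖ ≤ 1) → Integrable g M →
      Tendsto (fun n : ℕ => ∫ ω, ∏ j ∈ Finset.range n, (1 + g (y j ω)) ∂P) atTop
        (𝓝 (Complex.exp (∫ x, g x ∂M)))) :
    HasPoissonFunctional y M P := by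
  refine ⟨hy, hM, fun g hg hg1 hgi => ?_⟩
  set h : E → ℂ := fun x => g x - 1 with hh
  have hhm : Measurable h := hg.sub_const 1
  set s : Set ℂ := {z | ‖1 + z‖ ≤ 1} with hs
  have h0 : (0 : ℂ) ∈ s := by simp [hs]
  have hhs : ∀ x, h x ∈ s := fun x => by simp [hs, hh, hg1 x]
  let a : ℕ → SimpleFunc E ℂ := fun k => SimpleFunc.approxOn h hhm s 0 h0 k
  have ha_mem : ∀ k x, ‖1 + a k x‖ ≤ 1 := fun k x => SimpleFunc.approxOn_mem hhm h0 k x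
  have ha_int : ∀ k, Integrable (a k) M := fun k =>
    SimpleFunc.integrable_approxOn hhm hgi h0 (integrable_zero _ _ _) k
  have ha_lim : Tendsto (fun k => ∫⁻ x, ‖a k x - h x‖ₑ ∂M) atTop (𝓝 0) :=
    SimpleFunc.tendsto_approxOn_L1_enorm hhm h0
      (by filter_upwards with x using subset_closure (hhs x)) (by simpa using hgi.2)
  have ha_int_lim : Tendsto (fun k => ∫ x, a k x ∂M) atTop (𝓝 (∫ x, h x ∂M)) :=
    tendsto_integral_of_L1 _ hgi.1 (Eventually.of_forall ha_int) ha_lim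
  have ha_norm_lim : Tendsto (fun k => ∫ x, ‖a k x - h x‖ ∂M) atTop (𝓝 0) := by
    have := (ENNReal.tendsto_toReal ENNReal.zero_ne_top).comp ha_lim
    refine (this.congr fun k => ?_)
    simp only [Function.comp]
    exact (integral_norm_eq_lintegral_enorm ((ha_int k).sub hgi).aestronglyMeasurable).symm
  rw [Metric.tendsto_atTop]
  intro ε hε
  have e1 : ∀ᶠ k in atTop, ∫ x, ‖a k x - h x‖ ∂M < ε / 3 :=
    ha_norm_lim.eventually (gt_mem_nhds (by linarith))
  have e2 : ∀ᶠ k in atTop,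
      dist (Complex.exp (∫ x, a k x ∂M)) (Complex.exp (∫ x, h x ∂M)) < ε / 3 :=
    ((Complex.continuous_exp.tendsto _).comp ha_int_lim).eventually
      (Metric.ball_mem_nhds _ (by linarith))
  obtain ⟨k, hk1, hk2⟩ := (e1.and e2).exists
  obtain ⟨N, hN⟩ := (Metric.tendsto_atTop.1 (H (a k) (ha_mem k) (ha_int k))) (ε / 3) (by linarith)
  refine ⟨N, fun n hn => ?_⟩
  have e3 := norm_integral_prod_sub_le (P := P) hy hM hg (h := fun x => 1 + a k x)
    ((a k).measurable.const_add 1) hg1 (ha_mem k)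
    (by
      have : (fun x => g x - (1 + a k x)) = fun x => h x - a k x := by ext x; simp [hh]; ring
      rw [this]; exact hgi.sub (ha_int k)) n
  have e4 : ∫ x, ‖g x - (1 + a k x)‖ ∂M = ∫ x, ‖a k x - h x‖ ∂M := by
    congr 1 with x
    rw [← norm_neg]; congr 1; simp [hh]; ring
  rw [e4, ← dist_eq_norm] at e3
  have e5 := hN n hn
  calc _ ≤ _ := dist_triangle4 _ (∫ ω, ∏ j ∈ Finset.range n, (1 + a k (y j ω)) ∂P)
        (Complex.exp (∫ x, a k x ∂M)) _
    _ < ε := by linarith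

end PointSequences

section PointSequences

variable {Ω E : Type*} [MeasurableSpace Ω] [MeasurableSpace E]

lemma ae_finite_setOf_mem {P : Measure Ω} {M : Measure E} {y : ℕ → Ω → E}
    (hy : ∀ j, Measurable (y j)) (hM : Measure.sum (fun j => P.map (y j)) = M) {G : Set E}
    (hG : MeasurableSet G) (hG' : M G ≠ ∞) : ∀ᵐ ω ∂P, {j | y j ω ∈ G}.Finite := by
  have h := lintegral_encard_setOf_mem P hy hG
  rw [hM] at h
  have hm : Measurable fun ω => ((Set.encard {j | y j ω ∈ G} : ℕ∞) : ℝ≥0∞) :=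
    (Measurable.of_discrete (f := fun n : ℕ∞ => (n : ℝ≥0∞))).comp
      (measurable_encard_setOf_mem hy hG)
  filter_upwards [ae_lt_top hm (by rw [h]; exact hG')] with ω hω
  rw [← Set.encard_lt_top_iff]
  exact_mod_cast hω

/-- Collecting the factors of a product of values of a function `g` according to the value:
if every nonzero value is taken only finitely often then the partial products of `1 + g (x j)`
are eventually constant. -/
lemma eventually_prod_one_add_eq (g : SimpleFunc E ℂ) (x : ℕ → E)
    (hfin : ∀ c ∈ g.range.filter (· ≠ 0), {j | x j ∈ g ⁻¹' {c}}.Finite) :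
    ∀ᶠ n in atTop, ∏ j ∈ Finset.range n, (1 + g (x j))
      = ∏ c ∈ g.range.filter (· ≠ 0), (1 + c) ^ (Set.encard {j | x j ∈ g ⁻¹' {c}}).toNat := by
  classical
  have hev : ∀ᶠ n in atTop, ∀ c ∈ g.range.filter (· ≠ 0),
      ((Finset.range n).filter fun j => g (x j) = c).card
        = (Set.encard {j | x j ∈ g ⁻¹' {c}}).toNat := by
    rw [Filter.eventually_all_finset]
    intro c hc
    obtain ⟨b, hb⟩ := (hfin c hc).bddAbove
    filter_upwards [eventually_gt_atTop b] with n hn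
    have : {j | x j ∈ g ⁻¹' {c}} = ↑((Finset.range n).filter fun j => g (x j) = c) := by
      ext j
      simp only [Set.mem_ofPred_eq, Set.mem_preimage, Set.mem_singleton_iff, Finset.coe_filter,
        Finset.mem_range]
      refine ⟨fun h => ⟨lt_of_le_of_lt (hb h) hn, h⟩, fun h => h.2⟩
    rw [this, Set.encard_coe_eq_coe_finsetCard]
    simp
  filter_upwards [hev] with n hn
  have h1 : ∏ j ∈ Finset.range n, (1 + g (x j))
      = ∏ c ∈ g.range, ∏ j ∈ (Finset.range n).filter (fun j => g (x j) = c), (1 + g (x j)) :=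
    (Finset.prod_fiberwise_of_maps_to (fun j _ => g.mem_range_self _) _).symm
  rw [h1]
  have h2 : ∀ c ∈ g.range, ∏ j ∈ (Finset.range n).filter (fun j => g (x j) = c), (1 + g (x j))
      = (1 + c) ^ ((Finset.range n).filter fun j => g (x j) = c).card := by
    intro c _
    rw [← Finset.prod_const]
    exact Finset.prod_congr rfl fun j hj => by rw [(Finset.mem_filter.1 hj).2]
  rw [Finset.prod_congr rfl h2]
  rw [← Finset.prod_filter_of_ne (p := fun c : ℂ => c ≠ 0)]
  · exact Finset.prod_congr rfl fun c hc => by rw [hn c hc]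
  · intro c _ h h0
    apply h; simp [h0]

end PointSequences

lemma lintegral_id_poissonMeasure (r : ℝ≥0) : ∫⁻ n : ℕ, (n : ℝ≥0∞) ∂(poissonMeasure r) = r := by
  have hs : HasSum (fun n : ℕ => Real.exp (-r) * r ^ n / n.factorial * n) (r : ℝ) := by
    rw [← hasSum_nat_add_iff' 1]
    have := (hasSum_one_poissonMeasure r).mul_left (r : ℝ)
    simp only [mul_one] at this
    have h0 : (r : ℝ) - ∑ i ∈ Finset.range 1, Real.exp (-r) * r ^ i / i.factorial * i = r := by simp
    rw [h0]
    refine this.congr_fun fun n => ?_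
    rw [Nat.factorial_succ]
    push_cast
    field_simp
    ring
  rw [poissonMeasure, lintegral_sum_measure]
  simp only [lintegral_smul_measure, lintegral_dirac, smul_eq_mul]
  have : ∀ n : ℕ, ENNReal.ofReal (Real.exp (-r) * r ^ n / n.factorial) * (n : ℝ≥0∞)
      = ENNReal.ofReal (Real.exp (-r) * r ^ n / n.factorial * n) := by
    intro n
    rw [ENNReal.ofReal_mul (by positivity), ENNReal.ofReal_natCast]
  simp_rw [this]
  rw [← ENNReal.ofReal_tsum_of_nonneg (fun n => by positivity) hs.summable, hs.tsum_eq]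
  simp

lemma integral_pow_poissonMeasure (r : ℝ≥0) (z : ℂ) :
    ∫ n : ℕ, (1 + z) ^ n ∂(poissonMeasure r) = Complex.exp (r * z) := by
  rw [integral_poissonMeasure]
  have h : HasSum (fun n : ℕ => (Real.exp (-r) * r ^ n / n.factorial : ℝ) • (1 + z) ^ n)
      (Real.exp (-r) * Complex.exp (r * (1 + z))) := by
    have := (NormedSpace.expSeries_div_hasSum_exp ((r : ℂ) * (1 + z))).mul_left
      ((Real.exp (-r) : ℝ) : ℂ)
    rw [← Complex.exp_eq_exp_ℂ] at this
    refine this.congr_fun fun n => ?_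
    rw [Complex.real_smul, mul_pow]
    push_cast
    ring
  rw [h.tsum_eq, Complex.ofReal_exp, ← Complex.exp_add]
  congr 1
  push_cast
  ring

/-! ### The Poisson process of the germs -/

section Germs

variable {Ω : Type*} [MeasurableSpace Ω] {ν : ℕ}

/-- The intensity measure of the germs is Lebesgue measure. -/
lemma IsUnitPoissonProcess.sum_map_eq_volume {u : ℕ → Ω → Eucl ν} {P : Measure Ω}
    (hu : IsUnitPoissonProcess u P) : Measure.sum (fun j => P.map (u j)) = volume := by
  have key : ∀ B : Set (Eucl ν), MeasurableSet B → volume B ≠ ∞ →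
      Measure.sum (fun j => P.map (u j)) B = volume B := by
    intro B hB hB'
    rw [← lintegral_encard_setOf_mem P hu.measurable hB,
      (hu.count_law B hB hB').lintegral_comp (f := fun n : ℕ∞ => (n : ℝ≥0∞))
        (Measurable.of_discrete).aemeasurable,
      lintegral_map .of_discrete .of_discrete]
    simp only [ENat.toENNReal_coe]
    rw [lintegral_id_poissonMeasure, ENNReal.coe_toNNReal hB']
  ext B hB
  have hm : Monotone fun n : ℕ => B ∩ Metric.ball (0 : Eucl ν) n := fun m n h =>
    Set.inter_subset_inter_right _ (Metric.ball_subset_ball (by exact_mod_cast h))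
  have hU : ⋃ n : ℕ, B ∩ Metric.ball (0 : Eucl ν) n = B := by
    rw [← Set.inter_iUnion, Metric.iUnion_ball_nat, Set.inter_univ]
  rw [← hU, hm.measure_iUnion, hm.measure_iUnion]
  congr 1 with n
  refine key _ (hB.inter measurableSet_ball) ?_
  exact ((measure_mono Set.inter_subset_right).trans_lt measure_ball_lt_top).ne

/-- The generating functional of the germs. -/
lemma IsUnitPoissonProcess.hasPoissonFunctional {u : ℕ → Ω → Eucl ν} {P : Measure Ω}
    [IsProbabilityMeasure P] (hu : IsUnitPoissonProcess u P) :
    HasPoissonFunctional u volume P := by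
  classical
  refine HasPoissonFunctional.of_simpleFunc hu.measurable hu.sum_map_eq_volume fun g hg hgi => ?_
  set s : Finset ℂ := g.range.filter (· ≠ 0) with hs
  set B : ℂ → Set (Eucl ν) := fun c => g ⁻¹' {c} with hB
  have hBm : ∀ c, MeasurableSet (B c) := fun c => g.measurableSet_fiber c
  have hBfin : ∀ c ∈ s, volume (B c) ≠ ∞ := fun c hc =>
    (SimpleFunc.measure_preimage_lt_top_of_integrable g hgi (Finset.mem_filter.1 hc).2).ne
  set N : ℂ → Ω → ℕ∞ := fun c ω => Set.encard {j | u j ω ∈ B c} with hN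
  have hNm : ∀ c, Measurable (N c) := fun c =>
    measurable_encard_setOf_mem hu.measurable (hBm c)
  have hc1 : ∀ c ∈ s, ‖1 + c‖ ≤ 1 := by
    intro c hc
    obtain ⟨x, hx⟩ := SimpleFunc.mem_range.1 (Finset.mem_filter.1 hc).1
    rw [← hx]; exact hg x
  -- Almost surely the product over all points is the finite product of the values of `1 + g`,
  -- raised to the numbers of points in the level sets of `g`.
  have hlim : Tendsto (fun n : ℕ => ∫ ω, ∏ j ∈ Finset.range n, (1 + g (u j ω)) ∂P) atTop
      (𝓝 (∫ ω, ∏ c ∈ s, (1 + c) ^ (N c ω).toNat ∂P)) := by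
    refine tendsto_integral_of_dominated_convergence (fun _ => (1 : ℝ)) (fun n => ?_)
      (integrable_const _) (fun n => ?_) ?_
    · exact (Finset.measurable_fun_prod _ fun j _ =>
        (g.measurable.comp (hu.measurable j)).const_add 1).aestronglyMeasurable
    · filter_upwards with ω
      rw [norm_prod]
      exact Finset.prod_le_one (fun _ _ => norm_nonneg _) fun i _ => hg _
    · have hfin : ∀ᵐ ω ∂P, ∀ c ∈ s, {j | u j ω ∈ B c}.Finite := by
        rw [Filter.eventually_all_finset]
        exact fun c hc =>
          ae_finite_setOf_mem hu.measurable hu.sum_map_eq_volume (hBm c) (hBfin c hc)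
      filter_upwards [hfin] with ω hω
      refine tendsto_const_nhds.congr' ?_
      filter_upwards [eventually_prod_one_add_eq g (fun j => u j ω) hω] with n hn
      exact hn.symm
  -- The counts of the level sets are independent Poisson variables.
  have hval : ∫ ω, ∏ c ∈ s, (1 + c) ^ (N c ω).toNat ∂P = Complex.exp (∫ x, g x) := by
    have hind := hu.count_indep s.card (fun i => B (s.equivFin.symm i)) (fun i => hBm _)
      (fun i => hBfin _ (s.equivFin.symm i).2) (by
        intro i i' hii'
        refine Set.disjoint_left.2 fun x hx hx' => hii' ?_
        apply s.equivFin.symm.injective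
        apply Subtype.ext
        exact (Set.mem_preimage.1 hx).symm.trans (Set.mem_preimage.1 hx'))
    have h1 : ∀ ω, ∏ c ∈ s, (1 + c) ^ (N c ω).toNat
        = ∏ i : Fin s.card, (1 + (s.equivFin.symm i : ℂ)) ^ (N (s.equivFin.symm i) ω).toNat := by
      intro ω
      rw [Equiv.prod_comp s.equivFin.symm (fun c : s => (1 + (c : ℂ)) ^ (N c ω).toNat)]
      exact (Finset.prod_coe_sort s fun c => (1 + c) ^ (N c ω).toNat).symm
    simp_rw [h1]
    rw [hind.integral_fun_prod_comp (f := fun i n => (1 + (s.equivFin.symm i : ℂ)) ^ n.toNat)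
      (fun i => (hNm _).aemeasurable) (fun i => Measurable.of_discrete.aestronglyMeasurable)]
    have h2 : ∀ c ∈ s, ∫ ω, (1 + c) ^ (N c ω).toNat ∂P
        = Complex.exp ((volume.real (B c) : ℝ) * c) := by
      intro c hc
      have := (hu.count_law (B c) (hBm c) (hBfin c hc)).integral_comp
        (f := fun n : ℕ∞ => (1 + c) ^ n.toNat) Measurable.of_discrete.aestronglyMeasurable
      rw [Function.comp_def] at this
      rw [this, integral_map .of_discrete Measurable.of_discrete.aestronglyMeasurable]
      simp only [ENat.toNat_natCast]
      rw [integral_pow_poissonMeasure]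
      rfl
    rw [Equiv.prod_comp s.equivFin.symm (fun c : s => ∫ ω, (1 + (c : ℂ)) ^ (N c ω).toNat ∂P),
      Finset.prod_coe_sort s fun c => ∫ ω, (1 + c) ^ (N c ω).toNat ∂P, Finset.prod_congr rfl h2,
      ← Complex.exp_sum, ← SimpleFunc.integral_eq_integral g hgi, SimpleFunc.integral_eq_sum_filter]
    rfl
  rw [← hval]
  exact hlim

end Germs

/-! ### Marking the germs by the grains -/

section Marking

variable {Ω : Type*} [MeasurableSpace Ω] {ν : ℕ}

/-- Integrating out the independent grains replaces a factor `g (u_j, Ξ_j)` by its mean over the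
law of the grain. -/
lemma IsBooleanModel.integral_prod_eq {u : ℕ → Ω → Eucl ν} {Ξ : ℕ → Ω → ClosedSets ν}
    {Q : Measure (ClosedSets ν)} [IsProbabilityMeasure Q] {P : Measure Ω} [IsProbabilityMeasure P]
    (h : IsBooleanModel u Ξ Q P) {g : Eucl ν × ClosedSets ν → ℂ} (hg : Measurable g)
    (hg1 : ∀ x, ‖g x‖ ≤ 1) (n : ℕ) :
    ∫ ω, ∏ j ∈ Finset.range n, g (u j ω, Ξ j ω) ∂P
      = ∫ ω, ∏ j ∈ Finset.range n, ∫ F, g (u j ω, F) ∂Q ∂P := by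
  set U : Ω → ℕ → Eucl ν := fun ω j => u j ω
  set V : Ω → ℕ → ClosedSets ν := fun ω j => Ξ j ω
  have hU : Measurable U := measurable_pi_lambda _ h.germs.measurable
  have hV : Measurable V := measurable_pi_lambda _ h.grains_measurable
  set Φ : (ℕ → Eucl ν) × (ℕ → ClosedSets ν) → ℂ :=
    fun p => ∏ j ∈ Finset.range n, g (p.1 j, p.2 j) with hΦ
  have hΦm : Measurable Φ := Finset.measurable_fun_prod _ fun j _ => hg.comp (by fun_prop)
  have hΦ1 : ∀ p, ‖Φ p‖ ≤ 1 := fun p => by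
    rw [hΦ, norm_prod]
    exact Finset.prod_le_one (fun _ _ => norm_nonneg _) fun i _ => hg1 _
  have : IsProbabilityMeasure (P.map U) := Measure.isProbabilityMeasure_map hU.aemeasurable
  have : IsProbabilityMeasure (P.map V) := Measure.isProbabilityMeasure_map hV.aemeasurable
  have hprod : P.map (fun ω => (U ω, V ω)) = (P.map U).prod (P.map V) :=
    (indepFun_iff_map_prod_eq_prod_map_map hU.aemeasurable hV.aemeasurable).1 h.germs_indep_grains
  have h1 : ∫ ω, ∏ j ∈ Finset.range n, g (u j ω, Ξ j ω) ∂P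
      = ∫ p, Φ p ∂((P.map U).prod (P.map V)) := by
    rw [← hprod, integral_map (hU.prodMk hV).aemeasurable hΦm.aestronglyMeasurable]
  rw [h1, integral_prod _ (Integrable.of_bound hΦm.aestronglyMeasurable 1
    (by filter_upwards with p using hΦ1 p))]
  have h2 : ∀ x : ℕ → Eucl ν, ∫ z, Φ (x, z) ∂(P.map V)
      = ∏ j ∈ Finset.range n, ∫ F, g (x j, F) ∂Q := by
    intro x
    have hx : Measurable fun z => Φ (x, z) := hΦm.comp measurable_prodMk_left
    rw [integral_map hV.aemeasurable hx.aestronglyMeasurable]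
    have hind : iIndepFun (fun (i : Fin n) => Ξ i) P := h.grains_indep.precomp Fin.val_injective
    have := hind.integral_fun_prod_comp (f := fun (i : Fin n) F => g (x i, F))
      (fun i => (h.grains_measurable i).aemeasurable)
      (fun i => (hg.comp measurable_prodMk_left).aestronglyMeasurable)
    simp only [hΦ, V, Finset.prod_range]
    rw [this]
    refine Finset.prod_congr rfl fun i _ => ?_
    have := (h.grains_law i).integral_comp (f := fun F => g (x i, F))
      (hg.comp measurable_prodMk_left).aestronglyMeasurable
    exact this
  simp_rw [h2]
  rw [integral_map hU.aemeasurable]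
  refine (Finset.measurable_fun_prod _ fun j _ => ?_).aestronglyMeasurable
  have hm : Measurable fun a => ∫ F, g (a, F) ∂Q :=
    (hg.stronglyMeasurable.integral_prod_right' (ν := Q)).measurable
  exact hm.comp (measurable_pi_apply j)

/-- **Marking theorem**: the germs together with their grains form a Poisson process on
`ℝ^ν × closed sets` with intensity measure `Leb ⊗ Q`. -/
theorem IsBooleanModel.hasPoissonFunctional {u : ℕ → Ω → Eucl ν} {Ξ : ℕ → Ω → ClosedSets ν}
    {Q : Measure (ClosedSets ν)} [IsProbabilityMeasure Q] {P : Measure Ω} [IsProbabilityMeasure P]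
    (h : IsBooleanModel u Ξ Q P) :
    HasPoissonFunctional (fun j ω => (u j ω, Ξ j ω)) ((volume : Measure (Eucl ν)).prod Q) P where
  measurable j := (h.germs.measurable j).prodMk (h.grains_measurable j)
  intensity := by
    rw [← h.germs.sum_map_eq_volume, Measure.prod_sum_left]
    congr 1 with j : 1
    have hind : IndepFun (u j) (Ξ j) P :=
      h.germs_indep_grains.comp (measurable_pi_apply j) (measurable_pi_apply j)
    rw [(indepFun_iff_map_prod_eq_prod_map_map (h.germs.measurable j).aemeasurable
      (h.grains_measurable j).aemeasurable).1 hind, (h.grains_law j).map_eq]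
  tendsto_prod g hg hg1 hgi := by
    simp_rw [h.integral_prod_eq hg hg1]
    have hgF : ∀ x, Integrable (fun F => g (x, F)) Q := fun x =>
      Integrable.of_bound (hg.comp measurable_prodMk_left).aestronglyMeasurable 1
        (by filter_upwards with F using hg1 _)
    have hsub : ∀ x, (∫ F, g (x, F) ∂Q) - 1 = ∫ F, (g (x, F) - 1) ∂Q := by
      intro x
      rw [integral_sub (hgF x) (integrable_const _)]
      simp
    have := h.germs.hasPoissonFunctional.tendsto_prod (fun x => ∫ F, g (x, F) ∂Q)
      (hg.stronglyMeasurable.integral_prod_right' (ν := Q)).measurable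
      (fun x => by
        refine (norm_integral_le_of_norm_le_const (C := 1)
          (by filter_upwards with F using hg1 _)).trans ?_
        simp)
      (by simp_rw [hsub]; exact hgi.integral_prod_left)
    simp_rw [hsub] at this
    rwa [integral_prod _ hgi]

end Marking

/-! ### Independence and stationarity of the counts of a Poisson process -/

section Counts

/-- The number of points `y_j` in the set `G`, as a real number; it is `0` if there are infinitely
many of them. -/
def pointCount {Ω E : Type*} (y : ℕ → Ω → E) (G : Set E) (ω : Ω) : ℝ :=
  ((Set.encard {j | y j ω ∈ G}).toNat : ℝ)

lemma pointCount_congr {Ω E : Type*} {y : ℕ → Ω → E} {G H : Set E} {ω : Ω}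
    (h : ∀ j, y j ω ∈ G ↔ y j ω ∈ H) : pointCount y G ω = pointCount y H ω := by
  unfold pointCount
  congr 3
  ext j
  exact h j

lemma sum_indicator_eq_pointCount {Ω E : Type*} {y : ℕ → Ω → E} {G : Set E} {ω : Ω}
    (hfin : {j | y j ω ∈ G}.Finite) :
    ∀ᶠ n in atTop, ∑ j ∈ Finset.range n, G.indicator (fun _ => (1 : ℝ)) (y j ω)
      = pointCount y G ω := by
  classical
  obtain ⟨b, hb⟩ := hfin.bddAbove
  filter_upwards [eventually_gt_atTop b] with n hn
  have : {j | y j ω ∈ G} = ↑((Finset.range n).filter fun j => y j ω ∈ G) := by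
    ext j
    simp only [Set.mem_ofPred_eq, Finset.coe_filter, Finset.mem_range]
    exact ⟨fun h => ⟨lt_of_le_of_lt (hb h) hn, h⟩, fun h => h.2⟩
  rw [pointCount, this, Set.encard_coe_eq_coe_finsetCard]
  simp [Set.indicator_apply, Finset.sum_boole]

lemma exists_dual_pi_apply {ι : Type*} [Fintype ι] (L : StrongDual ℝ (ι → ℝ)) :
    ∃ c : ι → ℝ, ∀ v, L v = ∑ i, c i * v i := by
  classical
  refine ⟨fun i => L (Pi.single i 1), fun v => ?_⟩
  have h : v = ∑ i, v i • (Pi.single i 1 : ι → ℝ) := by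
    ext k
    simp [Pi.single_apply]
  conv_lhs => rw [h]
  simp [map_sum, mul_comm]

variable {Ω E : Type*} [MeasurableSpace Ω] [MeasurableSpace E]

lemma measurable_pointCount {y : ℕ → Ω → E} (hy : ∀ j, Measurable (y j)) {G : Set E}
    (hG : MeasurableSet G) : Measurable (pointCount y G) :=
  (Measurable.of_discrete (f := fun n : ℕ∞ => ((n.toNat : ℕ) : ℝ))).comp
    (measurable_encard_setOf_mem hy hG)

lemma measurable_uncurry_pointCount {T : Type*} [MeasurableSpace T] {y : ℕ → Ω → E}
    (hy : ∀ j, Measurable (y j)) {S : T → Set E} (hS : MeasurableSet {q : T × E | q.2 ∈ S q.1}) :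
    Measurable (Function.uncurry fun (t : T) (ω : Ω) => pointCount y (S t) ω) := by
  have h := measurable_pointCount (y := fun j (q : T × Ω) => (q.1, y j q.2))
    (fun j => measurable_fst.prodMk ((hy j).comp measurable_snd)) hS
  exact h

/-- The probability that a set contains points is at most its intensity. -/
lemma HasPoissonFunctional.measure_exists_mem_le {P : Measure Ω} {M : Measure E}
    {y : ℕ → Ω → E} (h : HasPoissonFunctional y M P) {G : Set E}
    (hG : MeasurableSet G) : P {ω | ∃ j, y j ω ∈ G} ≤ M G := by
  have : {ω | ∃ j, y j ω ∈ G} = ⋃ j, y j ⁻¹' G := by ext; simp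
  rw [this, ← h.intensity, Measure.sum_apply _ hG]
  refine (measure_iUnion_le _).trans_eq ?_
  congr 1 with j
  rw [Measure.map_apply (h.measurable j) hG]

variable {P : Measure Ω} {M : Measure E} {y : ℕ → Ω → E}

/-- The integrand in the logarithm of the joint characteristic function of finitely many
counts. -/
lemma integrable_cexp_sum_indicator_sub_one {ι : Type*} [Fintype ι] {G : ι → Set E}
    (hG : ∀ i, MeasurableSet (G i)) (hGM : ∀ i, M (G i) ≠ ∞) (a : ι → ℝ) :
    Integrable (fun x => Complex.exp
      (((∑ i, a i * (G i).indicator (fun _ => (1 : ℝ)) x : ℝ) : ℂ) * Complex.I) - 1) M := by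
  have hm : Measurable (fun x => Complex.exp
      (((∑ i, a i * (G i).indicator (fun _ => (1 : ℝ)) x : ℝ) : ℂ) * Complex.I) - 1) := by
    refine (Complex.measurable_exp.comp
      ((Complex.measurable_ofReal.comp ?_).mul_const _)).sub_const 1
    exact Finset.measurable_fun_sum _ fun i _ => (measurable_const.indicator (hG i)).const_mul _
  have hb : Integrable (fun x => (⋃ i, G i).indicator (fun _ => (2 : ℝ)) x) M := by
    refine (integrable_indicator_iff (MeasurableSet.iUnion hG)).2 ?_
    refine integrableOn_const ?_
    exact ((measure_iUnion_le _).trans_lt (by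
      rw [tsum_fintype]; exact ENNReal.sum_lt_top.2 fun i _ => (hGM i).lt_top)).ne
  refine hb.mono' hm.aestronglyMeasurable ?_
  filter_upwards with x
  by_cases hx : x ∈ ⋃ i, G i
  · rw [Set.indicator_of_mem hx]
    refine (norm_sub_le _ _).trans ?_
    rw [Complex.norm_exp_ofReal_mul_I]
    norm_num
  · have : ∀ i, x ∉ G i := by simpa using hx
    simp [this]

lemma integrable_cexp_dual_indicator_sub_one {ι : Type*} [Fintype ι] {G : ι → Set E}
    (hG : ∀ i, MeasurableSet (G i)) (hGM : ∀ i, M (G i) ≠ ∞) (L : StrongDual ℝ (ι → ℝ)) :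
    Integrable (fun x => Complex.exp
      ((L (fun i => (G i).indicator (fun _ => (1 : ℝ)) x) : ℂ) * Complex.I) - 1) M := by
  obtain ⟨c, hc⟩ := exists_dual_pi_apply L
  simp_rw [hc]
  exact integrable_cexp_sum_indicator_sub_one hG hGM c

variable [IsProbabilityMeasure P]

/-- The joint characteristic function of the numbers of points in finitely many sets. -/
lemma HasPoissonFunctional.integral_cexp_pointCount (h : HasPoissonFunctional y M P) {ι : Type*}
    [Fintype ι] {G : ι → Set E} (hG : ∀ i, MeasurableSet (G i)) (hGM : ∀ i, M (G i) ≠ ∞)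
    (a : ι → ℝ) :
    ∫ ω, Complex.exp (((∑ i, a i * pointCount y (G i) ω : ℝ) : ℂ) * Complex.I) ∂P
      = Complex.exp (∫ x, (Complex.exp
        (((∑ i, a i * (G i).indicator (fun _ => (1 : ℝ)) x : ℝ) : ℂ) * Complex.I) - 1) ∂M) := by
  set f : E → ℝ := fun x => ∑ i, a i * (G i).indicator (fun _ => (1 : ℝ)) x with hf
  have hfm : Measurable f :=
    Finset.measurable_fun_sum _ fun i _ => (measurable_const.indicator (hG i)).const_mul _
  have hgm : Measurable fun x => Complex.exp ((f x : ℂ) * Complex.I) := by fun_prop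
  have hlim := h.tendsto_prod (fun x => Complex.exp ((f x : ℂ) * Complex.I)) hgm
    (fun x => (Complex.norm_exp_ofReal_mul_I _).le) (integrable_cexp_sum_indicator_sub_one hG hGM a)
  refine tendsto_nhds_unique ?_ hlim
  refine tendsto_integral_of_dominated_convergence (fun _ => (1 : ℝ)) (fun n => ?_)
    (integrable_const _) (fun n => ?_) ?_
  · exact (Finset.measurable_fun_prod _ fun j _ => hgm.comp (h.measurable j)).aestronglyMeasurable
  · filter_upwards with ω
    rw [norm_prod]
    exact Finset.prod_le_one (fun _ _ => norm_nonneg _)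
      fun i _ => (Complex.norm_exp_ofReal_mul_I _).le
  · have hfin : ∀ᵐ ω ∂P, ∀ i, {j | y j ω ∈ G i}.Finite :=
      ae_all_iff.2 fun i => ae_finite_setOf_mem h.measurable h.intensity (hG i) (hGM i)
    filter_upwards [hfin] with ω hω
    refine tendsto_const_nhds.congr' ?_
    filter_upwards [eventually_all.2 fun i => sum_indicator_eq_pointCount (hω i)] with n hn
    rw [← Complex.exp_sum, ← Finset.sum_mul, ← Complex.ofReal_sum]
    congr 3
    simp only [hf]
    rw [Finset.sum_comm]
    exact Finset.sum_congr rfl fun i _ => by rw [← Finset.mul_sum, hn i]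

/-- The characteristic function of the vector of counts, in dual form. -/
lemma HasPoissonFunctional.charFunDual_pointCount (h : HasPoissonFunctional y M P) {ι : Type*}
    [Fintype ι] {G : ι → Set E} (hG : ∀ i, MeasurableSet (G i)) (hGM : ∀ i, M (G i) ≠ ∞)
    (L : StrongDual ℝ (ι → ℝ)) :
    charFunDual (P.map fun ω i => pointCount y (G i) ω) L
      = Complex.exp (∫ x, (Complex.exp
        ((L (fun i => (G i).indicator (fun _ => (1 : ℝ)) x) : ℂ) * Complex.I) - 1) ∂M) := by
  obtain ⟨c, hc⟩ := exists_dual_pi_apply L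
  rw [charFunDual_apply, integral_map
    (measurable_pi_lambda _ fun i => measurable_pointCount h.measurable (hG i)).aemeasurable
    (by fun_prop)]
  simp_rw [hc]
  exact h.integral_cexp_pointCount hG hGM _

/-- The counts in sets of one family are independent of the counts in sets of another one if the
sets of the first family are disjoint from those of the second. -/
theorem HasPoissonFunctional.indepFun_pointCount (h : HasPoissonFunctional y M P) {ι κ : Type*}
    [Fintype ι] [Fintype κ] {G : ι → Set E} {H : κ → Set E} (hG : ∀ i, MeasurableSet (G i))
    (hGM : ∀ i, M (G i) ≠ ∞) (hH : ∀ k, MeasurableSet (H k)) (hHM : ∀ k, M (H k) ≠ ∞)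
    (hGH : ∀ i k, Disjoint (G i) (H k)) :
    IndepFun (fun ω i => pointCount y (G i) ω) (fun ω k => pointCount y (H k) ω) P := by
  have hmG : Measurable fun ω i => pointCount y (G i) ω :=
    measurable_pi_lambda _ fun i => measurable_pointCount h.measurable (hG i)
  have hmH : Measurable fun ω k => pointCount y (H k) ω :=
    measurable_pi_lambda _ fun i => measurable_pointCount h.measurable (hH i)
  rw [indepFun_iff_charFunDual_prod hmG.aemeasurable hmH.aemeasurable]
  intro L
  rw [h.charFunDual_pointCount hG hGM, h.charFunDual_pointCount hH hHM, ← Complex.exp_add]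
  -- Both families are read off from the family indexed by the disjoint union.
  let Λ : (ι ⊕ κ → ℝ) →L[ℝ] (ι → ℝ) × (κ → ℝ) :=
    (ContinuousLinearMap.pi fun i => ContinuousLinearMap.proj (Sum.inl i)).prod
      (ContinuousLinearMap.pi fun k => ContinuousLinearMap.proj (Sum.inr k))
  have hS := h.charFunDual_pointCount (G := Sum.elim G H)
    (by rintro (i | k); exacts [hG i, hH k]) (by rintro (i | k); exacts [hGM i, hHM k])
    (L.comp Λ)
  have h1 : charFunDual (P.map fun ω => ((fun i => pointCount y (G i) ω),
      (fun k => pointCount y (H k) ω))) L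
      = charFunDual (P.map fun ω s => pointCount y (Sum.elim G H s) ω) (L.comp Λ) := by
    rw [← charFunDual_map, Measure.map_map (by fun_prop) (measurable_pi_lambda _ fun i =>
      measurable_pointCount h.measurable (by rcases i with i | k; exacts [hG i, hH k]))]
    rfl
  rw [h1, hS]
  congr 1
  rw [← integral_add (integrable_cexp_dual_indicator_sub_one hG hGM _)
    (integrable_cexp_dual_indicator_sub_one hH hHM _)]
  congr 1 with x
  have hsplit : (L.comp Λ) (fun s => (Sum.elim G H s).indicator (fun _ => (1 : ℝ)) x)
      = L.comp (.inl ℝ _ _) (fun i => (G i).indicator (fun _ => (1 : ℝ)) x)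
        + L.comp (.inr ℝ _ _) (fun k => (H k).indicator (fun _ => (1 : ℝ)) x) := by
    simp only [ContinuousLinearMap.comp_apply, ContinuousLinearMap.inl_apply,
      ContinuousLinearMap.inr_apply]
    rw [← map_add]
    simp [Λ]
  have hL0 : L (0, 0) = 0 := map_zero L
  rw [hsplit]
  by_cases hx : ∃ i, x ∈ G i
  · obtain ⟨i, hi⟩ := hx
    have : (fun k => (H k).indicator (fun _ => (1 : ℝ)) x) = 0 := by
      ext k
      exact Set.indicator_of_notMem (Set.disjoint_left.1 (hGH i k) hi) _
    rw [this]
    simp [hL0]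
  · have : (fun i => (G i).indicator (fun _ => (1 : ℝ)) x) = 0 := by
      ext i
      exact Set.indicator_of_notMem (fun hi => hx ⟨i, hi⟩) _
    rw [this]
    simp [hL0]

/-- A transformation that preserves the intensity measure preserves the joint law of the counts. -/
theorem HasPoissonFunctional.identDistrib_pointCount_preimage (h : HasPoissonFunctional y M P)
    {τ : E → E} (hτ : MeasurePreserving τ M M) {ι : Type*} [Fintype ι] {G : ι → Set E}
    (hG : ∀ i, MeasurableSet (G i)) (hGM : ∀ i, M (G i) ≠ ∞) :
    IdentDistrib (fun ω i => pointCount y (τ ⁻¹' G i) ω) (fun ω i => pointCount y (G i) ω) P P where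
  aemeasurable_fst := (measurable_pi_lambda _ fun i =>
    measurable_pointCount h.measurable (hτ.measurable (hG i))).aemeasurable
  aemeasurable_snd := (measurable_pi_lambda _ fun i =>
    measurable_pointCount h.measurable (hG i)).aemeasurable
  map_eq := by
    refine Measure.ext_of_charFunDual ?_
    ext L
    rw [h.charFunDual_pointCount (fun i => hτ.measurable (hG i))
      (fun i => by rw [hτ.measure_preimage (hG i).nullMeasurableSet]; exact hGM i),
      h.charFunDual_pointCount hG hGM]
    congr 1
    have hm : Measurable fun x => Complex.exp
        ((L (fun i => (G i).indicator (fun _ => (1 : ℝ)) x) : ℂ) * Complex.I) - 1 := by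
      have : Measurable fun x => fun i => (G i).indicator (fun _ => (1 : ℝ)) x :=
        measurable_pi_lambda _ fun i => measurable_const.indicator (hG i)
      exact (Complex.measurable_exp.comp ((Complex.measurable_ofReal.comp
        (L.continuous.measurable.comp this)).mul_const _)).sub_const 1
    conv_rhs => rw [← hτ.map_eq]
    rw [integral_map hτ.measurable.aemeasurable hm.aestronglyMeasurable]
    rfl

/-- The void probabilities of a Poisson process. -/
lemma HasPoissonFunctional.measureReal_forall_notMem (h : HasPoissonFunctional y M P) {G : Set E}
    (hG : MeasurableSet G) (hGM : M G ≠ ∞) :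
    P.real {ω | ∀ j, y j ω ∉ G} = Real.exp (-M.real G) := by
  set g : E → ℂ := Gᶜ.indicator (fun _ => 1) with hg
  have hgm : Measurable g := measurable_const.indicator hG.compl
  have hg1 : ∀ x, g x - 1 = G.indicator (fun _ => (-1 : ℂ)) x := by
    intro x
    by_cases hx : x ∈ G <;> simp [hg, hx]
  have hlim := h.tendsto_prod g hgm (fun x => by by_cases hx : x ∈ G <;> simp [hg, hx])
    (by
      simp_rw [hg1]
      exact (integrable_indicator_iff hG).2 (integrableOn_const hGM))
  have hset : MeasurableSet {ω | ∀ j, y j ω ∉ G} := by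
    have : {ω | ∀ j, y j ω ∉ G} = ⋂ j, y j ⁻¹' Gᶜ := by ext; simp
    rw [this]
    exact MeasurableSet.iInter fun j => h.measurable j hG.compl
  have hlim2 : Tendsto (fun n : ℕ => ∫ ω, ∏ j ∈ Finset.range n, g (y j ω) ∂P) atTop
      (𝓝 (∫ ω, Set.indicator {ω | ∀ j, y j ω ∉ G} (fun _ => (1 : ℂ)) ω ∂P)) := by
    refine tendsto_integral_of_dominated_convergence (fun _ => (1 : ℝ)) (fun n => ?_)
      (integrable_const _) (fun n => ?_) ?_
    · exact (Finset.measurable_fun_prod _ fun j _ => hgm.comp (h.measurable j)).aestronglyMeasurable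
    · filter_upwards with ω
      rw [norm_prod]
      exact Finset.prod_le_one (fun _ _ => norm_nonneg _)
        fun i _ => by by_cases hx : y i ω ∈ G <;> simp [hg, hx]
    · filter_upwards with ω
      refine tendsto_const_nhds.congr' ?_
      by_cases hω : ∀ j, y j ω ∉ G
      · filter_upwards with n
        rw [Set.indicator_of_mem (by exact hω)]
        exact (Finset.prod_eq_one fun j _ => by simp [hg, hω j]).symm
      · have hω' := hω
        push Not at hω'
        obtain ⟨j, hj⟩ := hω'
        filter_upwards [eventually_gt_atTop j] with n hn
        rw [Set.indicator_of_notMem (by exact hω)]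
        exact (Finset.prod_eq_zero (Finset.mem_range.2 hn) (by simp [hg, hj])).symm
  have heq := tendsto_nhds_unique hlim2 hlim
  simp_rw [hg1] at heq
  rw [integral_indicator_const _ hset, integral_indicator_const _ hG] at heq
  have : ((P.real {ω | ∀ j, y j ω ∉ G} : ℝ) : ℂ) = ((Real.exp (-M.real G) : ℝ) : ℂ) := by
    rw [Complex.ofReal_exp]
    simpa using heq
  exact_mod_cast this

end Counts

/-! ### The grains that cover a point -/

section CoverSets

variable {ν : ℕ}

lemma measurableSet_hits_of_isOpen {G : Set (Eucl ν)} (hG : IsOpen G) :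
    MeasurableSet {F : ClosedSets ν | ((F : Set (Eucl ν)) ∩ G).Nonempty} := by
  refine MeasurableSpace.measurableSet_generateFrom ?_
  exact TopologicalSpace.isOpen_generateFrom_of_mem (Or.inr ⟨G, hG, rfl⟩)

/-- Membership of a point in a closed set is jointly measurable for the Fell Borel σ-algebra. -/
lemma measurableSet_mem_closedSets :
    MeasurableSet {p : ClosedSets ν × Eucl ν | p.2 ∈ (p.1 : Set (Eucl ν))} := by
  -- A point belongs to a closed set iff arbitrarily small balls around points of a countable dense
  -- set contain the point and hit the set.
  have h : {p : ClosedSets ν × Eucl ν | p.2 ∈ (p.1 : Set (Eucl ν))}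
      = ⋂ n : ℕ, ⋃ i : ℕ,
        {F : ClosedSets ν | ((F : Set (Eucl ν)) ∩
          Metric.ball (TopologicalSpace.denseSeq (Eucl ν) i) (1 / (n + 1 : ℝ))).Nonempty} ×ˢ
        Metric.ball (TopologicalSpace.denseSeq (Eucl ν) i) (1 / (n + 1 : ℝ)) := by
    ext ⟨F, t⟩
    simp only [Set.mem_ofPred_eq, Set.mem_iInter, Set.mem_iUnion, Set.mem_prod]
    constructor
    · intro ht n
      obtain ⟨i, hi⟩ := (TopologicalSpace.denseRange_denseSeq (Eucl ν)).exists_dist_lt t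
        (ε := 1 / (n + 1 : ℝ)) (by positivity)
      exact ⟨i, ⟨t, ht, hi⟩, hi⟩
    · intro ht
      rw [← F.isClosed.closure_eq, Metric.mem_closure_iff]
      intro ε hε
      obtain ⟨n, hn⟩ := exists_nat_one_div_lt (half_pos hε)
      obtain ⟨i, ⟨z, hz, hzi⟩, hti⟩ := ht n
      refine ⟨z, hz, ?_⟩
      rw [Metric.mem_ball] at hzi hti
      calc dist t z ≤ dist t _ + dist z _ := dist_triangle_right _ _ _
        _ < ε := by linarith
  rw [h]
  exact MeasurableSet.iInter fun n => MeasurableSet.iUnion fun i =>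
    (measurableSet_hits_of_isOpen Metric.isOpen_ball).prod measurableSet_ball

/-- The germ-grain pairs `(x, F)` whose grain `x + F` covers the point `t`. -/
def coverSet (t : Eucl ν) : Set (Eucl ν × ClosedSets ν) := {p | t - p.1 ∈ (p.2 : Set (Eucl ν))}

/-- The germ-grain pairs that cover `t` and whose germ is at distance at most `R` from `t`. -/
def nearCoverSet (R : ℝ) (t : Eucl ν) : Set (Eucl ν × ClosedSets ν) :=
  coverSet t ∩ {p | dist p.1 t ≤ R}

lemma measurableSet_setOf_mem_coverSet :
    MeasurableSet {q : Eucl ν × (Eucl ν × ClosedSets ν) | q.2 ∈ coverSet q.1} := by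
  have : Measurable fun q : Eucl ν × (Eucl ν × ClosedSets ν) => (q.2.2, q.1 - q.2.1) := by fun_prop
  exact this measurableSet_mem_closedSets

lemma measurableSet_setOf_mem_nearCoverSet (R : ℝ) :
    MeasurableSet {q : Eucl ν × (Eucl ν × ClosedSets ν) | q.2 ∈ nearCoverSet R q.1} := by
  refine measurableSet_setOf_mem_coverSet.inter ?_
  exact measurableSet_le (by fun_prop) measurable_const

lemma measurableSet_coverSet (t : Eucl ν) : MeasurableSet (coverSet t) :=
  measurable_prodMk_left measurableSet_setOf_mem_coverSet

lemma measurableSet_nearCoverSet (R : ℝ) (t : Eucl ν) : MeasurableSet (nearCoverSet R t) :=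
  measurable_prodMk_left (measurableSet_setOf_mem_nearCoverSet R)

lemma nearCoverSet_subset (R : ℝ) (t : Eucl ν) : nearCoverSet R t ⊆ coverSet t :=
  Set.inter_subset_left

lemma disjoint_nearCoverSet {R : ℝ} {s t : Eucl ν} (h : 2 * R < dist s t) :
    Disjoint (nearCoverSet R s) (nearCoverSet R t) := by
  refine Set.disjoint_left.2 fun p hp hp' => ?_
  have h1 : dist p.1 s ≤ R := hp.2
  have h2 : dist p.1 t ≤ R := hp'.2
  linarith [dist_triangle_left s t p.1]

/-- The translation of the germs by `-s`. -/
def germShift (s : Eucl ν) (p : Eucl ν × ClosedSets ν) : Eucl ν × ClosedSets ν := (p.1 - s, p.2)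

lemma germShift_preimage_coverSet (s t : Eucl ν) :
    germShift s ⁻¹' coverSet t = coverSet (t + s) := by
  ext p
  simp only [germShift, coverSet, Set.mem_preimage, Set.mem_ofPred_eq]
  rw [show t - (p.1 - s) = t + s - p.1 by abel]

lemma germShift_preimage_nearCoverSet (R : ℝ) (s t : Eucl ν) :
    germShift s ⁻¹' nearCoverSet R t = nearCoverSet R (t + s) := by
  rw [nearCoverSet, nearCoverSet, Set.preimage_inter, germShift_preimage_coverSet]
  congr 1
  ext p
  simp only [germShift, Set.mem_preimage, Set.mem_ofPred_eq, dist_eq_norm]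
  rw [show p.1 - s - t = p.1 - (t + s) by abel]

variable (Q : Measure (ClosedSets ν))

/-- The mean overlap `E Leb(Ξ ∩ (Ξ - t))` as an extended nonnegative number. -/
def overlap (t : Eucl ν) : ℝ≥0∞ :=
  ∫⁻ F, volume ((F : Set (Eucl ν)) ∩ (-t +ᵥ (F : Set (Eucl ν)))) ∂Q

lemma meanOverlap_eq (t : Eucl ν) : meanOverlap Q t = (overlap Q t).toReal := rfl

lemma meanOverlap_nonneg (t : Eucl ν) : 0 ≤ meanOverlap Q t := ENNReal.toReal_nonneg

variable [IsProbabilityMeasure Q]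

lemma measurePreserving_germShift (s : Eucl ν) :
    MeasurePreserving (germShift s) ((volume : Measure (Eucl ν)).prod Q)
      ((volume : Measure (Eucl ν)).prod Q) :=
  (measurePreserving_sub_right volume s).prod (MeasurePreserving.id Q)

lemma measure_coverSet (t : Eucl ν) : ((volume : Measure (Eucl ν)).prod Q) (coverSet t)
    = ∫⁻ F, volume (F : Set (Eucl ν)) ∂Q := by
  rw [Measure.prod_apply_symm (measurableSet_coverSet t)]
  congr 1 with F
  exact (Measure.measurePreserving_sub_left volume t).measure_preimage
    F.isClosed.measurableSet.nullMeasurableSet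

lemma measure_coverSet_inter (s t : Eucl ν) :
    ((volume : Measure (Eucl ν)).prod Q) (coverSet s ∩ coverSet t) = overlap Q (t - s) := by
  rw [Measure.prod_apply_symm ((measurableSet_coverSet s).inter (measurableSet_coverSet t)),
    overlap]
  congr 1 with F
  rw [← (Measure.measurePreserving_sub_left volume s).measure_preimage
    (F.isClosed.measurableSet.inter
      (F.isClosed.measurableSet.const_vadd (-(t - s)))).nullMeasurableSet]
  congr 1 with x
  simp only [coverSet, Set.mem_preimage, Set.mem_inter_iff, Set.mem_ofPred_eq,
    Set.mem_vadd_set_iff_neg_vadd_mem, neg_neg, vadd_eq_add]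
  rw [show t - s + (s - x) = t - x by abel]

lemma lintegral_volume_lt_top (hQ : ∫⁻ F, volume (F : Set (Eucl ν)) ^ 2 ∂Q < ∞) :
    ∫⁻ F, volume (F : Set (Eucl ν)) ∂Q < ∞ := by
  calc _ ≤ ∫⁻ F, (1 + volume (F : Set (Eucl ν)) ^ 2) ∂Q := by
        refine lintegral_mono fun F => ?_
        rcases le_total (volume (F : Set (Eucl ν))) 1 with h | h
        · exact h.trans le_self_add
        · exact (le_self_pow h two_ne_zero).trans le_add_self
    _ < ∞ := by
        rw [lintegral_add_left measurable_const]
        simpa using hQ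

lemma measurableSet_overlap : MeasurableSet {q : (Eucl ν × ClosedSets ν) × Eucl ν |
    q.2 ∈ (q.1.2 : Set (Eucl ν)) ∩ (-q.1.1 +ᵥ (q.1.2 : Set (Eucl ν)))} := by
  have h1 : Measurable fun q : (Eucl ν × ClosedSets ν) × Eucl ν => (q.1.2, q.2) := by fun_prop
  have h2 : Measurable fun q : (Eucl ν × ClosedSets ν) × Eucl ν => (q.1.2, q.1.1 + q.2) := by
    fun_prop
  convert (h1 measurableSet_mem_closedSets).inter (h2 measurableSet_mem_closedSets) using 1
  ext q
  simp [Set.mem_vadd_set_iff_neg_vadd_mem]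

lemma measurable_overlap : Measurable (overlap Q) := by
  have h := measurable_measure_prodMk_left (ν := (volume : Measure (Eucl ν)))
    (measurableSet_overlap (ν := ν))
  exact h.lintegral_prod_right' (ν := Q)

lemma lintegral_overlap : ∫⁻ t, overlap Q t = ∫⁻ F, volume (F : Set (Eucl ν)) ^ 2 ∂Q := by
  have h := measurable_measure_prodMk_left (ν := (volume : Measure (Eucl ν)))
    (measurableSet_overlap (ν := ν))
  unfold overlap
  rw [lintegral_lintegral_swap (f := fun (t : Eucl ν) (F : ClosedSets ν) =>
    volume ((F : Set (Eucl ν)) ∩ (-t +ᵥ (F : Set (Eucl ν))))) h.aemeasurable]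
  congr 1 with F
  set S : Set (Eucl ν) := (F : Set (Eucl ν))
  have hS : MeasurableSet S := F.isClosed.measurableSet
  have hm : MeasurableSet {q : Eucl ν × Eucl ν | q.2 ∈ S ∧ q.1 + q.2 ∈ S} :=
    (measurable_snd hS).inter ((measurable_fst.add measurable_snd) hS)
  have h1 : ∀ t : Eucl ν, volume (S ∩ (-t +ᵥ S)) = volume (Prod.mk t ⁻¹' {q : Eucl ν × Eucl ν |
      q.2 ∈ S ∧ q.1 + q.2 ∈ S}) := by
    intro t
    congr 1 with x
    simp [Set.mem_vadd_set_iff_neg_vadd_mem]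
  simp_rw [h1]
  rw [← Measure.prod_apply hm, Measure.prod_apply_symm hm]
  have h2 : ∀ x, volume ((fun t => (t, x)) ⁻¹' {q : Eucl ν × Eucl ν | q.2 ∈ S ∧ q.1 + q.2 ∈ S})
      = S.indicator (fun _ => volume S) x := by
    intro x
    by_cases hx : x ∈ S
    · rw [Set.indicator_of_mem hx, ← (measurePreserving_add_right volume x).measure_preimage
        hS.nullMeasurableSet]
      congr 1 with t
      simp [hx]
    · simp [hx]
  simp_rw [h2]
  rw [lintegral_indicator hS, lintegral_const, Measure.restrict_apply_univ, sq]

lemma integrable_meanOverlap (hQ : ∫⁻ F, volume (F : Set (Eucl ν)) ^ 2 ∂Q < ∞) :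
    Integrable (meanOverlap Q) := by
  refine integrable_toReal_of_lintegral_ne_top (measurable_overlap Q).aemeasurable ?_
  exact (lintegral_overlap Q).trans_ne hQ.ne

/-- The intensity of the far germs whose grains cover a given point. -/
def farIntensity (R : ℝ) : ℝ≥0∞ :=
  ((volume : Measure (Eucl ν)).prod Q) (coverSet 0 \ nearCoverSet R 0)

lemma measure_coverSet_diff (R : ℝ) (t : Eucl ν) :
    ((volume : Measure (Eucl ν)).prod Q) (coverSet t \ nearCoverSet R t) = farIntensity Q R := by
  rw [farIntensity, ← (measurePreserving_germShift Q t).measure_preimage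
    ((measurableSet_coverSet 0).diff (measurableSet_nearCoverSet R 0)).nullMeasurableSet,
    Set.preimage_sdiff, germShift_preimage_coverSet, germShift_preimage_nearCoverSet, zero_add]

lemma tendsto_farIntensity (hQ : ∫⁻ F, volume (F : Set (Eucl ν)) ^ 2 ∂Q < ∞) :
    Tendsto (fun n : ℕ => farIntensity Q n) atTop (𝓝 0) := by
  have h := tendsto_measure_iInter_atTop (μ := (volume : Measure (Eucl ν)).prod Q)
    (s := fun n : ℕ => coverSet (0 : Eucl ν) \ nearCoverSet n 0)
    (fun n => ((measurableSet_coverSet 0).diff (measurableSet_nearCoverSet n 0)).nullMeasurableSet)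
    (fun m n hmn => Set.sdiff_subset_sdiff_right
      (Set.inter_subset_inter_right _ fun p (hp : dist p.1 0 ≤ m) =>
        le_trans hp (by exact_mod_cast hmn : (m : ℝ) ≤ n)))
    ⟨0, ((measure_mono Set.sdiff_subset).trans_lt
      (by rw [measure_coverSet]; exact lintegral_volume_lt_top Q hQ)).ne⟩
  have h0 : ⋂ n : ℕ, coverSet (0 : Eucl ν) \ nearCoverSet (n : ℝ) 0 = ∅ := by
    refine Set.eq_empty_iff_forall_notMem.2 fun p hp => ?_
    obtain ⟨n, hn⟩ := exists_nat_ge (dist p.1 0)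
    have := Set.mem_iInter.1 hp n
    exact this.2 ⟨this.1, hn⟩
  rw [h0, measure_empty] at h
  exact h

end CoverSets

/-! ### Covering fields and their covariances -/

/-- If two bounded random variables agree, off an event, with two independent ones, then their
covariance is controlled by the probability of the event. -/
lemma abs_covariance_le_of_indepFun {Ω : Type*} [MeasurableSpace Ω] {P : Measure Ω}
    [IsProbabilityMeasure P] {X Y X' Y' : Ω → ℝ} (hX : Measurable X) (hY : Measurable Y)
    (hX' : Measurable X') (hY' : Measurable Y') (bX : ∀ ω, |X ω| ≤ 1) (bY : ∀ ω, |Y ω| ≤ 1)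
    (bX' : ∀ ω, |X' ω| ≤ 1) (bY' : ∀ ω, |Y' ω| ≤ 1) {e : Set Ω} (he : MeasurableSet e)
    (hXX : ∀ ω, ω ∉ e → X ω = X' ω) (hYY : ∀ ω, ω ∉ e → Y ω = Y' ω) (hind : IndepFun X' Y' P) :
    |covariance X Y P| ≤ 6 * P.real e := by
  have int : ∀ {Z : Ω → ℝ}, Measurable Z → (∀ ω, |Z ω| ≤ 1) → Integrable Z P := fun hZ bZ =>
    Integrable.of_bound hZ.aestronglyMeasurable 1 (ae_of_all _ bZ)
  have mem : ∀ {Z : Ω → ℝ}, Measurable Z → (∀ ω, |Z ω| ≤ 1) → MemLp Z 2 P := fun hZ bZ =>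
    MemLp.of_bound hZ.aestronglyMeasurable 1 (ae_of_all _ bZ)
  have key : ∀ {Z Z' : Ω → ℝ}, Measurable Z → Measurable Z' → (∀ ω, |Z ω| ≤ 1) →
      (∀ ω, |Z' ω| ≤ 1) → (∀ ω, ω ∉ e → Z ω = Z' ω) →
      |∫ ω, Z ω ∂P - ∫ ω, Z' ω ∂P| ≤ 2 * P.real e := by
    intro Z Z' hZ hZ' bZ bZ' hZZ
    rw [← integral_sub (int hZ bZ) (int hZ' bZ')]
    calc |∫ ω, (Z ω - Z' ω) ∂P| ≤ ∫ ω, |Z ω - Z' ω| ∂P := abs_integral_le_integral_abs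
      _ ≤ ∫ ω, e.indicator (fun _ => (2 : ℝ)) ω ∂P := by
          refine integral_mono ((int hZ bZ).sub (int hZ' bZ')).abs
            ((integrable_const _).indicator he) fun ω => ?_
          by_cases hω : ω ∈ e
          · simp only [Set.indicator_of_mem hω]
            exact (abs_sub _ _).trans (by linarith [bZ ω, bZ' ω])
          · simp [hZZ ω hω, hω]
      _ = 2 * P.real e := by
          rw [integral_indicator_const _ he, smul_eq_mul, mul_comm]
  have bmul : ∀ {a b : ℝ}, |a| ≤ 1 → |b| ≤ 1 → |a * b| ≤ 1 := fun ha hb => by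
    rw [abs_mul]; exact mul_le_one₀ ha (abs_nonneg _) hb
  have bint : ∀ {Z : Ω → ℝ}, (∀ ω, |Z ω| ≤ 1) → |∫ ω, Z ω ∂P| ≤ 1 := fun {Z} bZ => by
    simpa using norm_integral_le_of_norm_le_const (μ := P) (C := 1)
      (ae_of_all P fun ω => (Real.norm_eq_abs (Z ω)).trans_le (bZ ω))
  have h1 := key (hX.mul hY) (hX'.mul hY') (fun ω => bmul (bX ω) (bY ω))
    (fun ω => bmul (bX' ω) (bY' ω))
    (fun ω hω => by rw [Pi.mul_apply, Pi.mul_apply, hXX ω hω, hYY ω hω])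
  have h2 := key hX hX' bX bX' hXX
  have h3 := key hY hY' bY bY' hYY
  have h4 : ∫ ω, (X' * Y') ω ∂P = (∫ ω, X' ω ∂P) * ∫ ω, Y' ω ∂P :=
    hind.integral_mul_eq_mul_integral hX'.aestronglyMeasurable hY'.aestronglyMeasurable
  rw [h4] at h1
  rw [covariance_eq_sub (mem hX bX) (mem hY bY)]
  have h5 : (∫ ω, (X * Y) ω ∂P) - (∫ ω, X ω ∂P) * ∫ ω, Y ω ∂P
      = ((∫ ω, (X * Y) ω ∂P) - (∫ ω, X' ω ∂P) * ∫ ω, Y' ω ∂P)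
        - (∫ ω, X ω ∂P - ∫ ω, X' ω ∂P) * (∫ ω, Y' ω ∂P)
        - (∫ ω, X ω ∂P) * (∫ ω, Y ω ∂P - ∫ ω, Y' ω ∂P) := by ring
  rw [h5]
  have h6 : |(∫ ω, X ω ∂P - ∫ ω, X' ω ∂P) * (∫ ω, Y' ω ∂P)| ≤ 2 * P.real e := by
    rw [abs_mul]
    calc _ ≤ (2 * P.real e) * 1 := by gcongr; exact bint bY'
      _ = _ := mul_one _
  have h7 : |(∫ ω, X ω ∂P) * (∫ ω, Y ω ∂P - ∫ ω, Y' ω ∂P)| ≤ 2 * P.real e := by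
    rw [abs_mul]
    calc _ ≤ 1 * (2 * P.real e) := by gcongr; exact bint bX
      _ = _ := one_mul _
  refine (abs_sub _ _).trans ?_
  refine (add_le_add (abs_sub _ _) le_rfl).trans ?_
  linarith

section Fields

variable {Ω : Type*} [MeasurableSpace Ω] {ν : ℕ}

/-- A random field whose value at `t` is the function `f` of the number of grains that cover `t`
and have their germ at distance at most `R` from `t`, and of the number of all grains that
cover `t`. -/
def coverField (u : ℕ → Ω → Eucl ν) (Ξ : ℕ → Ω → ClosedSets ν) (f : ℝ × ℝ → ℝ) (R : ℝ)
    (t : Eucl ν) (ω : Ω) : ℝ :=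
  f (pointCount (fun j ω => (u j ω, Ξ j ω)) (nearCoverSet R t) ω,
    pointCount (fun j ω => (u j ω, Ξ j ω)) (coverSet t) ω)

variable {u : ℕ → Ω → Eucl ν} {Ξ : ℕ → Ω → ClosedSets ν} {Q : Measure (ClosedSets ν)}
  [IsProbabilityMeasure Q] {P : Measure Ω} [IsProbabilityMeasure P]

lemma IsBooleanModel.measurable_coverField (h : IsBooleanModel u Ξ Q P) {f : ℝ × ℝ → ℝ}
    (hf : Measurable f) (R : ℝ) : Measurable (Function.uncurry (coverField u Ξ f R)) := by
  have h1 := measurable_uncurry_pointCount h.hasPoissonFunctional.measurable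
    (measurableSet_setOf_mem_nearCoverSet (ν := ν) R)
  have h2 := measurable_uncurry_pointCount h.hasPoissonFunctional.measurable
    (measurableSet_setOf_mem_coverSet (ν := ν))
  exact hf.comp (h1.prodMk h2)

lemma IsBooleanModel.measurable_coverField_apply (h : IsBooleanModel u Ξ Q P) {f : ℝ × ℝ → ℝ}
    (hf : Measurable f) (R : ℝ) (t : Eucl ν) : Measurable (coverField u Ξ f R t) :=
  (h.measurable_coverField hf R).of_uncurry_left

lemma measure_coverSet_ne_top (hQ : ∫⁻ F, volume (F : Set (Eucl ν)) ^ 2 ∂Q < ∞) (t : Eucl ν) :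
    ((volume : Measure (Eucl ν)).prod Q) (coverSet t) ≠ ∞ := by
  rw [measure_coverSet]
  exact (lintegral_volume_lt_top Q hQ).ne

lemma measure_nearCoverSet_ne_top (hQ : ∫⁻ F, volume (F : Set (Eucl ν)) ^ 2 ∂Q < ∞) (R : ℝ)
    (t : Eucl ν) : ((volume : Measure (Eucl ν)).prod Q) (nearCoverSet R t) ≠ ∞ :=
  ((measure_mono (nearCoverSet_subset R t)).trans_lt (measure_coverSet_ne_top hQ t).lt_top).ne

/-- Stationarity of the covering fields. -/
lemma IsBooleanModel.identDistrib_coverField (h : IsBooleanModel u Ξ Q P)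
    (hQ : ∫⁻ F, volume (F : Set (Eucl ν)) ^ 2 ∂Q < ∞) {f : ℝ × ℝ → ℝ} (hf : Measurable f) (R : ℝ)
    (s t : Eucl ν) :
    IdentDistrib (fun ω => (coverField u Ξ f R s ω, coverField u Ξ f R t ω))
      (fun ω => (coverField u Ξ f R 0 ω, coverField u Ξ f R (t - s) ω)) P P := by
  set G : Fin 4 → Set (Eucl ν × ClosedSets ν) :=
    ![nearCoverSet R 0, coverSet 0, nearCoverSet R (t - s), coverSet (t - s)] with hG
  have h1 := h.hasPoissonFunctional.identDistrib_pointCount_preimage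
    (measurePreserving_germShift Q s) (G := G)
    (by
      intro i
      fin_cases i
      exacts [measurableSet_nearCoverSet _ _, measurableSet_coverSet _,
        measurableSet_nearCoverSet _ _, measurableSet_coverSet _])
    (by
      intro i
      fin_cases i
      exacts [measure_nearCoverSet_ne_top hQ _ _, measure_coverSet_ne_top hQ _,
        measure_nearCoverSet_ne_top hQ _ _, measure_coverSet_ne_top hQ _])
  have h2 := h1.comp (u := fun v : Fin 4 → ℝ => (f (v 0, v 1), f (v 2, v 3))) (by fun_prop)
  have e : (fun ω => (coverField u Ξ f R s ω, coverField u Ξ f R t ω))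
      = (fun v : Fin 4 → ℝ => (f (v 0, v 1), f (v 2, v 3))) ∘
        (fun ω i => pointCount (fun j ω => (u j ω, Ξ j ω)) (germShift s ⁻¹' G i) ω) := by
    ext ω <;> simp [hG, coverField, germShift_preimage_nearCoverSet, germShift_preimage_coverSet]
  rw [e]
  exact h2

/-- Covariances of covering fields are bounded by the mean overlap: the counts at two points are
independent once the grains covering both points are removed. -/
lemma IsBooleanModel.abs_covariance_coverField_le (h : IsBooleanModel u Ξ Q P)
    (hQ : ∫⁻ F, volume (F : Set (Eucl ν)) ^ 2 ∂Q < ∞) {f : ℝ × ℝ → ℝ} (hf : Measurable f)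
    (hf1 : ∀ x, |f x| ≤ 1) (R : ℝ) (s t : Eucl ν) :
    |covariance (coverField u Ξ f R s) (coverField u Ξ f R t) P| ≤ 6 * meanOverlap Q (t - s) := by
  set y : ℕ → Ω → Eucl ν × ClosedSets ν := fun j ω => (u j ω, Ξ j ω) with hy
  have hP : HasPoissonFunctional y ((volume : Measure (Eucl ν)).prod Q) P := h.hasPoissonFunctional
  set e : Set Ω := {ω | ∃ j, y j ω ∈ coverSet s ∩ coverSet t} with he
  have hCm : MeasurableSet (coverSet s ∩ coverSet t) :=
    (measurableSet_coverSet s).inter (measurableSet_coverSet t)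
  have hem : MeasurableSet e := by
    have : e = ⋃ j, y j ⁻¹' (coverSet s ∩ coverSet t) := by ext; simp [he]
    rw [this]
    exact MeasurableSet.iUnion fun j => hP.measurable j hCm
  have hPe : P.real e ≤ meanOverlap Q (t - s) := by
    rw [meanOverlap_eq, ← measure_coverSet_inter]
    refine ENNReal.toReal_mono ?_ (hP.measure_exists_mem_le hCm)
    exact ((measure_mono Set.inter_subset_left).trans_lt (measure_coverSet_ne_top hQ s).lt_top).ne
  have hm : ∀ a b : Eucl ν, ∀ i : Fin 2,
      MeasurableSet (![nearCoverSet R a \ coverSet b, coverSet a \ coverSet b] i) := by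
    intro a b i
    fin_cases i
    exacts [(measurableSet_nearCoverSet R a).diff (measurableSet_coverSet b),
      (measurableSet_coverSet a).diff (measurableSet_coverSet b)]
  have hM : ∀ a b : Eucl ν, ∀ i : Fin 2, ((volume : Measure (Eucl ν)).prod Q)
      (![nearCoverSet R a \ coverSet b, coverSet a \ coverSet b] i) ≠ ∞ := by
    intro a b i
    refine ((measure_mono ?_).trans_lt (measure_coverSet_ne_top hQ a).lt_top).ne
    fin_cases i
    exacts [Set.sdiff_subset.trans (nearCoverSet_subset R a), Set.sdiff_subset]
  have hind := hP.indepFun_pointCount (hm s t) (hM s t) (hm t s) (hM t s) (by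
    have hd : Disjoint (coverSet s \ coverSet t) (coverSet t \ coverSet s) :=
      Set.disjoint_left.2 fun p hp hp' => hp.2 hp'.1
    have hs : ∀ a b : Eucl ν, ∀ i : Fin 2,
        ![nearCoverSet R a \ coverSet b, coverSet a \ coverSet b] i ⊆ coverSet a \ coverSet b := by
      intro a b i
      fin_cases i
      exacts [Set.sdiff_subset_sdiff_left (nearCoverSet_subset R a), subset_rfl]
    exact fun i k => hd.mono (hs s t i) (hs t s k))
  have hF : Measurable fun v : Fin 2 → ℝ => f (v 0, v 1) := by fun_prop
  have hind' := hind.comp hF hF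
  have hagree : ∀ a b : Eucl ν, ∀ ω, ω ∉ {ω | ∃ j, y j ω ∈ coverSet a ∩ coverSet b} →
      coverField u Ξ f R a ω = f (pointCount y (nearCoverSet R a \ coverSet b) ω,
        pointCount y (coverSet a \ coverSet b) ω) := by
    intro a b ω hω
    have hω' : ∀ j, y j ω ∈ coverSet a → y j ω ∉ coverSet b := fun j ha hb => hω ⟨j, ha, hb⟩
    have e1 : pointCount y (nearCoverSet R a) ω = pointCount y (nearCoverSet R a \ coverSet b) ω :=
      pointCount_congr fun j => ⟨fun hj => ⟨hj, hω' j (nearCoverSet_subset R a hj)⟩, fun hj => hj.1⟩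
    have e2 : pointCount y (coverSet a) ω = pointCount y (coverSet a \ coverSet b) ω :=
      pointCount_congr fun j => ⟨fun hj => ⟨hj, hω' j hj⟩, fun hj => hj.1⟩
    rw [← e1, ← e2]
    rfl
  have hmeas : ∀ a b : Eucl ν, Measurable fun ω =>
      f (pointCount y (nearCoverSet R a \ coverSet b) ω,
        pointCount y (coverSet a \ coverSet b) ω) := fun a b =>
    hf.comp ((measurable_pointCount hP.measurable (hm a b 0)).prodMk
      (measurable_pointCount hP.measurable (hm a b 1)))
  refine (abs_covariance_le_of_indepFun (h.measurable_coverField_apply hf R s)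
    (h.measurable_coverField_apply hf R t) (hmeas s t) (hmeas t s) (fun _ => hf1 _) (fun _ => hf1 _)
    (fun _ => hf1 _) (fun _ => hf1 _) hem (fun ω hω => hagree s t ω hω) (fun ω hω => ?_)
    hind').trans
    (by linarith)
  refine hagree t s ω ?_
  rintro ⟨j, h1, h2⟩
  exact hω ⟨j, h2, h1⟩

/-- Near covering fields have finite range of dependence: the values at points of a finite family
are independent of the values at points of another one at distance more than `2 R` from it. -/
lemma IsBooleanModel.indepFun_coverField (h : IsBooleanModel u Ξ Q P)
    (hQ : ∫⁻ F, volume (F : Set (Eucl ν)) ^ 2 ∂Q < ∞) {f : ℝ → ℝ} (hf : Measurable f) (R : ℝ)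
    {ι κ : Type*} [Fintype ι] [Fintype κ] (s : ι → Eucl ν) (t : κ → Eucl ν)
    (hst : ∀ i k, 2 * R < dist (s i) (t k)) :
    IndepFun (fun ω i => coverField u Ξ (fun x => f x.1) R (s i) ω)
      (fun ω k => coverField u Ξ (fun x => f x.1) R (t k) ω) P := by
  have hind := h.hasPoissonFunctional.indepFun_pointCount
    (G := fun i => nearCoverSet R (s i)) (H := fun k => nearCoverSet R (t k))
    (fun i => measurableSet_nearCoverSet R _) (fun i => measure_nearCoverSet_ne_top hQ R _)
    (fun i => measurableSet_nearCoverSet R _) (fun i => measure_nearCoverSet_ne_top hQ R _)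
    (fun i k => disjoint_nearCoverSet (hst i k))
  exact hind.comp (φ := fun v i => f (v i)) (ψ := fun v k => f (v k)) (by fun_prop) (by fun_prop)

/-- The probability that the near count differs from the full count. -/
lemma IsBooleanModel.measureReal_pointCount_ne_le (h : IsBooleanModel u Ξ Q P)
    (hQ : ∫⁻ F, volume (F : Set (Eucl ν)) ^ 2 ∂Q < ∞) (R : ℝ) (t : Eucl ν) :
    P.real {ω | pointCount (fun j ω => (u j ω, Ξ j ω)) (nearCoverSet R t) ω
      ≠ pointCount (fun j ω => (u j ω, Ξ j ω)) (coverSet t) ω} ≤ (farIntensity Q R).toReal := by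
  rw [← measure_coverSet_diff Q R t]
  refine ENNReal.toReal_mono ?_ ((measure_mono ?_).trans
    (h.hasPoissonFunctional.measure_exists_mem_le
    ((measurableSet_coverSet t).diff (measurableSet_nearCoverSet R t))))
  · exact ((measure_mono Set.sdiff_subset).trans_lt (measure_coverSet_ne_top hQ t).lt_top).ne
  · intro ω hω
    by_contra hcon
    refine hω (pointCount_congr fun j => ⟨fun hj => nearCoverSet_subset R t hj, fun hj => ?_⟩)
    by_contra hj'
    exact hcon ⟨j, hj, hj'⟩

end Fields

/-! ### Integrals of random fields -/

section RandomIntegrals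

variable {Ω T : Type*} [MeasurableSpace Ω] [MeasurableSpace T] {P : Measure Ω}
  [IsProbabilityMeasure P] {μ : Measure T} [SigmaFinite μ]

lemma integrable_prod_of_bound {A E : Type*} [MeasurableSpace A] [NormedAddCommGroup E]
    {κ : Measure A} [SFinite κ] {F : A → Ω → E}
    (hF : AEStronglyMeasurable (Function.uncurry F) (κ.prod P)) {f : A → ℝ} (hf : Integrable f κ)
    (h : ∀ a ω, ‖F a ω‖ ≤ f a) : Integrable (Function.uncurry F) (κ.prod P) :=
  (hf.comp_fst P).mono' hF (ae_of_all _ fun q => h q.1 q.2)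

lemma measurable_integral_left {F : T → Ω → ℝ} (hF : Measurable (Function.uncurry F)) :
    Measurable fun ω => ∫ t, F t ω ∂μ :=
  (hF.stronglyMeasurable.integral_prod_left' (μ := μ)).measurable

/-- The expected product of two integrals of random fields. -/
lemma integral_mul_integral_eq {F G : T → Ω → ℝ} (hF : Measurable (Function.uncurry F))
    (hG : Measurable (Function.uncurry G)) {f g : T → ℝ} (hf : Integrable f μ)
    (hg : Integrable g μ) (hFf : ∀ t ω, |F t ω| ≤ f t) (hGg : ∀ t ω, |G t ω| ≤ g t) :
    ∫ ω, (∫ t, F t ω ∂μ) * (∫ t, G t ω ∂μ) ∂P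
      = ∫ z : T × T, (∫ ω, F z.1 ω * G z.2 ω ∂P) ∂(μ.prod μ) := by
  have h1 : ∀ ω, (∫ t, F t ω ∂μ) * (∫ t, G t ω ∂μ)
      = ∫ z : T × T, F z.1 ω * G z.2 ω ∂(μ.prod μ) := fun ω =>
    (integral_prod_mul (fun t => F t ω) (fun t => G t ω)).symm
  simp_rw [h1]
  refine (integral_integral_swap ?_).symm
  refine integrable_prod_of_bound (F := fun (z : T × T) ω => F z.1 ω * G z.2 ω) ?_
    (hf.mul_prod hg) fun z ω => ?_
  · have h2 : Measurable fun q : (T × T) × Ω => F q.1.1 q.2 :=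
      hF.comp (g := Function.uncurry F) (f := fun q : (T × T) × Ω => (q.1.1, q.2)) (by fun_prop)
    have h3 : Measurable fun q : (T × T) × Ω => G q.1.2 q.2 :=
      hG.comp (g := Function.uncurry G) (f := fun q : (T × T) × Ω => (q.1.2, q.2)) (by fun_prop)
    exact (h2.mul h3).aestronglyMeasurable
  · rw [norm_mul]
    exact mul_le_mul (hFf _ _) (hGg _ _) (norm_nonneg _) ((abs_nonneg _).trans (hFf z.1 ω))

/-- Mixed moments of an integral of a random field are integrals of mixed moments of the field. -/
lemma integral_mul_pow_integral_eq {X : Ω → ℝ} (hX : Measurable X) (hX1 : ∀ ω, |X ω| ≤ 1)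
    {w : T → ℝ} (hw : Measurable w) (hwi : Integrable w μ) {ξ : T → Ω → ℝ}
    (hξ : Measurable (Function.uncurry ξ)) (hξ1 : ∀ t ω, |ξ t ω| ≤ 1) (n : ℕ) :
    ∫ ω, X ω * (∫ t, w t * ξ t ω ∂μ) ^ n ∂P
      = ∫ x : Fin n → T, (∏ i, w (x i)) * ∫ ω, X ω * ∏ i, ξ (x i) ω ∂P
        ∂(Measure.pi fun _ => μ) := by
  have h1 : ∀ ω, X ω * (∫ t, w t * ξ t ω ∂μ) ^ n
      = ∫ x : Fin n → T, X ω * ∏ i, (w (x i) * ξ (x i) ω) ∂(Measure.pi fun _ => μ) := by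
    intro ω
    rw [integral_const_mul, integral_fintype_prod_eq_pow (fun t => w t * ξ t ω), Fintype.card_fin]
  simp_rw [h1]
  rw [← integral_integral_swap]
  · congr 1 with x
    rw [← integral_const_mul]
    congr 1 with ω
    rw [Finset.prod_mul_distrib]
    ring
  · refine integrable_prod_of_bound (F := fun (x : Fin n → T) ω => X ω * ∏ i, (w (x i) * ξ (x i) ω))
      (f := fun x => ∏ i, |w (x i)|) ?_ ?_ fun x ω => ?_
    · refine Measurable.aestronglyMeasurable ?_
      refine (hX.comp measurable_snd).mul (Finset.measurable_fun_prod _ fun i _ => ?_)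
      exact (hw.comp (by fun_prop)).mul (hξ.comp (g := Function.uncurry ξ)
        (f := fun q : (Fin n → T) × Ω => (q.1 i, q.2)) (by fun_prop))
    · exact Integrable.fintype_prod (f := fun _ t => |w t|) fun _ => hwi.abs
    · rw [norm_mul, Finset.prod_mul_distrib, norm_mul, norm_prod, norm_prod]
      have : ∏ i, ‖ξ (x i) ω‖ ≤ 1 :=
        Finset.prod_le_one (fun _ _ => norm_nonneg _) fun i _ => hξ1 _ _
      calc ‖X ω‖ * ((∏ i, ‖w (x i)‖) * ∏ i, ‖ξ (x i) ω‖) ≤ 1 * ((∏ i, ‖w (x i)‖) * 1) := by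
            gcongr
            exact hX1 ω
        _ = ∏ i, |w (x i)| := by simp

lemma abs_integral_mul_le {T : Type*} [MeasurableSpace T] {μ : Measure T} {w : T → ℝ}
    (hwi : Integrable w μ) {g : T → ℝ} (hg : ∀ t, |g t| ≤ 1) :
    |∫ t, w t * g t ∂μ| ≤ ∫ t, |w t| ∂μ := by
  refine abs_integral_le_integral_abs.trans ?_
  refine integral_mono_of_nonneg (ae_of_all _ fun t => abs_nonneg _) hwi.abs
    (ae_of_all _ fun t => ?_)
  simp only
  rw [abs_mul]
  exact mul_le_of_le_one_right (abs_nonneg _) (hg t)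

lemma integral_mul_pow_integral_eq_zero {X : Ω → ℝ} (hX : Measurable X) (hX1 : ∀ ω, |X ω| ≤ 1)
    {w : T → ℝ} (hw : Measurable w) (hwi : Integrable w μ) {ξ : T → Ω → ℝ}
    (hξ : Measurable (Function.uncurry ξ)) (hξ1 : ∀ t ω, |ξ t ω| ≤ 1)
    (h0 : ∀ (n : ℕ) (x : Fin n → T), (∀ i, w (x i) ≠ 0) → ∫ ω, X ω * ∏ i, ξ (x i) ω ∂P = 0)
    (n : ℕ) : ∫ ω, X ω * (∫ t, w t * ξ t ω ∂μ) ^ n ∂P = 0 := by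
  rw [integral_mul_pow_integral_eq hX hX1 hw hwi hξ hξ1]
  refine integral_eq_zero_of_ae (ae_of_all _ fun x => ?_)
  by_cases hx : ∀ i, w (x i) ≠ 0
  · simp [h0 n x hx]
  · push Not at hx
    obtain ⟨i, hi⟩ := hx
    simp only [Pi.zero_apply]
    rw [Finset.prod_eq_zero (f := fun i => w (x i)) (Finset.mem_univ i) hi, zero_mul]

/-- If a bounded random variable `X` is orthogonal to all products of values of a field at points
where the weight `w` does not vanish, then it is orthogonal to the exponentials of the weighted
integral of the field, by expansion of the exponential. -/
lemma integral_mul_cexp_eq_zero {X : Ω → ℝ} (hX : Measurable X) (hX1 : ∀ ω, |X ω| ≤ 1)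
    {w : T → ℝ} (hw : Measurable w) (hwi : Integrable w μ) {ξ : T → Ω → ℝ}
    (hξ : Measurable (Function.uncurry ξ)) (hξ1 : ∀ t ω, |ξ t ω| ≤ 1)
    (h0 : ∀ (n : ℕ) (x : Fin n → T), (∀ i, w (x i) ≠ 0) → ∫ ω, X ω * ∏ i, ξ (x i) ω ∂P = 0)
    (s : ℝ) :
    ∫ ω, (X ω : ℂ) * Complex.exp (((s * ∫ t, w t * ξ t ω ∂μ : ℝ) : ℂ) * Complex.I) ∂P = 0 := by
  set S : Ω → ℝ := fun ω => ∫ t, w t * ξ t ω ∂μ with hS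
  have hSm : Measurable S := measurable_integral_left
    (F := fun t ω => w t * ξ t ω) ((hw.comp measurable_fst).mul hξ)
  set K : ℝ := ∫ t, |w t| ∂μ
  have hSK : ∀ ω, |S ω| ≤ K := fun ω => abs_integral_mul_le hwi fun t => hξ1 t ω
  have hmom : ∀ n : ℕ, ∫ ω, X ω * S ω ^ n ∂P = 0 :=
    integral_mul_pow_integral_eq_zero hX hX1 hw hwi hξ hξ1 h0
  have hmeas : ∀ n : ℕ, Measurable fun ω => (X ω : ℂ) *
      (((s * S ω : ℝ) : ℂ) * Complex.I) ^ n / (n.factorial : ℂ) := fun n => by fun_prop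
  have hnorm : ∀ (n : ℕ) (ω : Ω), ‖(X ω : ℂ) *
      (((s * S ω : ℝ) : ℂ) * Complex.I) ^ n / (n.factorial : ℂ)‖
        ≤ (|s| * K) ^ n / n.factorial := by
    intro n ω
    rw [norm_div, norm_mul, norm_pow, norm_mul, Complex.norm_I, mul_one, Complex.norm_real,
      Complex.norm_real, Complex.norm_natCast, norm_mul, Real.norm_eq_abs, Real.norm_eq_abs,
      Real.norm_eq_abs]
    gcongr
    calc |X ω| * (|s| * |S ω|) ^ n ≤ 1 * (|s| * K) ^ n := by
          gcongr
          · exact hX1 ω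
          · exact hSK ω
      _ = _ := one_mul _
  have hsum := hasSum_integral_of_summable_integral_norm (μ := P)
    (F := fun (n : ℕ) ω => (X ω : ℂ) * (((s * S ω : ℝ) : ℂ) * Complex.I) ^ n / (n.factorial : ℂ))
    (fun n => Integrable.of_bound (hmeas n).aestronglyMeasurable _ (ae_of_all _ (hnorm n)))
    (by
      refine Summable.of_nonneg_of_le (fun n => integral_nonneg fun ω => norm_nonneg _)
        (fun n => ?_) (Real.summable_pow_div_factorial (|s| * K))
      refine (integral_mono_of_nonneg (ae_of_all _ fun ω => norm_nonneg _) (integrable_const _)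
        (ae_of_all _ (hnorm n))).trans ?_
      simp)
  have hzero : ∀ n : ℕ, ∫ ω, (X ω : ℂ) * (((s * S ω : ℝ) : ℂ) * Complex.I) ^ n
      / (n.factorial : ℂ) ∂P = 0 := by
    intro n
    have : ∀ ω, (X ω : ℂ) * (((s * S ω : ℝ) : ℂ) * Complex.I) ^ n / (n.factorial : ℂ)
        = ((X ω * S ω ^ n : ℝ) : ℂ) * (((s : ℂ) * Complex.I) ^ n / (n.factorial : ℂ)) := by
      intro ω
      push_cast
      ring
    simp_rw [this]
    rw [integral_mul_const, integral_complex_ofReal, hmom n]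
    simp
  simp_rw [hzero] at hsum
  have h2 := hsum.unique hasSum_zero
  rw [← h2]
  congr 1 with ω
  have h3 := (NormedSpace.expSeries_div_hasSum_exp (((s * S ω : ℝ) : ℂ) * Complex.I)).mul_left
    (X ω : ℂ)
  rw [← Complex.exp_eq_exp_ℂ] at h3
  rw [← h3.tsum_eq]
  congr 1 with n
  ring

end RandomIntegrals

section SecondMoments

/-- The integral `∫ w(t) ξ_t dt` of a random field against a weight function. -/
def fieldIntegral {Ω : Type*} {ν : ℕ} (w : Eucl ν → ℝ) (ξ : Eucl ν → Ω → ℝ) (ω : Ω) : ℝ :=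
  ∫ t, w t * ξ t ω

lemma abs_fieldIntegral_le {Ω : Type*} {ν : ℕ} {w : Eucl ν → ℝ} (hwi : Integrable w)
    {ξ : Eucl ν → Ω → ℝ} (hξ1 : ∀ t ω, |ξ t ω| ≤ 1) (ω : Ω) : |fieldIntegral w ξ ω| ≤ ∫ t, |w t| :=
  abs_integral_mul_le hwi fun t => hξ1 t ω

variable {Ω : Type*} [MeasurableSpace Ω] {ν : ℕ} {P : Measure Ω} [IsProbabilityMeasure P]

lemma measurable_fieldIntegral {w : Eucl ν → ℝ} (hw : Measurable w) {ξ : Eucl ν → Ω → ℝ}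
    (hξ : Measurable (Function.uncurry ξ)) : Measurable (fieldIntegral w ξ) :=
  measurable_integral_left (F := fun t ω => w t * ξ t ω) ((hw.comp measurable_fst).mul hξ)

/-- The second moment of a weighted integral as a double integral of the two point function. -/
lemma integral_fieldIntegral_sq {w : Eucl ν → ℝ} (hw : Measurable w) (hwi : Integrable w)
    {ξ : Eucl ν → Ω → ℝ} (hξ : Measurable (Function.uncurry ξ)) {K : ℝ}
    (hξK : ∀ t ω, |ξ t ω| ≤ K) :
    ∫ ω, fieldIntegral w ξ ω ^ 2 ∂P
      = ∫ z : Eucl ν × Eucl ν, w z.1 * w z.2 * ∫ ω, ξ z.1 ω * ξ z.2 ω ∂P := by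
  have hF : Measurable (Function.uncurry fun t ω => w t * ξ t ω) :=
    (hw.comp measurable_fst).mul hξ
  have hb : ∀ t ω, |w t * ξ t ω| ≤ |w t| * K := fun t ω => by
    rw [abs_mul]; gcongr; exact hξK t ω
  have := integral_mul_integral_eq (P := P) hF hF (hwi.abs.mul_const K) (hwi.abs.mul_const K) hb hb
  simp_rw [sq, fieldIntegral]
  rw [this]
  refine integral_congr_ae (ae_of_all _ fun z => ?_)
  simp only
  rw [← integral_const_mul]
  congr 1 with ω
  ring

lemma integrable_two_point {w : Eucl ν → ℝ} (hw : Measurable w) (hwi : Integrable w)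
    {ξ : Eucl ν → Ω → ℝ} (hξ : Measurable (Function.uncurry ξ)) {K : ℝ}
    (hξK : ∀ t ω, |ξ t ω| ≤ K) :
    Integrable (fun z : Eucl ν × Eucl ν => w z.1 * w z.2 * ∫ ω, ξ z.1 ω * ξ z.2 ω ∂P) := by
  have h2 : Measurable fun q : (Eucl ν × Eucl ν) × Ω => ξ q.1.1 q.2 :=
    hξ.comp (g := Function.uncurry ξ) (f := fun q : (Eucl ν × Eucl ν) × Ω => (q.1.1, q.2))
      (by fun_prop)
  have h3 : Measurable fun q : (Eucl ν × Eucl ν) × Ω => ξ q.1.2 q.2 :=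
    hξ.comp (g := Function.uncurry ξ) (f := fun q : (Eucl ν × Eucl ν) × Ω => (q.1.2, q.2))
      (by fun_prop)
  have hm : Measurable fun z : Eucl ν × Eucl ν => ∫ ω, ξ z.1 ω * ξ z.2 ω ∂P :=
    ((h2.mul h3).stronglyMeasurable.integral_prod_right' (ν := P)).measurable
  refine ((hwi.abs.mul_prod hwi.abs).mul_const (K * K)).mono'
    (((hw.comp measurable_fst).mul (hw.comp measurable_snd)).mul hm).aestronglyMeasurable
    (ae_of_all _ fun z => ?_)
  rw [norm_mul, norm_mul]
  gcongr
  · exact le_rfl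
  · exact le_rfl
  · refine (norm_integral_le_of_norm_le_const (C := K * K)
      (ae_of_all _ fun ω => ?_)).trans (by simp)
    rw [norm_mul]
    exact mul_le_mul (hξK _ _) (hξK _ _) (norm_nonneg _) ((abs_nonneg _).trans (hξK z.1 ω))

/-- If the two point function is dominated by an integrable function of the difference, then the
second moment of a weighted integral is bounded by the squared `L²` norm of the weight. -/
lemma integral_fieldIntegral_sq_le {w : Eucl ν → ℝ} (hw : Measurable w) (hwi : Integrable w)
    (hw2 : Integrable fun t => w t ^ 2) {ξ : Eucl ν → Ω → ℝ}
    (hξ : Measurable (Function.uncurry ξ)) {K : ℝ} (hξK : ∀ t ω, |ξ t ω| ≤ K) {κ : Eucl ν → ℝ}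
    (hκ : Integrable κ) (hcov : ∀ s t, |∫ ω, ξ s ω * ξ t ω ∂P| ≤ κ (t - s)) :
    ∫ ω, fieldIntegral w ξ ω ^ 2 ∂P ≤ (∫ t, κ t) * ∫ t, w t ^ 2 := by
  rw [integral_fieldIntegral_sq hw hwi hξ hξK]
  have hmp1 := measurePreserving_prod_sub (volume : Measure (Eucl ν)) (volume : Measure (Eucl ν))
  have hmp2 := measurePreserving_prod_sub_swap (volume : Measure (Eucl ν))
    (volume : Measure (Eucl ν))
  have hκ' : Integrable fun t => κ (-t) := hκ.comp_neg
  have i1 : Integrable fun z : Eucl ν × Eucl ν => w z.1 ^ 2 * κ (z.2 - z.1) :=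
    hmp1.integrable_comp_of_integrable (hw2.mul_prod hκ)
  have i2 : Integrable fun z : Eucl ν × Eucl ν => w z.2 ^ 2 * κ (-(z.1 - z.2)) :=
    hmp2.integrable_comp_of_integrable (hw2.mul_prod hκ')
  -- The shear `(s, t) ↦ (s, t - s)` preserves Lebesgue measure.
  have v1 : ∫ z : Eucl ν × Eucl ν, w z.1 ^ 2 * κ (z.2 - z.1) = (∫ t, w t ^ 2) * ∫ t, κ t := by
    have := integral_map (μ := (volume : Measure (Eucl ν × Eucl ν)))
      (φ := fun z : Eucl ν × Eucl ν => (z.1, z.2 - z.1)) (f := fun z => w z.1 ^ 2 * κ z.2)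
      hmp1.measurable.aemeasurable
      (by rw [Measure.volume_eq_prod, hmp1.map_eq]; exact (hw2.mul_prod hκ).1)
    rw [← this, Measure.volume_eq_prod, hmp1.map_eq]
    exact integral_prod_mul (fun t => w t ^ 2) κ
  have v2 : ∫ z : Eucl ν × Eucl ν, w z.2 ^ 2 * κ (-(z.1 - z.2)) = (∫ t, w t ^ 2) * ∫ t, κ t := by
    have := integral_map (μ := (volume : Measure (Eucl ν × Eucl ν)))
      (φ := fun z : Eucl ν × Eucl ν => (z.2, z.1 - z.2)) (f := fun z => w z.1 ^ 2 * κ (-z.2))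
      hmp2.measurable.aemeasurable
      (by rw [Measure.volume_eq_prod, hmp2.map_eq]; exact (hw2.mul_prod hκ').1)
    rw [← this, Measure.volume_eq_prod, hmp2.map_eq]
    refine (integral_prod_mul (fun t => w t ^ 2) (fun t => κ (-t))).trans ?_
    rw [integral_neg_eq_self]
  calc _ ≤ ∫ z : Eucl ν × Eucl ν,
        (1 / 2 * (w z.1 ^ 2 * κ (z.2 - z.1)) + 1 / 2 * (w z.2 ^ 2 * κ (-(z.1 - z.2)))) := by
        refine integral_mono (integrable_two_point hw hwi hξ hξK)
          ((i1.const_mul _).add (i2.const_mul _)) fun z => ?_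
        have h1 := hcov z.1 z.2
        have h2 : 0 ≤ κ (z.2 - z.1) := (abs_nonneg _).trans h1
        simp only [neg_sub]
        calc _ ≤ |w z.1 * w z.2 * ∫ ω, ξ z.1 ω * ξ z.2 ω ∂P| := le_abs_self _
          _ = |w z.1 * w z.2| * |∫ ω, ξ z.1 ω * ξ z.2 ω ∂P| := abs_mul _ _
          _ ≤ (1 / 2 * w z.1 ^ 2 + 1 / 2 * w z.2 ^ 2) * κ (z.2 - z.1) := by
              gcongr
              rw [abs_le]
              constructor <;> nlinarith [sq_nonneg (w z.1 + w z.2), sq_nonneg (w z.1 - w z.2)]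
          _ = _ := by ring
    _ = _ := by
        rw [integral_add (i1.const_mul _) (i2.const_mul _), integral_const_mul, integral_const_mul,
          v1, v2]
        ring

end SecondMoments

/-! ### Perturbation of the equation of the Gaussian characteristic function -/

section SteinEquation

lemma norm_one_sub_sub_cexp_le (y : ℝ) :
    ‖1 - (y : ℂ) * Complex.I - Complex.exp (-((y : ℂ) * Complex.I))‖ ≤ 3 * y ^ 2 := by
  have hn : ‖(y : ℂ) * Complex.I‖ = |y| := by simp
  rcases le_total |y| 1 with h | h
  · have := Complex.norm_exp_sub_one_sub_id_le (x := -((y : ℂ) * Complex.I)) (by rwa [norm_neg, hn])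
    rw [norm_neg, hn, sq_abs] at this
    rw [← norm_neg]
    calc _ = ‖Complex.exp (-((y : ℂ) * Complex.I)) - 1 - -((y : ℂ) * Complex.I)‖ := by
          congr 1; ring
      _ ≤ y ^ 2 := this
      _ ≤ 3 * y ^ 2 := by nlinarith [sq_nonneg y]
  · have he : ‖Complex.exp (-((y : ℂ) * Complex.I))‖ = 1 := by
      rw [← neg_mul, ← Complex.ofReal_neg, Complex.norm_exp_ofReal_mul_I]
    calc _ ≤ ‖(1 : ℂ)‖ + ‖(y : ℂ) * Complex.I‖ + ‖Complex.exp (-((y : ℂ) * Complex.I))‖ :=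
          (norm_sub_le _ _).trans (add_le_add_left (norm_sub_le _ _) _)
      _ = 1 + |y| + 1 := by rw [norm_one, hn, he]
      _ ≤ 3 * |y| ^ 2 := by nlinarith
      _ = 3 * y ^ 2 := by rw [sq_abs]

/-- An approximate solution of `ψ' = -v x ψ` with `ψ 0 = 1` is close to the Gaussian
characteristic function `exp (-v s² / 2)`. -/
lemma norm_sub_gaussian_le {ψ ψ' : ℝ → ℂ} {v ε s : ℝ} (hv : 0 ≤ v)
    (hψ : ∀ x, HasDerivAt ψ (ψ' x) x) (h0 : ψ 0 = 1)
    (hε : ∀ x, |x| ≤ |s| → ‖ψ' x + x * v * ψ x‖ ≤ ε) :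
    ‖ψ s - Complex.exp ((-(s ^ 2 * v / 2) : ℝ) : ℂ)‖ ≤ |s| * ε := by
  -- The derivative of `ψ(x) exp (v x² / 2)` is at most `ε exp (v x² / 2)`.
  set g : ℝ → ℂ := fun x => ψ x * Complex.exp ((x ^ 2 * v / 2 : ℝ) : ℂ) with hg
  have hd : ∀ x : ℝ, HasDerivAt (fun x : ℝ => Complex.exp ((x ^ 2 * v / 2 : ℝ) : ℂ))
      (Complex.exp ((x ^ 2 * v / 2 : ℝ) : ℂ) * ((x * v : ℝ) : ℂ)) x := by
    intro x
    have h1 : HasDerivAt (fun x : ℝ => x ^ 2 * v / 2) (x * v) x := by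
      have := ((hasDerivAt_pow 2 x).mul_const v).div_const 2
      exact this.congr_deriv (by push_cast; ring)
    exact h1.ofReal_comp.cexp
  have hg' : ∀ x, HasDerivAt g
      ((ψ' x + x * v * ψ x) * Complex.exp ((x ^ 2 * v / 2 : ℝ) : ℂ)) x := by
    intro x
    exact ((hψ x).mul (hd x)).congr_deriv (by push_cast; ring)
  have hnorm : ∀ x : ℝ, ‖Complex.exp ((x ^ 2 * v / 2 : ℝ) : ℂ)‖ = Real.exp (x ^ 2 * v / 2) := by
    intro x
    rw [← Complex.ofReal_exp, Complex.norm_real, Real.norm_eq_abs, abs_of_pos (Real.exp_pos _)]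
  have hε0 : 0 ≤ ε := (norm_nonneg _).trans (hε 0 (by simp))
  have hmain := Convex.norm_image_sub_le_of_norm_hasDerivWithin_le (f := g) (x := 0) (y := s)
    (s := Set.Icc (-|s|) |s|) (C := ε * Real.exp (s ^ 2 * v / 2))
    (fun x _ => (hg' x).hasDerivWithinAt) (fun x hx => by
      have hx' : |x| ≤ |s| := abs_le.2 ⟨hx.1, hx.2⟩
      rw [norm_mul, hnorm]
      gcongr ?_ * Real.exp (?_ * v / 2)
      · exact hε x hx'
      · exact sq_le_sq.2 hx')
    (convex_Icc _ _) ⟨by simp, by simp⟩ ⟨neg_abs_le s, le_abs_self s⟩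
  have hg0 : g 0 = 1 := by simp [hg, h0]
  rw [hg0, sub_zero, Real.norm_eq_abs] at hmain
  have h1 : ψ s - Complex.exp ((-(s ^ 2 * v / 2) : ℝ) : ℂ)
      = (g s - 1) * Complex.exp ((-(s ^ 2 * v / 2) : ℝ) : ℂ) := by
    have : Complex.exp ((s ^ 2 * v / 2 : ℝ) : ℂ) *
        Complex.exp ((-(s ^ 2 * v / 2) : ℝ) : ℂ) = 1 := by
      rw [← Complex.exp_add, ← Complex.ofReal_add, add_neg_cancel, Complex.ofReal_zero,
        Complex.exp_zero]
    simp only [hg]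
    rw [sub_mul, mul_assoc, this, mul_one, one_mul]
  rw [h1, norm_mul, ← Complex.ofReal_exp, Complex.norm_real, Real.norm_eq_abs,
    abs_of_pos (Real.exp_pos _), Real.exp_neg]
  calc ‖g s - 1‖ * (Real.exp (s ^ 2 * v / 2))⁻¹
      ≤ (ε * Real.exp (s ^ 2 * v / 2) * |s|) * (Real.exp (s ^ 2 * v / 2))⁻¹ := by gcongr
    _ = |s| * ε := by
        have := (Real.exp_pos (s ^ 2 * v / 2)).ne'
        field_simp

end SteinEquation

/-! ### Fields with finite range of dependence -/

section FiniteRange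

variable {Ω : Type*} [MeasurableSpace Ω] {ν : ℕ}

/-- A centred random field with values in `[-1, 1]` whose values at points of finite families at
distance more than `r` are independent. -/
structure IsFiniteRangeField (ξ : Eucl ν → Ω → ℝ) (r : ℝ) (P : Measure Ω) : Prop where
  measurable_uncurry : Measurable (Function.uncurry ξ)
  abs_le_one : ∀ t ω, |ξ t ω| ≤ 1
  integral_eq_zero : ∀ t, ∫ ω, ξ t ω ∂P = 0
  indepFun : ∀ {n m : ℕ} (s : Fin n → Eucl ν) (t : Fin m → Eucl ν),
    (∀ i k, r < dist (s i) (t k)) →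
      IndepFun (fun ω i => ξ (s i) ω) (fun ω k => ξ (t k) ω) P

/-- The part `∫_{|x - t| ≤ r} w(x) ξ_x dx` of a weighted integral near `t`. -/
def nearIntegral (r : ℝ) (w : Eucl ν → ℝ) (ξ : Eucl ν → Ω → ℝ) (t : Eucl ν) (ω : Ω) : ℝ :=
  fieldIntegral ((Metric.closedBall t r).indicator w) ξ ω

/-- The part `∫_{|x - t| > r} w(x) ξ_x dx` of a weighted integral away from `t`. -/
def farIntegral (r : ℝ) (w : Eucl ν → ℝ) (ξ : Eucl ν → Ω → ℝ) (t : Eucl ν) (ω : Ω) : ℝ :=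
  fieldIntegral ((Metric.closedBall t r)ᶜ.indicator w) ξ ω

variable {P : Measure Ω} {ξ : Eucl ν → Ω → ℝ} {r b : ℝ} {w : Eucl ν → ℝ}

lemma IsFiniteRangeField.measurable_apply (h : IsFiniteRangeField ξ r P) (t : Eucl ν) :
    Measurable (ξ t) := h.measurable_uncurry.of_uncurry_left

lemma IsFiniteRangeField.integrable_mul_apply (h : IsFiniteRangeField ξ r P)
    (hwi : Integrable w) (ω : Ω) : Integrable fun t => w t * ξ t ω :=
  hwi.mul_bdd (c := 1) (h.measurable_uncurry.of_uncurry_right).aestronglyMeasurable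
    (ae_of_all _ fun t => h.abs_le_one t ω)

lemma IsFiniteRangeField.near_add_far (h : IsFiniteRangeField ξ r P) (hwi : Integrable w)
    (t : Eucl ν) (ω : Ω) :
    fieldIntegral w ξ ω = nearIntegral r w ξ t ω + farIntegral r w ξ t ω := by
  unfold nearIntegral farIntegral fieldIntegral
  have hm : MeasurableSet (Metric.closedBall t r) := Metric.isClosed_closedBall.measurableSet
  rw [← integral_add (h.integrable_mul_apply (hwi.indicator hm) ω)
    (h.integrable_mul_apply (hwi.indicator hm.compl) ω)]
  congr 1 with x
  by_cases hx : x ∈ Metric.closedBall t r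
  · simp [hx]
  · simp [hx]

lemma IsFiniteRangeField.measurable_nearIntegral (h : IsFiniteRangeField ξ r P)
    (hw : Measurable w) : Measurable (Function.uncurry (nearIntegral r w ξ)) := by
  have hm : MeasurableSet {q : Eucl ν × (Eucl ν × Ω) | dist q.1 q.2.1 ≤ r} :=
    measurableSet_le (by fun_prop) measurable_const
  have h1 : Measurable (Function.uncurry fun (x : Eucl ν) (q : Eucl ν × Ω) =>
      (Metric.closedBall q.1 r).indicator w x * ξ x q.2) := by
    have e : (Function.uncurry fun (x : Eucl ν) (q : Eucl ν × Ω) =>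
        (Metric.closedBall q.1 r).indicator w x * ξ x q.2)
        = fun q => Set.indicator {q : Eucl ν × (Eucl ν × Ω) | dist q.1 q.2.1 ≤ r}
          (fun q => w q.1) q * Function.uncurry ξ (q.1, q.2.2) := by
      ext ⟨x, t, ω⟩
      by_cases hx : dist x t ≤ r <;> simp [Metric.mem_closedBall, hx]
    rw [e]
    exact ((hw.comp measurable_fst).indicator hm).mul (h.measurable_uncurry.comp (by fun_prop))
  exact measurable_integral_left h1

lemma integrable_indicator_closedBall (hwi : Integrable w) (t : Eucl ν) (r : ℝ) :
    Integrable ((Metric.closedBall t r).indicator w) :=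
  hwi.indicator Metric.isClosed_closedBall.measurableSet

lemma IsFiniteRangeField.abs_nearIntegral_le (h : IsFiniteRangeField ξ r P) (hwi : Integrable w)
    (hwb : ∀ x, |w x| ≤ b) (t : Eucl ν) (ω : Ω) :
    |nearIntegral r w ξ t ω| ≤ b * volume.real (Metric.closedBall (0 : Eucl ν) r) := by
  refine (abs_fieldIntegral_le (integrable_indicator_closedBall hwi t r) h.abs_le_one ω).trans ?_
  have hm : MeasurableSet (Metric.closedBall t r) := Metric.isClosed_closedBall.measurableSet
  have hfin : volume (Metric.closedBall t r) ≠ ∞ := measure_closedBall_lt_top.ne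
  calc _ ≤ ∫ x, (Metric.closedBall t r).indicator (fun _ => b) x := by
        refine integral_mono (integrable_indicator_closedBall hwi t r).abs
          ((integrable_indicator_iff hm).2 (integrableOn_const hfin)) fun x => ?_
        by_cases hx : x ∈ Metric.closedBall t r
        · simp only [Set.indicator_of_mem hx]; exact hwb x
        · simp [Set.indicator_of_notMem hx]
    _ = b * volume.real (Metric.closedBall (0 : Eucl ν) r) := by
        rw [integral_indicator_const _ hm, smul_eq_mul, mul_comm, measureReal_def, measureReal_def,
          Measure.addHaar_closedBall_center]

/-- The value of the field at `t` is orthogonal to products of values at distance more than `r`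
from `t`. -/
lemma IsFiniteRangeField.integral_mul_prod_eq_zero (h : IsFiniteRangeField ξ r P) (t : Eucl ν)
    (n : ℕ) (x : Fin n → Eucl ν) (hx : ∀ i, (Metric.closedBall t r)ᶜ.indicator w (x i) ≠ 0) :
    ∫ ω, ξ t ω * ∏ i, ξ (x i) ω ∂P = 0 := by
  have hd : ∀ (i : Fin 1) (k : Fin n), r < dist ((fun _ => t : Fin 1 → Eucl ν) i) (x k) := by
    intro _ k
    have := Set.mem_of_indicator_ne_zero (hx k)
    rw [Set.mem_compl_iff, Metric.mem_closedBall, not_le, dist_comm] at this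
    exact this
  have m0 : Measurable fun v : Fin 1 → ℝ => v 0 := by fun_prop
  have m1 : Measurable fun v : Fin n → ℝ => ∏ i, v i := by fun_prop
  have hind := (h.indepFun _ _ hd).comp (φ := fun v : Fin 1 → ℝ => v 0)
    (ψ := fun v : Fin n → ℝ => ∏ i, v i) m0 m1
  have := hind.integral_fun_mul_eq_mul_integral
    (by exact (h.measurable_apply t).aestronglyMeasurable)
    (by exact (Finset.measurable_fun_prod _
      fun i _ => h.measurable_apply (x i)).aestronglyMeasurable)
  simp only [Function.comp] at this
  rw [this, h.integral_eq_zero, zero_mul]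

variable [IsProbabilityMeasure P]

lemma IsFiniteRangeField.integral_mul_farIntegral (h : IsFiniteRangeField ξ r P)
    (hw : Measurable w) (hwi : Integrable w) (t : Eucl ν) :
    ∫ ω, ξ t ω * farIntegral r w ξ t ω ∂P = 0 := by
  have hm : MeasurableSet (Metric.closedBall t r)ᶜ :=
    Metric.isClosed_closedBall.measurableSet.compl
  have := integral_mul_pow_integral_eq_zero (h.measurable_apply t) (h.abs_le_one t)
    (hw.indicator hm) (hwi.indicator hm) h.measurable_uncurry h.abs_le_one
    (h.integral_mul_prod_eq_zero t) 1
  simp only [pow_one] at this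
  exact this

lemma IsFiniteRangeField.integral_mul_cexp_farIntegral (h : IsFiniteRangeField ξ r P)
    (hw : Measurable w) (hwi : Integrable w) (t : Eucl ν) (s : ℝ) :
    ∫ ω, (ξ t ω : ℂ) * Complex.exp (((s * farIntegral r w ξ t ω : ℝ) : ℂ) * Complex.I) ∂P = 0 := by
  have hm : MeasurableSet (Metric.closedBall t r)ᶜ :=
    Metric.isClosed_closedBall.measurableSet.compl
  exact integral_mul_cexp_eq_zero (h.measurable_apply t) (h.abs_le_one t)
    (hw.indicator hm) (hwi.indicator hm) h.measurable_uncurry h.abs_le_one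
    (h.integral_mul_prod_eq_zero t) s

/-- The products `ξ_t · ∫_{|x - t| ≤ r} w(x) ξ_x dx` are uncorrelated at distance more than
`3 r`. -/
lemma IsFiniteRangeField.integral_mul_nearIntegral_mul (h : IsFiniteRangeField ξ r P)
    (hw : Measurable w) (hwi : Integrable w) {t a : Eucl ν} (hr : 0 ≤ r) (hta : 3 * r < dist t a) :
    ∫ ω, (ξ t ω * nearIntegral r w ξ t ω) * (ξ a ω * nearIntegral r w ξ a ω) ∂P
      = (∫ ω, ξ t ω * nearIntegral r w ξ t ω ∂P) * ∫ ω, ξ a ω * nearIntegral r w ξ a ω ∂P := by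
  set F : Eucl ν → Eucl ν → Ω → ℝ := fun c x ω =>
    (Metric.closedBall c r).indicator w x * (ξ c ω * ξ x ω) with hF
  have hFm : ∀ c, Measurable (Function.uncurry (F c)) := fun c =>
    ((hw.indicator Metric.isClosed_closedBall.measurableSet).comp measurable_fst).mul
      (((h.measurable_apply c).comp measurable_snd).mul h.measurable_uncurry)
  have hFb : ∀ c x ω, |F c x ω| ≤ |(Metric.closedBall c r).indicator w x| := by
    intro c x ω
    rw [hF]
    simp only
    rw [abs_mul, abs_mul]
    refine mul_le_of_le_one_right (abs_nonneg _) ?_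
    exact mul_le_one₀ (h.abs_le_one _ _) (abs_nonneg _) (h.abs_le_one _ _)
  have hfi : ∀ c, Integrable fun x => |(Metric.closedBall c r).indicator w x| := fun c =>
    (integrable_indicator_closedBall hwi c r).abs
  have e : ∀ c ω, ξ c ω * nearIntegral r w ξ c ω = ∫ x, F c x ω := by
    intro c ω
    rw [nearIntegral, fieldIntegral, ← integral_const_mul]
    congr 1 with x
    simp only [hF]
    ring
  simp_rw [e]
  rw [integral_mul_integral_eq (hFm t) (hFm a) (hfi t) (hfi a) (hFb t) (hFb a)]
  have hswap : ∀ c, ∫ ω, (∫ x, F c x ω) ∂P = ∫ x, (∫ ω, F c x ω ∂P) := fun c =>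
    (integral_integral_swap (integrable_prod_of_bound (hFm c).aestronglyMeasurable (hfi c)
      (hFb c))).symm
  rw [hswap t, hswap a, ← integral_prod_mul, ← Measure.volume_eq_prod]
  congr 1 with z
  -- If `|z.1 - t| ≤ r` and `|z.2 - a| ≤ r` then the pairs `t, z.1` and `a, z.2` are at distance
  -- more than `r` from each other.
  by_cases hz1 : z.1 ∈ Metric.closedBall t r
  swap
  · simp [hF, Set.indicator_of_notMem hz1]
  by_cases hz2 : z.2 ∈ Metric.closedBall a r
  swap
  · simp [hF, Set.indicator_of_notMem hz2]
  rw [Metric.mem_closedBall] at hz1 hz2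
  have hd : ∀ i k : Fin 2, r < dist (![t, z.1] i) (![a, z.2] k) := by
    have t1 := dist_triangle t z.1 a
    have t2 := dist_triangle t z.2 a
    have t3 := dist_triangle t z.1 z.2
    rw [dist_comm] at hz1
    intro i k
    fin_cases i <;> fin_cases k <;> simp <;> linarith
  have hind := (h.indepFun _ _ hd).comp (φ := fun v : Fin 2 → ℝ => v 0 * v 1)
    (ψ := fun v : Fin 2 → ℝ => v 0 * v 1) (by fun_prop) (by fun_prop)
  have := hind.integral_fun_mul_eq_mul_integral
    (by exact ((h.measurable_apply t).mul (h.measurable_apply z.1)).aestronglyMeasurable)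
    (by exact ((h.measurable_apply a).mul (h.measurable_apply z.2)).aestronglyMeasurable)
  simp only [Function.comp, Matrix.cons_val_zero, Matrix.cons_val_one] at this
  simp only [hF]
  rw [integral_const_mul, integral_const_mul]
  calc _ = ∫ ω, ((Metric.closedBall t r).indicator w z.1 * (Metric.closedBall a r).indicator w z.2)
        * ((ξ t ω * ξ z.1 ω) * (ξ a ω * ξ z.2 ω)) ∂P := by
        congr 1 with ω; ring
    _ = _ := by
        rw [integral_const_mul, this]
        ring

end FiniteRange

/-! ### Normal approximation under finite range of dependence -/

section SteinEstimate

variable {Ω : Type*} [MeasurableSpace Ω] {ν : ℕ} {P : Measure Ω}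
  {ξ : Eucl ν → Ω → ℝ} {r b : ℝ} {w : Eucl ν → ℝ}

lemma IsFiniteRangeField.measurable_mul_nearIntegral (h : IsFiniteRangeField ξ r P)
    (hw : Measurable w) :
    Measurable (Function.uncurry fun t ω => ξ t ω * nearIntegral r w ξ t ω) :=
  h.measurable_uncurry.mul (h.measurable_nearIntegral hw)

lemma IsFiniteRangeField.abs_mul_nearIntegral_le (h : IsFiniteRangeField ξ r P)
    (hwi : Integrable w) (hwb : ∀ x, |w x| ≤ b) (t : Eucl ν) (ω : Ω) :
    |ξ t ω * nearIntegral r w ξ t ω| ≤ b * volume.real (Metric.closedBall (0 : Eucl ν) r) := by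
  rw [abs_mul]
  calc _ ≤ 1 * |nearIntegral r w ξ t ω| := by gcongr; exact h.abs_le_one t ω
    _ ≤ _ := by rw [one_mul]; exact h.abs_nearIntegral_le hwi hwb t ω

variable [IsProbabilityMeasure P]

lemma integral_abs_le_sqrt {X : Ω → ℝ} (hX : MemLp X 2 P) :
    ∫ ω, |X ω| ∂P ≤ √(∫ ω, X ω ^ 2 ∂P) := by
  refine Real.le_sqrt_of_sq_le ?_
  have hvar := variance_nonneg |X| P
  rw [variance_eq_sub hX.abs] at hvar
  have : ∫ ω, (|X| ^ 2) ω ∂P = ∫ ω, X ω ^ 2 ∂P := by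
    congr 1 with ω
    simp [sq_abs]
  rw [this] at hvar
  exact sub_nonneg.1 hvar

lemma hasDerivAt_integral_cexp_mul {S : Ω → ℝ} (hS : Measurable S) {K : ℝ} (hK : ∀ ω, |S ω| ≤ K)
    (x : ℝ) :
    HasDerivAt (fun x : ℝ => ∫ ω, Complex.exp (((x * S ω : ℝ) : ℂ) * Complex.I) ∂P)
      (∫ ω, Complex.exp (((x * S ω : ℝ) : ℂ) * Complex.I) * ((S ω : ℂ) * Complex.I) ∂P) x := by
  have hm : ∀ x : ℝ, Measurable fun ω => Complex.exp (((x * S ω : ℝ) : ℂ) * Complex.I) :=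
    fun x => by fun_prop
  refine (hasDerivAt_integral_of_dominated_loc_of_deriv_le (μ := P) (s := Set.univ)
    (F := fun (x : ℝ) ω => Complex.exp (((x * S ω : ℝ) : ℂ) * Complex.I))
    (F' := fun (x : ℝ) ω => Complex.exp (((x * S ω : ℝ) : ℂ) * Complex.I) *
      ((S ω : ℂ) * Complex.I)) (bound := fun _ => K) Filter.univ_mem
    (Eventually.of_forall fun x => (hm x).aestronglyMeasurable) ?_ ?_ ?_ (integrable_const _) ?_).2
  · exact Integrable.of_bound (hm x).aestronglyMeasurable 1
      (ae_of_all _ fun ω => (Complex.norm_exp_ofReal_mul_I _).le)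
  · exact Measurable.aestronglyMeasurable (by fun_prop)
  · refine ae_of_all _ fun ω x _ => ?_
    rw [norm_mul, Complex.norm_exp_ofReal_mul_I, one_mul, norm_mul, Complex.norm_I, mul_one,
      Complex.norm_real]
    exact hK ω
  · refine ae_of_all _ fun ω x _ => ?_
    have h1 : HasDerivAt (fun x : ℝ => ((x * S ω : ℝ) : ℂ) * Complex.I)
        ((S ω : ℂ) * Complex.I) x := by
      have h2 : HasDerivAt (fun x : ℝ => x * S ω) (S ω) x := by
        simpa using (hasDerivAt_id x).mul_const (S ω)
      exact h2.ofReal_comp.mul_const _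
    exact h1.cexp

/-- `∫ w(t) ξ_t (∫_{|x - t| ≤ r} w(x) ξ_x dx) dt`, a random variable with mean `Var ∫ w ξ`. -/
def nearSquare (r : ℝ) (w : Eucl ν → ℝ) (ξ : Eucl ν → Ω → ℝ) (ω : Ω) : ℝ :=
  fieldIntegral w (fun t ω => ξ t ω * nearIntegral r w ξ t ω) ω

/-- The variance of the weighted integral is the mean of `nearSquare`. -/
lemma IsFiniteRangeField.integral_nearSquare (h : IsFiniteRangeField ξ r P) (hw : Measurable w)
    (hwi : Integrable w) (hwb : ∀ x, |w x| ≤ b) :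
    ∫ ω, nearSquare r w ξ ω ∂P = ∫ ω, fieldIntegral w ξ ω ^ 2 ∂P := by
  have hSm := measurable_fieldIntegral hw h.measurable_uncurry
  have hS1 : ∀ ω, |fieldIntegral w ξ ω| ≤ ∫ t, |w t| := abs_fieldIntegral_le hwi h.abs_le_one
  have hnear := h.measurable_mul_nearIntegral hw
  have h1 : ∫ ω, nearSquare r w ξ ω ∂P
      = ∫ t, (∫ ω, w t * (ξ t ω * nearIntegral r w ξ t ω) ∂P) := by
    refine (integral_integral_swap ?_).symm
    refine integrable_prod_of_bound (F := fun t ω => w t * (ξ t ω * nearIntegral r w ξ t ω))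
      (f := fun t => |w t| * (b * volume.real (Metric.closedBall (0 : Eucl ν) r)))
      ((hw.comp measurable_fst).mul hnear).aestronglyMeasurable (hwi.abs.mul_const _) fun t ω => ?_
    rw [norm_mul]
    exact mul_le_mul_of_nonneg_left (h.abs_mul_nearIntegral_le hwi hwb t ω) (norm_nonneg _)
  have h2 : ∫ ω, fieldIntegral w ξ ω ^ 2 ∂P
      = ∫ t, (∫ ω, w t * (ξ t ω * fieldIntegral w ξ ω) ∂P) := by
    have e : ∀ ω, fieldIntegral w ξ ω ^ 2 = ∫ t, w t * (ξ t ω * fieldIntegral w ξ ω) := by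
      intro ω
      simp_rw [← mul_assoc]
      rw [integral_mul_const, sq]
      rfl
    simp_rw [e]
    refine (integral_integral_swap ?_).symm
    refine integrable_prod_of_bound (F := fun t ω => w t * (ξ t ω * fieldIntegral w ξ ω))
      (f := fun t => |w t| * (1 * ∫ t, |w t|))
      ((hw.comp measurable_fst).mul (h.measurable_uncurry.mul
        (hSm.comp measurable_snd))).aestronglyMeasurable (hwi.abs.mul_const _) fun t ω => ?_
    rw [norm_mul, norm_mul]
    exact mul_le_mul_of_nonneg_left
      (mul_le_mul (h.abs_le_one _ _) (hS1 ω) (abs_nonneg _) zero_le_one) (norm_nonneg _)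
  rw [h1, h2]
  -- The far part of the weighted integral is uncorrelated with the value at `t`.
  congr 1 with t
  rw [integral_const_mul, integral_const_mul]
  congr 1
  have hfm : Measurable (farIntegral r w ξ t) := measurable_fieldIntegral
    (hw.indicator Metric.isClosed_closedBall.measurableSet.compl) h.measurable_uncurry
  have hfi : Integrable (fun ω => ξ t ω * farIntegral r w ξ t ω) P := by
    refine Integrable.of_bound ((h.measurable_apply t).mul hfm).aestronglyMeasurable
      (1 * ∫ x, |(Metric.closedBall t r)ᶜ.indicator w x|) (ae_of_all _ fun ω => ?_)
    rw [norm_mul]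
    exact mul_le_mul (h.abs_le_one _ _) (abs_fieldIntegral_le (hwi.indicator
      Metric.isClosed_closedBall.measurableSet.compl) h.abs_le_one ω) (norm_nonneg _) zero_le_one
  have hni : Integrable (fun ω => ξ t ω * nearIntegral r w ξ t ω) P :=
    Integrable.of_bound hnear.of_uncurry_left.aestronglyMeasurable _
      (ae_of_all _ fun ω => h.abs_mul_nearIntegral_le hwi hwb t ω)
  simp_rw [h.near_add_far hwi t, mul_add]
  rw [integral_add hni hfi, h.integral_mul_farIntegral hw hwi t, add_zero]

/-- The fluctuations of `nearSquare` are small: it is a weighted integral of a field with finite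
range of dependence. -/
lemma IsFiniteRangeField.variance_nearSquare_le (h : IsFiniteRangeField ξ r P) (hr : 0 ≤ r)
    (hw : Measurable w) (hwi : Integrable w) (hwb : ∀ x, |w x| ≤ b) :
    ∫ ω, (nearSquare r w ξ ω - ∫ ω', fieldIntegral w ξ ω' ^ 2 ∂P) ^ 2 ∂P
      ≤ (2 * (b * volume.real (Metric.closedBall (0 : Eucl ν) r))) ^ 2 *
        volume.real (Metric.closedBall (0 : Eucl ν) (3 * r)) * (b * ∫ t, |w t|) := by
  set K := b * volume.real (Metric.closedBall (0 : Eucl ν) r) with hK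
  set ζ : Eucl ν → Ω → ℝ := fun t ω => ξ t ω * nearIntegral r w ξ t ω with hζ
  set η : Eucl ν → Ω → ℝ := fun t ω => ζ t ω - ∫ ω', ζ t ω' ∂P with hη
  have hζm : Measurable (Function.uncurry ζ) := h.measurable_mul_nearIntegral hw
  have hζK : ∀ t ω, |ζ t ω| ≤ K := h.abs_mul_nearIntegral_le hwi hwb
  have hζi : ∀ t, Integrable (ζ t) P := fun t =>
    Integrable.of_bound hζm.of_uncurry_left.aestronglyMeasurable K (ae_of_all _ (hζK t))
  have hmean : ∀ t, |∫ ω, ζ t ω ∂P| ≤ K := fun t => by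
    simpa using norm_integral_le_of_norm_le_const (μ := P) (C := K)
      (ae_of_all P fun ω => (Real.norm_eq_abs (ζ t ω)).trans_le (hζK t ω))
  have hmm : Measurable fun t => ∫ ω, ζ t ω ∂P :=
    (hζm.stronglyMeasurable.integral_prod_right' (ν := P)).measurable
  have hηm : Measurable (Function.uncurry η) := hζm.sub (hmm.comp measurable_fst)
  have hηK : ∀ t ω, |η t ω| ≤ 2 * K := fun t ω =>
    (abs_sub _ _).trans (by linarith [hζK t ω, hmean t])
  have hwζ : ∀ ω, Integrable fun t => w t * ζ t ω := fun ω =>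
    hwi.mul_bdd (c := K) (hζm.of_uncurry_right).aestronglyMeasurable
      (ae_of_all _ fun t => hζK t ω)
  have hwm : Integrable fun t => w t * ∫ ω, ζ t ω ∂P :=
    hwi.mul_bdd (c := K) hmm.aestronglyMeasurable (ae_of_all _ fun t => hmean t)
  have e : ∀ ω, nearSquare r w ξ ω - ∫ ω', fieldIntegral w ξ ω' ^ 2 ∂P = fieldIntegral w η ω := by
    intro ω
    rw [← h.integral_nearSquare hw hwi hwb]
    have h1 : ∫ ω, nearSquare r w ξ ω ∂P = ∫ t, w t * ∫ ω, ζ t ω ∂P := by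
      have : ∫ ω, nearSquare r w ξ ω ∂P = ∫ t, (∫ ω, w t * ζ t ω ∂P) := by
        refine (integral_integral_swap ?_).symm
        refine integrable_prod_of_bound (F := fun t ω => w t * ζ t ω) (f := fun t => |w t| * K)
          ((hw.comp measurable_fst).mul hζm).aestronglyMeasurable (hwi.abs.mul_const _)
          fun t ω => ?_
        rw [norm_mul]
        exact mul_le_mul_of_nonneg_left (hζK t ω) (norm_nonneg _)
      rw [this]
      congr 1 with t
      rw [integral_const_mul]
    rw [h1, nearSquare, fieldIntegral, fieldIntegral, ← integral_sub (hwζ ω) hwm]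
    congr 1 with t
    simp only [hη]
    ring
  simp_rw [e]
  have hB : MeasurableSet (Metric.closedBall (0 : Eucl ν) (3 * r)) :=
    Metric.isClosed_closedBall.measurableSet
  have hBfin : volume (Metric.closedBall (0 : Eucl ν) (3 * r)) ≠ ∞ := measure_closedBall_lt_top.ne
  have hb0 : 0 ≤ b := (abs_nonneg _).trans (hwb 0)
  have hw2 : Integrable fun t => w t ^ 2 := by
    simp_rw [sq]
    exact hwi.mul_bdd (c := b) hw.aestronglyMeasurable (ae_of_all _ hwb)
  have key := integral_fieldIntegral_sq_le (P := P) hw hwi hw2 hηm hηK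
    (κ := (Metric.closedBall (0 : Eucl ν) (3 * r)).indicator fun _ => (2 * K) ^ 2)
    ((integrable_indicator_iff hB).2 (integrableOn_const hBfin)) (fun s t => by
      by_cases hst : t - s ∈ Metric.closedBall (0 : Eucl ν) (3 * r)
      · rw [Set.indicator_of_mem hst]
        rw [← Real.norm_eq_abs]
        refine (norm_integral_le_of_norm_le_const (μ := P) (C := (2 * K) ^ 2)
          (ae_of_all _ fun ω => ?_)).trans_eq (by simp)
        rw [norm_mul, sq]
        exact mul_le_mul (hηK _ _) (hηK _ _) (norm_nonneg _) ((abs_nonneg _).trans (hηK s ω))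
      · have hd : 3 * r < dist s t := by
          rw [Metric.mem_closedBall, dist_zero_right, not_le, ← dist_eq_norm, dist_comm] at hst
          exact hst
        have hcov : ∫ ω, η s ω * η t ω ∂P = 0 := by
          have mem : ∀ t, MemLp (ζ t) 2 P := fun t =>
            MemLp.of_bound (hζi t).1 K (ae_of_all _ (hζK t))
          have e2 : ∫ ω, η s ω * η t ω ∂P = covariance (ζ s) (ζ t) P := rfl
          rw [e2, covariance_eq_sub (mem s) (mem t), sub_eq_zero]
          exact h.integral_mul_nearIntegral_mul hw hwi hr hd
        rw [hcov, Set.indicator_of_notMem hst, abs_zero])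
  refine key.trans ?_
  rw [integral_indicator_const _ hB, smul_eq_mul, mul_comm (volume.real _)]
  gcongr
  rw [← integral_const_mul]
  refine integral_mono hw2 (hwi.abs.const_mul b) fun t => ?_
  simp only
  rw [← sq_abs, sq]
  exact mul_le_mul_of_nonneg_right (hwb t) (abs_nonneg _)

/-- **Normal approximation for weighted integrals of fields with finite range of dependence**. The
characteristic function `ψ` of `∫ w ξ` solves `ψ'(s) = -s Var(∫ w ξ) ψ(s)` up to an error which is
small when `w` is small and spread out. -/
theorem IsFiniteRangeField.norm_charFun_sub_le (h : IsFiniteRangeField ξ r P) (hr : 0 ≤ r)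
    (hw : Measurable w) (hwi : Integrable w) (hwb : ∀ x, |w x| ≤ b) (s : ℝ) :
    ‖∫ ω, Complex.exp (((s * fieldIntegral w ξ ω : ℝ) : ℂ) * Complex.I) ∂P
        - Complex.exp ((-(s ^ 2 * (∫ ω, fieldIntegral w ξ ω ^ 2 ∂P) / 2) : ℝ) : ℂ)‖
      ≤ |s| * (|s| * √((2 * (b * volume.real (Metric.closedBall (0 : Eucl ν) r))) ^ 2 *
          volume.real (Metric.closedBall (0 : Eucl ν) (3 * r)) * (b * ∫ t, |w t|))
        + 3 * (|s| * (b * volume.real (Metric.closedBall (0 : Eucl ν) r))) ^ 2 * ∫ t, |w t|) := by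
  set S : Ω → ℝ := fieldIntegral w ξ with hS
  set U : Ω → ℝ := nearSquare r w ξ with hU
  set v : ℝ := ∫ ω, S ω ^ 2 ∂P with hv
  set K : ℝ := b * volume.real (Metric.closedBall (0 : Eucl ν) r) with hK
  set W : ℝ := ∫ t, |w t| with hW
  set VU : ℝ := (2 * K) ^ 2 * volume.real (Metric.closedBall (0 : Eucl ν) (3 * r)) * (b * W)
    with hVU
  have hSm : Measurable S := measurable_fieldIntegral hw h.measurable_uncurry
  have hSW : ∀ ω, |S ω| ≤ W := abs_fieldIntegral_le hwi h.abs_le_one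
  have hnear := h.measurable_mul_nearIntegral hw
  have hnm := h.measurable_nearIntegral hw
  have hUm : Measurable U := measurable_fieldIntegral hw hnear
  have hK0 : 0 ≤ K := mul_nonneg ((abs_nonneg _).trans (hwb 0)) measureReal_nonneg
  have hW0 : 0 ≤ W := integral_nonneg fun _ => abs_nonneg _
  have hUW : ∀ ω, |U ω| ≤ W * K := by
    intro ω
    refine abs_integral_le_integral_abs.trans ?_
    rw [hW, ← integral_mul_const]
    refine integral_mono_of_nonneg (ae_of_all _ fun t => abs_nonneg _) (hwi.abs.mul_const K)
      (ae_of_all _ fun t => ?_)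
    simp only
    rw [abs_mul]
    exact mul_le_mul_of_nonneg_left (h.abs_mul_nearIntegral_le hwi hwb t ω) (abs_nonneg _)
  have hv0 : 0 ≤ v := integral_nonneg fun _ => sq_nonneg _
  refine norm_sub_gaussian_le hv0
    (fun x => hasDerivAt_integral_cexp_mul hSm hSW x) (by simp) fun x hx => ?_
  set E : Ω → ℂ := fun ω => Complex.exp (((x * S ω : ℝ) : ℂ) * Complex.I) with hE
  have hEm : Measurable E := by fun_prop
  have hE1 : ∀ ω, ‖E ω‖ = 1 := fun ω => Complex.norm_exp_ofReal_mul_I _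
  have bint : ∀ {Z : Ω → ℂ} {C : ℝ}, Measurable Z → (∀ ω, ‖Z ω‖ ≤ C) → Integrable Z P :=
    fun hZ hC => Integrable.of_bound hZ.aestronglyMeasurable _ (ae_of_all _ hC)
  have iSE : Integrable (fun ω => (S ω : ℂ) * E ω) P := bint (C := W) (by fun_prop) fun ω => by
    rw [norm_mul, hE1, mul_one, Complex.norm_real]; exact hSW ω
  have iUE : Integrable (fun ω => (U ω : ℂ) * E ω) P := bint (C := W * K) (by fun_prop) fun ω => by
    rw [norm_mul, hE1, mul_one, Complex.norm_real]; exact hUW ω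
  have iE : Integrable E P := bint (C := 1) hEm fun ω => (hE1 ω).le
  -- `x ψ(x) v + ψ'(x)` splits into the remainder `D` of the linear expansion of the exponential in
  -- the near part, and the effect of the fluctuations of `U` around its mean `v`.
  set D : ℂ := ∫ ω, ((S ω : ℂ) * E ω - x * Complex.I * ((U ω : ℂ) * E ω)) ∂P with hD
  have hsplit : (∫ ω, Complex.exp (((x * S ω : ℝ) : ℂ) * Complex.I) * ((S ω : ℂ) * Complex.I) ∂P)
      + x * v * ∫ ω, Complex.exp (((x * S ω : ℝ) : ℂ) * Complex.I) ∂P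
      = Complex.I * D - x * ∫ ω, (((U ω - v : ℝ) : ℂ) * E ω) ∂P := by
    have e1 : ∫ ω, Complex.exp (((x * S ω : ℝ) : ℂ) * Complex.I) * ((S ω : ℂ) * Complex.I) ∂P
        = Complex.I * ∫ ω, (S ω : ℂ) * E ω ∂P := by
      rw [← integral_const_mul]
      congr 1 with ω
      simp only [hE]
      ring
    have e2 : ∫ ω, (((U ω - v : ℝ) : ℂ) * E ω) ∂P
        = ∫ ω, (U ω : ℂ) * E ω ∂P - v * ∫ ω, E ω ∂P := by
      rw [← integral_const_mul, ← integral_sub iUE (iE.const_mul _)]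
      congr 1 with ω
      push_cast
      ring
    rw [e1, e2, hD, integral_sub iSE (iUE.const_mul _), integral_const_mul]
    linear_combination (x * ∫ ω, (U ω : ℂ) * E ω ∂P) * Complex.I_sq
  rw [hsplit]
  have hVbound : ‖∫ ω, (((U ω - v : ℝ) : ℂ) * E ω) ∂P‖ ≤ √VU := by
    have m1 : MemLp (fun ω => U ω - v) 2 P :=
      MemLp.of_bound (hUm.sub_const v).aestronglyMeasurable (W * K + v) (ae_of_all _ fun ω =>
        (abs_sub _ _).trans (add_le_add (hUW ω) (abs_of_nonneg hv0).le))
    calc _ ≤ ∫ ω, ‖((U ω - v : ℝ) : ℂ) * E ω‖ ∂P := norm_integral_le_integral_norm _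
      _ = ∫ ω, |U ω - v| ∂P := by
          congr 1 with ω
          rw [norm_mul, hE1, mul_one, Complex.norm_real, Real.norm_eq_abs]
      _ ≤ √(∫ ω, (U ω - v) ^ 2 ∂P) := integral_abs_le_sqrt m1
      _ ≤ √VU := Real.sqrt_le_sqrt (h.variance_nearSquare_le hr hw hwi hwb)
  have hDbound : ‖D‖ ≤ 3 * (|x| * K) ^ 2 * W := by
    set N : Eucl ν → Ω → ℝ := nearIntegral r w ξ with hN
    set G : Eucl ν → Ω → ℂ := fun t ω =>
      (ξ t ω : ℂ) * (E ω - x * Complex.I * ((N t ω : ℂ) * E ω)) with hG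
    have hGm : Measurable (Function.uncurry G) := by
      have a1 : Measurable fun q : Eucl ν × Ω => ((Function.uncurry ξ q : ℝ) : ℂ) :=
        Complex.measurable_ofReal.comp h.measurable_uncurry
      have a2 : Measurable fun q : Eucl ν × Ω => ((Function.uncurry N q : ℝ) : ℂ) :=
        Complex.measurable_ofReal.comp hnm
      have a3 : Measurable fun q : Eucl ν × Ω => E q.2 := hEm.comp measurable_snd
      exact a1.mul (a3.sub ((a2.mul a3).const_mul _))
    have hNK : ∀ t ω, |N t ω| ≤ K := h.abs_nearIntegral_le hwi hwb
    have hGb : ∀ t ω, ‖G t ω‖ ≤ 1 + |x| * K := by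
      intro t ω
      rw [hG]
      simp only
      rw [norm_mul, Complex.norm_real]
      calc _ ≤ 1 * ‖E ω - x * Complex.I * ((N t ω : ℂ) * E ω)‖ := by
            gcongr; exact h.abs_le_one t ω
        _ ≤ 1 * (1 + |x| * |N t ω|) := by
            gcongr
            refine (norm_sub_le _ _).trans ?_
            rw [hE1, norm_mul, norm_mul, norm_mul, hE1, Complex.norm_I, Complex.norm_real,
              Complex.norm_real]
            simp
        _ ≤ _ := by rw [one_mul]; gcongr; exact hNK t ω
    have e1 : ∀ ω, (S ω : ℂ) * E ω - x * Complex.I * ((U ω : ℂ) * E ω)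
        = ∫ t, (w t : ℂ) * G t ω := by
      intro ω
      have c1 : (S ω : ℂ) = ∫ t, ((w t * ξ t ω : ℝ) : ℂ) := integral_complex_ofReal.symm
      have c2 : (U ω : ℂ) = ∫ t, ((w t * (ξ t ω * N t ω) : ℝ) : ℂ) := integral_complex_ofReal.symm
      have d1 : Integrable fun t => ((w t * ξ t ω : ℝ) : ℂ) := (h.integrable_mul_apply hwi ω).ofReal
      have d2 : Integrable fun t => ((w t * (ξ t ω * N t ω) : ℝ) : ℂ) := by
        refine Integrable.ofReal ?_
        exact hwi.mul_bdd (c := K) hnear.of_uncurry_right.aestronglyMeasurable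
          (ae_of_all _ fun t => h.abs_mul_nearIntegral_le hwi hwb t ω)
      rw [c1, c2, ← integral_mul_const, ← integral_mul_const, ← integral_const_mul,
        ← integral_sub (d1.mul_const _) ((d2.mul_const _).const_mul _)]
      congr 1 with t
      simp only [hG]
      push_cast
      ring
    have e2 : D = ∫ t, (w t : ℂ) * ∫ ω, G t ω ∂P := by
      rw [hD]
      simp_rw [e1]
      rw [← integral_integral_swap]
      · congr 1 with t
        rw [integral_const_mul]
      · refine integrable_prod_of_bound (F := fun t ω => (w t : ℂ) * G t ω)
          (f := fun t => |w t| * (1 + |x| * K)) ?_ (hwi.abs.mul_const _) fun t ω => ?_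
        · exact ((Complex.measurable_ofReal.comp (hw.comp measurable_fst)).mul
            hGm).aestronglyMeasurable
        · rw [norm_mul, Complex.norm_real]
          exact mul_le_mul_of_nonneg_left (hGb t ω) (norm_nonneg _)
    -- Subtract the mean of `ξ_t exp (i x far_t)`, which vanishes; what is left is the second order
    -- remainder of the exponential of the near part.
    have e3 : ∀ t, ‖∫ ω, G t ω ∂P‖ ≤ 3 * (|x| * K) ^ 2 := by
      intro t
      set Z : Ω → ℂ := fun ω => (ξ t ω : ℂ) *
        Complex.exp (((x * farIntegral r w ξ t ω : ℝ) : ℂ) * Complex.I) with hZ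
      have hZ0 : ∫ ω, Z ω ∂P = 0 := h.integral_mul_cexp_farIntegral hw hwi t x
      have hfm : Measurable (farIntegral r w ξ t) := measurable_fieldIntegral
        (hw.indicator Metric.isClosed_closedBall.measurableSet.compl) h.measurable_uncurry
      have hξt := h.measurable_apply t
      have hZi : Integrable Z P := bint (C := 1) (by fun_prop) fun ω => by
        rw [hZ]
        simp only
        rw [norm_mul, Complex.norm_exp_ofReal_mul_I, mul_one, Complex.norm_real]
        exact h.abs_le_one t ω
      have hGi : Integrable (G t) P := bint hGm.of_uncurry_left (hGb t)
      rw [← sub_zero (∫ ω, G t ω ∂P), ← hZ0, ← integral_sub hGi hZi]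
      refine (norm_integral_le_of_norm_le_const (C := 3 * (|x| * K) ^ 2)
        (ae_of_all _ fun ω => ?_)).trans (by simp)
      have hfac : G t ω - Z ω = (ξ t ω : ℂ) * E ω * (1 - ((x * N t ω : ℝ) : ℂ) * Complex.I
          - Complex.exp (-(((x * N t ω : ℝ) : ℂ) * Complex.I))) := by
        have hexp : Complex.exp (((x * farIntegral r w ξ t ω : ℝ) : ℂ) * Complex.I)
            = E ω * Complex.exp (-(((x * N t ω : ℝ) : ℂ) * Complex.I)) := by
          rw [hE, ← Complex.exp_add]
          congr 1
          rw [hS, h.near_add_far hwi t ω]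
          push_cast
          ring
        simp only [hG, hZ]
        rw [hexp]
        push_cast
        ring
      rw [hfac, norm_mul, norm_mul, hE1, mul_one, Complex.norm_real]
      calc _ ≤ 1 * (3 * (x * N t ω) ^ 2) := by
            gcongr
            · exact h.abs_le_one t ω
            · exact norm_one_sub_sub_cexp_le _
        _ = 3 * (|x| * |N t ω|) ^ 2 := by rw [one_mul, ← abs_mul, sq_abs]
        _ ≤ 3 * (|x| * K) ^ 2 := by gcongr; exact hNK t ω
    rw [e2]
    calc _ ≤ ∫ t, ‖(w t : ℂ) * ∫ ω, G t ω ∂P‖ := norm_integral_le_integral_norm _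
      _ ≤ ∫ t, |w t| * (3 * (|x| * K) ^ 2) := by
          refine integral_mono_of_nonneg (ae_of_all _ fun t => norm_nonneg _)
            (hwi.abs.mul_const _) (ae_of_all _ fun t => ?_)
          simp only
          rw [norm_mul, Complex.norm_real]
          exact mul_le_mul_of_nonneg_left (e3 t) (norm_nonneg _)
      _ = 3 * (|x| * K) ^ 2 * W := by rw [integral_mul_const, mul_comm]
  calc _ ≤ ‖Complex.I * D‖ + ‖(x : ℂ) * ∫ ω, (((U ω - v : ℝ) : ℂ) * E ω) ∂P‖ := norm_sub_le _ _
    _ = ‖D‖ + |x| * ‖∫ ω, (((U ω - v : ℝ) : ℂ) * E ω) ∂P‖ := by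
        rw [norm_mul, norm_mul, Complex.norm_I, one_mul, Complex.norm_real, Real.norm_eq_abs]
    _ ≤ 3 * (|s| * K) ^ 2 * W + |s| * √VU := by
        gcongr
        exact hDbound.trans (by gcongr)
    _ = _ := by ring

end SteinEstimate

/-! ### The limit of the variance -/

section VarianceLimit

variable {ν : ℕ}

/-- The autocorrelation of a bounded integrable function is continuous, as a uniform limit of
correlations with continuous functions of compact support. -/
lemma continuous_integral_mul_comp_add {φ : Eucl ν → ℝ} (hφ : Measurable φ) (hφi : Integrable φ)
    {C : ℝ} (hφC : ∀ t, |φ t| ≤ C) : Continuous fun h => ∫ x, φ x * φ (x + h) := by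
  have hC0 : 0 ≤ C := (abs_nonneg _).trans (hφC 0)
  refine continuous_of_uniform_approx_of_continuous fun U hU => ?_
  obtain ⟨ε, hε, hεU⟩ := Metric.mem_uniformity_dist.1 hU
  obtain ⟨f, hfc, hfφ, hf, hfi⟩ :=
    hφi.exists_hasCompactSupport_integral_sub_le (ε := ε / (2 * (C + 1))) (by positivity)
  obtain ⟨M, hM⟩ := hfc.exists_bound_of_continuous hf
  have hcont : Continuous fun h => ∫ x, φ x * f (x + h) := by
    refine continuous_of_dominated (bound := fun x => |φ x| * M) (fun h => ?_) (fun h => ?_)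
      (hφi.abs.mul_const M) (ae_of_all _ fun x => by fun_prop)
    · exact hφ.aestronglyMeasurable.mul (by fun_prop)
    · refine ae_of_all _ fun x => ?_
      rw [norm_mul]
      exact mul_le_mul_of_nonneg_left (hM _) (norm_nonneg _)
  refine ⟨_, hcont, fun h => hεU ?_⟩
  have i1 : Integrable fun x => φ x * φ (x + h) :=
    hφi.mul_bdd (c := C) (hφ.comp (measurable_add_const h)).aestronglyMeasurable
      (ae_of_all _ fun x => hφC _)
  have i2 : Integrable fun x => φ x * f (x + h) :=
    hφi.mul_bdd (c := M) (by fun_prop) (ae_of_all _ fun x => hM _)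
  rw [Real.dist_eq, ← integral_sub i1 i2]
  have hd : Integrable fun x => ‖φ (x + h) - f (x + h)‖ :=
    ((hφi.sub hfi).norm).comp_add_right h
  calc |∫ x, (φ x * φ (x + h) - φ x * f (x + h))|
      ≤ ∫ x, |φ x * φ (x + h) - φ x * f (x + h)| := abs_integral_le_integral_abs
    _ ≤ ∫ x, C * ‖φ (x + h) - f (x + h)‖ := by
        refine integral_mono (i1.sub i2).abs (hd.const_mul C) fun x => ?_
        simp only
        rw [← mul_sub, abs_mul]
        exact mul_le_mul_of_nonneg_right (hφC x) (abs_nonneg _)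
    _ = C * ∫ x, ‖φ x - f x‖ := by
        rw [integral_const_mul, integral_add_right_eq_self (fun x => ‖φ x - f x‖) h]
    _ ≤ C * (ε / (2 * (C + 1))) := by gcongr
    _ < ε := by
        rw [mul_div_assoc', div_lt_iff₀ (by positivity)]
        nlinarith

/-- The weight `t ↦ λ^(-ν/2) φ(t/λ)`. -/
def scaledWeight (φ : Eucl ν → ℝ) (l : ℝ) (t : Eucl ν) : ℝ := l ^ (-(ν : ℝ) / 2) * φ (l⁻¹ • t)

lemma measurable_scaledWeight {φ : Eucl ν → ℝ} (hφ : Measurable φ) (l : ℝ) :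
    Measurable (scaledWeight φ l) := by
  unfold scaledWeight
  fun_prop

lemma integrable_scaledWeight {φ : Eucl ν → ℝ} (hφi : Integrable φ) {l : ℝ} (hl : 0 < l) :
    Integrable (scaledWeight φ l) :=
  (hφi.comp_smul (inv_ne_zero hl.ne')).const_mul _

lemma abs_scaledWeight_le {φ : Eucl ν → ℝ} {C : ℝ} (hφC : ∀ t, |φ t| ≤ C) {l : ℝ} (hl : 0 < l)
    (t : Eucl ν) : |scaledWeight φ l t| ≤ l ^ (-(ν : ℝ) / 2) * C := by
  rw [scaledWeight, abs_mul, abs_of_pos (Real.rpow_pos_of_pos hl _)]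
  gcongr
  exact hφC _

lemma integral_comp_inv_smul_eq (f : Eucl ν → ℝ) {l : ℝ} (hl : 0 < l) :
    ∫ t, f (l⁻¹ • t) = l ^ ν * ∫ t, f t := by
  rw [Measure.integral_comp_inv_smul_of_nonneg volume f hl.le, finrank_euclideanSpace_fin,
    smul_eq_mul]

lemma rpow_neg_half_mul_self {l : ℝ} (hl : 0 < l) :
    l ^ (-(ν : ℝ) / 2) * l ^ (-(ν : ℝ) / 2) = (l ^ ν)⁻¹ := by
  rw [← Real.rpow_add hl, add_halves, Real.rpow_neg hl.le, Real.rpow_natCast]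

lemma integral_abs_scaledWeight (φ : Eucl ν → ℝ) {l : ℝ} (hl : 0 < l) :
    ∫ t, |scaledWeight φ l t| = l ^ ((ν : ℝ) / 2) * ∫ t, |φ t| := by
  simp_rw [scaledWeight, abs_mul, abs_of_pos (Real.rpow_pos_of_pos hl _)]
  rw [integral_const_mul, integral_comp_inv_smul_eq (fun t => |φ t|) hl, ← mul_assoc,
    ← Real.rpow_natCast, ← Real.rpow_add hl]
  congr 2
  ring

lemma integral_scaledWeight_sq (φ : Eucl ν → ℝ) {l : ℝ} (hl : 0 < l) :
    ∫ t, scaledWeight φ l t ^ 2 = ∫ t, φ t ^ 2 := by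
  simp_rw [scaledWeight, mul_pow]
  rw [integral_const_mul, integral_comp_inv_smul_eq (fun t => φ t ^ 2) hl, sq,
    rpow_neg_half_mul_self hl, inv_mul_cancel_left₀ (pow_pos hl ν).ne']

lemma integral_scaledWeight_mul_comp_add (φ : Eucl ν → ℝ) {l : ℝ} (hl : 0 < l) (h : Eucl ν) :
    ∫ t, scaledWeight φ l t * scaledWeight φ l (t + h) = ∫ t, φ t * φ (t + l⁻¹ • h) := by
  have : ∀ t, scaledWeight φ l t * scaledWeight φ l (t + h)
      = (l ^ ν)⁻¹ * (φ (l⁻¹ • t) * φ (l⁻¹ • t + l⁻¹ • h)) := fun t => by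
    rw [scaledWeight, scaledWeight, ← rpow_neg_half_mul_self hl, smul_add]
    ring
  simp_rw [this]
  rw [integral_const_mul, integral_comp_inv_smul_eq (fun t => φ t * φ (t + l⁻¹ • h)) hl,
    inv_mul_cancel_left₀ (pow_pos hl ν).ne']

variable {Ω : Type*} [MeasurableSpace Ω] {P : Measure Ω} [IsProbabilityMeasure P]

/-- The second moment of a weighted integral of a stationary field is the integral of the
two point function against the autocorrelation of the weight. -/
lemma integral_fieldIntegral_sq_eq_of_stationary {w : Eucl ν → ℝ} (hw : Measurable w)
    (hwi : Integrable w) {b : ℝ} (hwb : ∀ t, |w t| ≤ b) {ξ : Eucl ν → Ω → ℝ}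
    (hξ : Measurable (Function.uncurry ξ)) {K : ℝ} (hξK : ∀ t ω, |ξ t ω| ≤ K) {ρ : Eucl ν → ℝ}
    (hρ : Integrable ρ) (hcov : ∀ s t, ∫ ω, ξ s ω * ξ t ω ∂P = ρ (t - s)) :
    ∫ ω, fieldIntegral w ξ ω ^ 2 ∂P = ∫ h, (∫ x, w x * w (x + h)) * ρ h := by
  rw [integral_fieldIntegral_sq hw hwi hξ hξK]
  have hmp := measurePreserving_prod_sub (volume : Measure (Eucl ν)) (volume : Measure (Eucl ν))
  set F : Eucl ν × Eucl ν → ℝ := fun z => w z.1 * w (z.1 + z.2) * ρ z.2 with hF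
  have hFm : AEStronglyMeasurable F
      ((volume : Measure (Eucl ν)).prod (volume : Measure (Eucl ν))) := by
    refine AEStronglyMeasurable.mul (Measurable.aestronglyMeasurable (by fun_prop)) ?_
    exact hρ.1.comp_snd
  have hFi : Integrable F ((volume : Measure (Eucl ν)).prod (volume : Measure (Eucl ν))) := by
    refine ((hwi.abs.mul_const b).mul_prod hρ.abs).mono' hFm (ae_of_all _ fun z => ?_)
    rw [norm_mul, norm_mul]
    exact mul_le_mul_of_nonneg_right (mul_le_mul_of_nonneg_left (hwb _) (norm_nonneg _))
      (norm_nonneg _)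
  have := integral_map (μ := (volume : Measure (Eucl ν × Eucl ν)))
    (φ := fun z : Eucl ν × Eucl ν => (z.1, z.2 - z.1)) (f := F) hmp.measurable.aemeasurable
    (by rw [Measure.volume_eq_prod, hmp.map_eq]; exact hFm)
  rw [Measure.volume_eq_prod, hmp.map_eq, integral_prod_symm F hFi] at this
  rw [Measure.volume_eq_prod]
  calc _ = ∫ z : Eucl ν × Eucl ν, F (z.1, z.2 - z.1) ∂(volume.prod volume) := by
        congr 1 with z
        simp only [hF]
        rw [hcov, add_sub_cancel]
    _ = _ := by
        rw [← this]
        congr 1 with h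
        simp only [hF]
        rw [integral_mul_const]

/-- Limit of the variances of the rescaled integrals of a stationary field. -/
lemma tendsto_integral_fieldIntegral_sq {φ : Eucl ν → ℝ} (hφ : Measurable φ)
    (hφi : Integrable φ) {C : ℝ} (hφC : ∀ t, |φ t| ≤ C) {ξ : Eucl ν → Ω → ℝ}
    (hξ : Measurable (Function.uncurry ξ)) {K : ℝ} (hξK : ∀ t ω, |ξ t ω| ≤ K) {ρ : Eucl ν → ℝ}
    (hρ : Integrable ρ) (hcov : ∀ s t, ∫ ω, ξ s ω * ξ t ω ∂P = ρ (t - s)) :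
    Tendsto (fun l : ℝ => ∫ ω, fieldIntegral (scaledWeight φ l) ξ ω ^ 2 ∂P) atTop
      (𝓝 ((∫ t, ρ t) * ∫ t, φ t ^ 2)) := by
  set g : Eucl ν → ℝ := fun h => ∫ x, φ x * φ (x + h) with hg
  have hgc : Continuous g := continuous_integral_mul_comp_add hφ hφi hφC
  have hgb : ∀ h, |g h| ≤ (∫ x, |φ x|) * C := fun h => by
    rw [← integral_mul_const]
    refine abs_integral_le_integral_abs.trans (integral_mono_of_nonneg
      (ae_of_all _ fun _ => abs_nonneg _) (hφi.abs.mul_const C) (ae_of_all _ fun x => ?_))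
    simp only
    rw [abs_mul]
    exact mul_le_mul_of_nonneg_left (hφC _) (abs_nonneg _)
  have hlim : Tendsto (fun l : ℝ => ∫ h, g (l⁻¹ • h) * ρ h) atTop (𝓝 (∫ h, g 0 * ρ h)) := by
    refine tendsto_integral_filter_of_dominated_convergence
      (fun h => (∫ x, |φ x|) * C * |ρ h|) (Eventually.of_forall fun l => ?_)
      (Eventually.of_forall fun l => ae_of_all _ fun h => ?_) (hρ.abs.const_mul _)
      (ae_of_all _ fun h => ?_)
    · exact (hgc.comp (continuous_const_smul _)).aestronglyMeasurable.mul hρ.1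
    · rw [norm_mul]
      exact mul_le_mul_of_nonneg_right (hgb _) (abs_nonneg _)
    · refine Tendsto.mul_const _ ((hgc.tendsto 0).comp ?_)
      have := (tendsto_inv_atTop_zero (𝕜 := ℝ)).smul_const h
      rwa [zero_smul] at this
  have h0 : ∫ h, g 0 * ρ h = (∫ t, ρ t) * ∫ t, φ t ^ 2 := by
    rw [integral_const_mul, mul_comm]
    congr 1
    simp only [hg, add_zero, sq]
  rw [h0] at hlim
  refine hlim.congr' ?_
  filter_upwards [eventually_gt_atTop 0] with l hl
  rw [integral_fieldIntegral_sq_eq_of_stationary (measurable_scaledWeight hφ l)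
    (integrable_scaledWeight hφi hl) (abs_scaledWeight_le hφC hl) hξ hξK hρ hcov]
  simp_rw [integral_scaledWeight_mul_comp_add φ hl, hg]

end VarianceLimit

/-! ### Central limit theorem for approximable stationary fields -/

section Approximation

lemma norm_cexp_mul_I_sub_le (x y : ℝ) :
    ‖Complex.exp ((x : ℂ) * Complex.I) - Complex.exp ((y : ℂ) * Complex.I)‖ ≤ |x - y| := by
  have h : Complex.exp ((x : ℂ) * Complex.I) - Complex.exp ((y : ℂ) * Complex.I)
      = Complex.exp ((y : ℂ) * Complex.I) * (Complex.exp (Complex.I * ((x - y : ℝ) : ℂ)) - 1) := by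
    rw [mul_sub, ← Complex.exp_add, mul_one]
    congr 2
    push_cast
    ring
  rw [h, norm_mul, Complex.norm_exp_ofReal_mul_I, one_mul]
  exact Real.norm_exp_I_mul_ofReal_sub_one_le

lemma abs_exp_neg_sub_exp_neg_le {a b : ℝ} (ha : 0 ≤ a) (hb : 0 ≤ b) :
    |Real.exp (-a) - Real.exp (-b)| ≤ |a - b| := by
  wlog hab : a ≤ b generalizing a b
  · rw [abs_sub_comm, abs_sub_comm a]
    exact this hb ha (le_of_not_ge hab)
  have h1 : Real.exp (-b) = Real.exp (-a) * Real.exp (-(b - a)) := by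
    rw [← Real.exp_add]
    congr 1
    ring
  have h2 : 1 - (b - a) ≤ Real.exp (-(b - a)) := Real.one_sub_le_exp_neg _
  have h3 : Real.exp (-a) ≤ 1 := Real.exp_le_one_iff.2 (by linarith)
  have h4 := Real.exp_pos (-a)
  rw [abs_of_nonneg (sub_nonneg.2 (Real.exp_le_exp.2 (by linarith))), abs_of_nonpos (by linarith),
    h1]
  nlinarith

variable {Ω : Type*} [MeasurableSpace Ω] {P : Measure Ω}

lemma abs_integral_mul_le_sqrt {X Y : Ω → ℝ} (hX : MemLp X 2 P) (hY : MemLp Y 2 P) :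
    |∫ ω, X ω * Y ω ∂P| ≤ √(∫ ω, X ω ^ 2 ∂P) * √(∫ ω, Y ω ^ 2 ∂P) := by
  have hXY : Integrable (fun ω => X ω * Y ω) P := hX.integrable_mul hY
  have h := discrim_le_zero (a := ∫ ω, X ω ^ 2 ∂P) (b := 2 * ∫ ω, X ω * Y ω ∂P)
    (c := ∫ ω, Y ω ^ 2 ∂P) fun t => by
      have : ∫ ω, (t * X ω + Y ω) ^ 2 ∂P = (∫ ω, X ω ^ 2 ∂P) * (t * t)
          + (2 * ∫ ω, X ω * Y ω ∂P) * t + ∫ ω, Y ω ^ 2 ∂P := by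
        have e : ∀ ω, (t * X ω + Y ω) ^ 2
            = (t * t) * X ω ^ 2 + (2 * t) * (X ω * Y ω) + Y ω ^ 2 := fun ω => by ring
        have i1 : Integrable (fun ω => (t * t) * X ω ^ 2) P := hX.integrable_sq.const_mul _
        have i2 : Integrable (fun ω => (2 * t) * (X ω * Y ω)) P := hXY.const_mul _
        have i3 : Integrable (fun ω => (t * t) * X ω ^ 2 + (2 * t) * (X ω * Y ω)) P := i1.add i2
        simp_rw [e]
        rw [integral_add i3 hY.integrable_sq, integral_add i1 i2, integral_const_mul,
          integral_const_mul]
        ring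
      rw [← this]
      exact integral_nonneg fun _ => sq_nonneg _
  rw [← Real.sqrt_mul (integral_nonneg fun _ => sq_nonneg _)]
  refine Real.abs_le_sqrt ?_
  rw [discrim] at h
  linarith

lemma abs_integral_sq_sub_le {X Y : Ω → ℝ} (hX : MemLp X 2 P) (hY : MemLp Y 2 P) {δ v : ℝ}
    (hδ : ∫ ω, (X ω - Y ω) ^ 2 ∂P ≤ δ) (hv : ∫ ω, Y ω ^ 2 ∂P ≤ v) :
    |∫ ω, X ω ^ 2 ∂P - ∫ ω, Y ω ^ 2 ∂P| ≤ δ + 2 * (√δ * √v) := by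
  have hD : MemLp (fun ω => X ω - Y ω) 2 P := hX.sub hY
  have i : Integrable (fun ω => 2 * ((X ω - Y ω) * Y ω)) P := (hD.integrable_mul hY).const_mul 2
  have e : ∫ ω, X ω ^ 2 ∂P - ∫ ω, Y ω ^ 2 ∂P
      = ∫ ω, (X ω - Y ω) ^ 2 ∂P + 2 * ∫ ω, (X ω - Y ω) * Y ω ∂P := by
    rw [← integral_sub hX.integrable_sq hY.integrable_sq, ← integral_const_mul,
      ← integral_add hD.integrable_sq i]
    congr 1 with ω
    ring
  rw [e]
  refine (abs_add_le _ _).trans (add_le_add ?_ ?_)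
  · rwa [abs_of_nonneg (integral_nonneg fun _ => sq_nonneg _)]
  · rw [abs_mul, abs_two]
    have h1 := abs_integral_mul_le_sqrt hD hY
    have h2 := Real.sqrt_le_sqrt hδ
    have h3 := Real.sqrt_le_sqrt hv
    gcongr
    exact h1.trans (by gcongr)

variable [IsProbabilityMeasure P] {ν : ℕ}

/-- **Central limit theorem** for the rescaled integrals of a stationary field which is approximated
by fields with finite range of dependence, uniformly in the scale. -/
theorem tendsto_integral_cexp_fieldIntegral (hν : 1 ≤ ν) {φ : Eucl ν → ℝ} (hφ : Measurable φ)
    (hφi : Integrable φ) {C : ℝ} (hφC : ∀ t, |φ t| ≤ C) {ξ : Eucl ν → Ω → ℝ}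
    (hξ : Measurable (Function.uncurry ξ)) (hξ1 : ∀ t ω, |ξ t ω| ≤ 1) {ρ : Eucl ν → ℝ}
    (hρ : Integrable ρ) (hcov : ∀ s t, ∫ ω, ξ s ω * ξ t ω ∂P = ρ (t - s))
    {ζ : ℕ → Eucl ν → Ω → ℝ} {r : ℕ → ℝ} (hr : ∀ n, 0 ≤ r n)
    (hζ : ∀ n, IsFiniteRangeField (ζ n) (r n) P) {κ : ℕ → Eucl ν → ℝ}
    (hκ : ∀ n, Integrable (κ n)) (hκ0 : Tendsto (fun n => ∫ t, κ n t) atTop (𝓝 0))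
    (hD : ∀ n s t, |∫ ω, (ζ n s ω - ξ s ω) * (ζ n t ω - ξ t ω) ∂P| ≤ κ n (t - s)) (s : ℝ) :
    Tendsto (fun l : ℝ => ∫ ω, Complex.exp
        (((s * fieldIntegral (scaledWeight φ l) ξ ω : ℝ) : ℂ) * Complex.I) ∂P) atTop
      (𝓝 (Complex.exp ((-(s ^ 2 * ((∫ t, ρ t) * ∫ t, φ t ^ 2) / 2) : ℝ) : ℂ))) := by
  set v : ℝ → ℝ := fun l => ∫ ω, fieldIntegral (scaledWeight φ l) ξ ω ^ 2 ∂P with hv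
  have hvlim : Tendsto v atTop (𝓝 ((∫ t, ρ t) * ∫ t, φ t ^ 2)) :=
    tendsto_integral_fieldIntegral_sq hφ hφi hφC hξ hξ1 hρ hcov
  set V : ℝ := (∫ t, ρ t) * (∫ t, φ t ^ 2) + 1 with hV
  set δ : ℕ → ℝ := fun n => (∫ t, κ n t) * ∫ t, φ t ^ 2 with hδ
  have hδ0 : Tendsto δ atTop (𝓝 0) := by simpa using hκ0.mul_const (∫ t, φ t ^ 2)
  -- The error of the normal approximation of the `n`-th field, for a weight of size `b`.
  set err : ℕ → ℝ → ℝ := fun n b =>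
    |s| * (|s| * √((2 * (b * volume.real (Metric.closedBall (0 : Eucl ν) (r n)))) ^ 2 *
          volume.real (Metric.closedBall (0 : Eucl ν) (3 * r n)) * (C * ∫ t, |φ t|))
        + 3 * (|s| * volume.real (Metric.closedBall (0 : Eucl ν) (r n))) ^ 2 * b *
          (C * ∫ t, |φ t|)) with herr
  have hφ2 : Integrable fun t => φ t ^ 2 := by
    simp_rw [sq]
    exact hφi.mul_bdd (c := C) hφ.aestronglyMeasurable (ae_of_all _ hφC)
  have hscale : Tendsto (fun l : ℝ => l ^ (-(ν : ℝ) / 2) * C) atTop (𝓝 0) := by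
    have h1 : 0 < (ν : ℝ) / 2 := by positivity
    have := (tendsto_rpow_neg_atTop h1).mul_const C
    rw [zero_mul] at this
    simpa only [neg_div] using this
  have herr0 : ∀ n, Tendsto (fun l : ℝ => err n (l ^ (-(ν : ℝ) / 2) * C)) atTop (𝓝 0) := by
    intro n
    have hc : Continuous (err n) := by
      simp only [herr]
      fun_prop
    have := (hc.tendsto 0).comp hscale
    have h0 : err n 0 = 0 := by simp [herr]
    rwa [h0] at this
  have hbound : ∀ n, ∀ l : ℝ, 0 < l → v l ≤ V →
      ‖∫ ω, Complex.exp (((s * fieldIntegral (scaledWeight φ l) ξ ω : ℝ) : ℂ) * Complex.I) ∂P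
        - Complex.exp ((-(s ^ 2 * v l / 2) : ℝ) : ℂ)‖
      ≤ |s| * √(δ n) + err n (l ^ (-(ν : ℝ) / 2) * C)
        + s ^ 2 / 2 * (δ n + 2 * (√(δ n) * √V)) := by
    intro n l hl hvl
    set w := scaledWeight φ l with hw
    have hwm : Measurable w := measurable_scaledWeight hφ l
    have hwi : Integrable w := integrable_scaledWeight hφi hl
    have hwb := abs_scaledWeight_le hφC hl
    have hw2 : Integrable fun t => w t ^ 2 := by
      simp_rw [sq]
      exact hwi.mul_bdd (c := l ^ (-(ν : ℝ) / 2) * C) hwm.aestronglyMeasurable (ae_of_all _ hwb)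
    set S := fieldIntegral w ξ with hS
    set S' := fieldIntegral w (ζ n) with hS'
    have hSm : Measurable S := measurable_fieldIntegral hwm hξ
    have hSm' : Measurable S' := measurable_fieldIntegral hwm (hζ n).measurable_uncurry
    have mS : MemLp S 2 P := MemLp.of_bound hSm.aestronglyMeasurable (∫ t, |w t|)
      (ae_of_all _ (abs_fieldIntegral_le hwi hξ1))
    have mS' : MemLp S' 2 P := MemLp.of_bound hSm'.aestronglyMeasurable (∫ t, |w t|)
      (ae_of_all _ (abs_fieldIntegral_le hwi (hζ n).abs_le_one))
    have hdiff : ∀ ω, S' ω - S ω = fieldIntegral w (fun t ω => ζ n t ω - ξ t ω) ω := by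
      intro ω
      have i1 : Integrable fun t => w t * ξ t ω :=
        hwi.mul_bdd (c := 1) hξ.of_uncurry_right.aestronglyMeasurable
          (ae_of_all _ fun t => hξ1 t ω)
      rw [hS, hS', fieldIntegral, fieldIntegral, fieldIntegral,
        ← integral_sub ((hζ n).integrable_mul_apply hwi ω) i1]
      congr 1 with t
      ring
    have hSS : ∫ ω, (S' ω - S ω) ^ 2 ∂P ≤ δ n := by
      simp_rw [hdiff]
      refine (integral_fieldIntegral_sq_le hwm hwi hw2
        ((hζ n).measurable_uncurry.sub hξ) (K := 2) (fun t ω => ?_) (hκ n) (hD n)).trans_eq ?_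
      · exact (abs_sub _ _).trans (by linarith [(hζ n).abs_le_one t ω, hξ1 t ω])
      · rw [hδ, hw, integral_scaledWeight_sq φ hl]
    have h1 : ‖∫ ω, Complex.exp (((s * S ω : ℝ) : ℂ) * Complex.I) ∂P
        - ∫ ω, Complex.exp (((s * S' ω : ℝ) : ℂ) * Complex.I) ∂P‖ ≤ |s| * √(δ n) := by
      have int : ∀ {Z : Ω → ℝ}, Measurable Z →
          Integrable (fun ω => Complex.exp (((s * Z ω : ℝ) : ℂ) * Complex.I)) P := fun hZ =>
        Integrable.of_bound (Measurable.aestronglyMeasurable (by fun_prop)) 1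
          (ae_of_all _ fun ω => (Complex.norm_exp_ofReal_mul_I _).le)
      rw [← integral_sub (int hSm) (int hSm')]
      calc _ ≤ ∫ ω, ‖Complex.exp (((s * S ω : ℝ) : ℂ) * Complex.I)
            - Complex.exp (((s * S' ω : ℝ) : ℂ) * Complex.I)‖ ∂P :=
            norm_integral_le_integral_norm _
        _ ≤ ∫ ω, |s| * |S' ω - S ω| ∂P := by
            refine integral_mono ((int hSm).sub (int hSm')).norm
              (((mS'.sub mS).integrable one_le_two).abs.const_mul _) fun ω => ?_
            refine (norm_cexp_mul_I_sub_le _ _).trans_eq ?_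
            rw [← mul_sub, abs_mul, abs_sub_comm]
        _ = |s| * ∫ ω, |S' ω - S ω| ∂P := integral_const_mul _ _
        _ ≤ |s| * √(δ n) := by
            gcongr
            exact (integral_abs_le_sqrt (mS'.sub mS)).trans (Real.sqrt_le_sqrt hSS)
    have h2 : ‖∫ ω, Complex.exp (((s * S' ω : ℝ) : ℂ) * Complex.I) ∂P
        - Complex.exp ((-(s ^ 2 * (∫ ω, S' ω ^ 2 ∂P) / 2) : ℝ) : ℂ)‖
        ≤ err n (l ^ (-(ν : ℝ) / 2) * C) := by
      refine ((hζ n).norm_charFun_sub_le (hr n) hwm hwi hwb s).trans_eq ?_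
      have e1 : l ^ (-(ν : ℝ) / 2) * C * ∫ t, |w t| = C * ∫ t, |φ t| := by
        rw [hw, integral_abs_scaledWeight φ hl]
        have : l ^ (-(ν : ℝ) / 2) * l ^ ((ν : ℝ) / 2) = 1 := by
          rw [← Real.rpow_add hl, neg_div, neg_add_cancel, Real.rpow_zero]
        linear_combination (C * ∫ t, |φ t|) * this
      simp only [herr]
      rw [← e1]
      ring
    have h3 : ‖Complex.exp ((-(s ^ 2 * (∫ ω, S' ω ^ 2 ∂P) / 2) : ℝ) : ℂ)
        - Complex.exp ((-(s ^ 2 * v l / 2) : ℝ) : ℂ)‖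
        ≤ s ^ 2 / 2 * (δ n + 2 * (√(δ n) * √V)) := by
      rw [← Complex.ofReal_exp, ← Complex.ofReal_exp, ← Complex.ofReal_sub, Complex.norm_real,
        Real.norm_eq_abs]
      have p1 : 0 ≤ ∫ ω, S' ω ^ 2 ∂P := integral_nonneg fun _ => sq_nonneg _
      have p2 : 0 ≤ v l := integral_nonneg fun _ => sq_nonneg _
      refine (abs_exp_neg_sub_exp_neg_le (by positivity) (by positivity)).trans ?_
      rw [show s ^ 2 * (∫ ω, S' ω ^ 2 ∂P) / 2 - s ^ 2 * v l / 2
        = s ^ 2 / 2 * (∫ ω, S' ω ^ 2 ∂P - v l) by ring, abs_mul, abs_of_nonneg (by positivity)]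
      gcongr
      exact abs_integral_sq_sub_le mS' mS hSS hvl
    calc _ ≤ _ := norm_sub_le_norm_sub_add_norm_sub _
            (∫ ω, Complex.exp (((s * S' ω : ℝ) : ℂ) * Complex.I) ∂P) _
      _ ≤ |s| * √(δ n) + (err n (l ^ (-(ν : ℝ) / 2) * C)
          + s ^ 2 / 2 * (δ n + 2 * (√(δ n) * √V))) := by
          refine add_le_add h1 ((norm_sub_le_norm_sub_add_norm_sub _ _ _).trans (add_le_add h2 h3))
      _ = _ := by ring
  -- The bound is small for large `n`, and then for large `l`.
  have hdiff0 : Tendsto (fun l : ℝ =>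
      ∫ ω, Complex.exp (((s * fieldIntegral (scaledWeight φ l) ξ ω : ℝ) : ℂ) * Complex.I) ∂P
        - Complex.exp ((-(s ^ 2 * v l / 2) : ℝ) : ℂ)) atTop (𝓝 0) := by
    rw [Metric.tendsto_nhds]
    intro ε hε
    have hA : Tendsto (fun n => |s| * √(δ n) + s ^ 2 / 2 * (δ n + 2 * (√(δ n) * √V))) atTop
        (𝓝 0) := by
      have h1 : Tendsto (fun n => √(δ n)) atTop (𝓝 0) := by
        rw [← Real.sqrt_zero]
        exact (Real.continuous_sqrt.tendsto 0).comp hδ0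
      have := (h1.const_mul |s|).add
        ((hδ0.add ((h1.mul_const √V).const_mul 2)).const_mul (s ^ 2 / 2))
      simpa using this
    obtain ⟨n, hn⟩ := (hA.eventually (gt_mem_nhds (half_pos hε))).exists
    filter_upwards [eventually_gt_atTop 0, (herr0 n).eventually (gt_mem_nhds (half_pos hε)),
      hvlim.eventually (gt_mem_nhds (lt_add_one _))] with l hl hl1 hl2
    rw [dist_zero_right]
    refine (hbound n l hl hl2.le).trans_lt ?_
    linarith
  have hG : Tendsto (fun l => Complex.exp ((-(s ^ 2 * v l / 2) : ℝ) : ℂ)) atTop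
      (𝓝 (Complex.exp ((-(s ^ 2 * ((∫ t, ρ t) * ∫ t, φ t ^ 2) / 2) : ℝ) : ℂ))) := by
    have hc : Continuous fun x : ℝ => Complex.exp ((-(s ^ 2 * x / 2) : ℝ) : ℂ) := by fun_prop
    exact (hc.tendsto _).comp hvlim
  simpa using hdiff0.add hG

end Approximation

/-! ### Central limit theorem for covering fields -/

section CoverFieldLimit

variable {Ω : Type*} [MeasurableSpace Ω] {P : Measure Ω}

lemma covariance_congr_ae {X Y X' Y' : Ω → ℝ} (hX : X =ᵐ[P] X') (hY : Y =ᵐ[P] Y') :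
    covariance X Y P = covariance X' Y' P := by
  unfold covariance
  rw [integral_congr_ae hX, integral_congr_ae hY]
  refine integral_congr_ae ?_
  filter_upwards [hX, hY] with ω h1 h2
  rw [h1, h2]

lemma covariance_eq_of_identDistrib {X Y X' Y' : Ω → ℝ}
    (h : IdentDistrib (fun ω => (X ω, Y ω)) (fun ω => (X' ω, Y' ω)) P P) :
    covariance X Y P = covariance X' Y' P := by
  have h1 : ∫ ω, X ω ∂P = ∫ ω, X' ω ∂P := (h.comp measurable_fst).integral_eq
  have h2 : ∫ ω, Y ω ∂P = ∫ ω, Y' ω ∂P := (h.comp measurable_snd).integral_eq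
  unfold covariance
  rw [h1, h2]
  exact (h.comp (u := fun p : ℝ × ℝ => (p.1 - ∫ ω, X' ω ∂P) * (p.2 - ∫ ω, Y' ω ∂P))
    (by fun_prop)).integral_eq

/-- The field `X_t - E X_t`. -/
def centred {T : Type*} (P : Measure Ω) (X : T → Ω → ℝ) (t : T) (ω : Ω) : ℝ :=
  X t ω - ∫ ω', X t ω' ∂P

/-- The indicator function of `[k, ∞)`. -/
def exceed (k : ℕ) (x : ℝ) : ℝ := (Set.Ici (k : ℝ)).indicator (fun _ => 1) x

lemma measurable_exceed (k : ℕ) : Measurable (exceed k) :=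
  measurable_const.indicator measurableSet_Ici

lemma exceed_mem_Icc (k : ℕ) (x : ℝ) : exceed k x ∈ Set.Icc (0 : ℝ) 1 := by
  unfold exceed
  by_cases h : x ∈ Set.Ici (k : ℝ) <;> simp [h]

lemma abs_exceed_le_one (k : ℕ) (x : ℝ) : |exceed k x| ≤ 1 := by
  rw [abs_of_nonneg (exceed_mem_Icc k x).1]
  exact (exceed_mem_Icc k x).2

lemma abs_exceed_sub_le_one (k : ℕ) (x y : ℝ) : |exceed k x - exceed k y| ≤ 1 := by
  have h1 := exceed_mem_Icc k x
  have h2 := exceed_mem_Icc k y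
  exact abs_le.2 ⟨by linarith [h1.1, h2.2], by linarith [h1.2, h2.1]⟩

variable [IsProbabilityMeasure P]

lemma measurable_centred {T : Type*} [MeasurableSpace T] {X : T → Ω → ℝ}
    (hX : Measurable (Function.uncurry X)) : Measurable (Function.uncurry (centred P X)) :=
  hX.sub ((hX.stronglyMeasurable.integral_prod_right' (ν := P)).measurable.comp measurable_fst)

lemma abs_centred_le_one {T : Type*} [MeasurableSpace T] {X : T → Ω → ℝ}
    (hX : Measurable (Function.uncurry X)) (h01 : ∀ t ω, X t ω ∈ Set.Icc (0 : ℝ) 1) (t : T)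
    (ω : Ω) : |centred P X t ω| ≤ 1 := by
  have hi : Integrable (X t) P := Integrable.of_bound hX.of_uncurry_left.aestronglyMeasurable 1
    (ae_of_all _ fun ω => by
      rw [Real.norm_of_nonneg (h01 t ω).1]
      exact (h01 t ω).2)
  have h1 : 0 ≤ ∫ ω, X t ω ∂P := integral_nonneg fun ω => (h01 t ω).1
  have h2 : ∫ ω, X t ω ∂P ≤ 1 := by
    simpa using integral_mono hi (integrable_const (1 : ℝ)) fun ω => (h01 t ω).2
  have h3 := h01 t ω
  exact abs_le.2 ⟨by rw [centred]; linarith [h3.1], by rw [centred]; linarith [h3.2]⟩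

variable {ν : ℕ} {u : ℕ → Ω → Eucl ν} {Ξ : ℕ → Ω → ClosedSets ν} {Q : Measure (ClosedSets ν)}
  [IsProbabilityMeasure Q]

lemma IsBooleanModel.covariance_coverField_eq (h : IsBooleanModel u Ξ Q P)
    (hQ : ∫⁻ F, volume (F : Set (Eucl ν)) ^ 2 ∂Q < ∞) {f : ℝ × ℝ → ℝ} (hf : Measurable f) (R : ℝ)
    (s t : Eucl ν) :
    covariance (coverField u Ξ f R s) (coverField u Ξ f R t) P
      = covariance (coverField u Ξ f R 0) (coverField u Ξ f R (t - s)) P :=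
  covariance_eq_of_identDistrib (h.identDistrib_coverField hQ hf R s t)

lemma IsBooleanModel.integrable_covariance_coverField (h : IsBooleanModel u Ξ Q P)
    (hQ : ∫⁻ F, volume (F : Set (Eucl ν)) ^ 2 ∂Q < ∞) {f : ℝ × ℝ → ℝ} (hf : Measurable f)
    (hf1 : ∀ x, |f x| ≤ 1) (R : ℝ) :
    Integrable fun t => covariance (coverField u Ξ f R 0) (coverField u Ξ f R t) P := by
  refine ((integrable_meanOverlap Q hQ).const_mul 6).mono' ?_ (ae_of_all _ fun t => ?_)
  · have h1 : Measurable (Function.uncurry (centred P (coverField u Ξ f R))) :=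
      measurable_centred (h.measurable_coverField hf R)
    have h2 : Measurable fun q : Eucl ν × Ω =>
        centred P (coverField u Ξ f R) 0 q.2 * centred P (coverField u Ξ f R) q.1 q.2 :=
      (h1.of_uncurry_left.comp measurable_snd).mul h1
    exact (h2.stronglyMeasurable.integral_prod_right' (ν := P)).aestronglyMeasurable
  · simpa using h.abs_covariance_coverField_le hQ hf hf1 R 0 t

/-- The covariances of a covering field which vanishes when the near count agrees with the full
count are small. -/
lemma IsBooleanModel.abs_covariance_coverField_le_farIntensity (h : IsBooleanModel u Ξ Q P)
    (hQ : ∫⁻ F, volume (F : Set (Eucl ν)) ^ 2 ∂Q < ∞) {f : ℝ × ℝ → ℝ} (hf : Measurable f)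
    (hf1 : ∀ x, |f x| ≤ 1) (hf0 : ∀ x, f (x, x) = 0) (R : ℝ) (s t : Eucl ν) :
    |covariance (coverField u Ξ f R s) (coverField u Ξ f R t) P|
      ≤ 6 * (farIntensity Q R).toReal := by
  have hy := h.hasPoissonFunctional.measurable
  refine (abs_covariance_le_of_indepFun (X' := fun _ => 0) (Y' := coverField u Ξ f R t)
    (h.measurable_coverField_apply hf R s) (h.measurable_coverField_apply hf R t)
    measurable_const (h.measurable_coverField_apply hf R t) (fun _ => hf1 _) (fun _ => hf1 _)
    (fun _ => by simp) (fun _ => hf1 _)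
    (measurableSet_eq_fun (measurable_pointCount hy (measurableSet_nearCoverSet R s))
      (measurable_pointCount hy (measurableSet_coverSet s))).compl (fun ω hω => ?_)
    (fun _ _ => rfl) (indepFun_const_left 0 _)).trans ?_
  · have heq : pointCount (fun j ω => (u j ω, Ξ j ω)) (nearCoverSet R s) ω
        = pointCount (fun j ω => (u j ω, Ξ j ω)) (coverSet s) ω := not_not.1 hω
    rw [coverField, heq, hf0]
  · exact mul_le_mul_of_nonneg_left (h.measureReal_pointCount_ne_le hQ R s) (by norm_num)

lemma IsBooleanModel.isFiniteRangeField_centred (h : IsBooleanModel u Ξ Q P)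
    (hQ : ∫⁻ F, volume (F : Set (Eucl ν)) ^ 2 ∂Q < ∞) (k : ℕ) (R : ℝ) :
    IsFiniteRangeField (centred P (coverField u Ξ (fun x => exceed k x.1) R)) (2 * R) P where
  measurable_uncurry := measurable_centred
    (h.measurable_coverField ((measurable_exceed k).comp measurable_fst) R)
  abs_le_one := abs_centred_le_one
    (h.measurable_coverField ((measurable_exceed k).comp measurable_fst) R)
    fun _ _ => exceed_mem_Icc k _
  integral_eq_zero t := by
    have hi : Integrable (coverField u Ξ (fun x => exceed k x.1) R t) P :=
      Integrable.of_bound (h.measurable_coverField_apply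
        ((measurable_exceed k).comp measurable_fst) R t).aestronglyMeasurable 1
        (ae_of_all _ fun ω => abs_exceed_le_one k _)
    unfold centred
    rw [integral_sub hi (integrable_const _)]
    simp
  indepFun s t hst := by
    have := h.indepFun_coverField hQ (measurable_exceed k) R s t hst
    exact this.comp
      (φ := fun v i => v i - ∫ ω', coverField u Ξ (fun x => exceed k x.1) R (s i) ω' ∂P)
      (ψ := fun v i => v i - ∫ ω', coverField u Ξ (fun x => exceed k x.1) R (t i) ω' ∂P)
      (by fun_prop) (by fun_prop)

/-- Central limit theorem for the rescaled integrals of the centred excursion field. The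
approximating fields keep only the grains whose germ is within distance `n` of the point. -/
theorem IsBooleanModel.tendsto_integral_cexp_coverField (h : IsBooleanModel u Ξ Q P)
    (hQ : ∫⁻ F, volume (F : Set (Eucl ν)) ^ 2 ∂Q < ∞) (hν : 1 ≤ ν) (k : ℕ) {φ : Eucl ν → ℝ}
    (hφ : Measurable φ) (hφi : Integrable φ) {C : ℝ} (hφC : ∀ t, |φ t| ≤ C) (s : ℝ) :
    Tendsto (fun l : ℝ => ∫ ω, Complex.exp (((s * fieldIntegral (scaledWeight φ l)
        (centred P (coverField u Ξ (fun x => exceed k x.2) 0)) ω : ℝ) : ℂ) * Complex.I) ∂P) atTop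
      (𝓝 (Complex.exp ((-(s ^ 2 * ((∫ t, covariance (coverField u Ξ (fun x => exceed k x.2) 0 0)
        (coverField u Ξ (fun x => exceed k x.2) 0 t) P) * ∫ t, φ t ^ 2) / 2) : ℝ) : ℂ))) := by
  have hf : Measurable fun x : ℝ × ℝ => exceed k x.2 := (measurable_exceed k).comp measurable_snd
  have hf1 : Measurable fun x : ℝ × ℝ => exceed k x.1 := (measurable_exceed k).comp measurable_fst
  have hX := h.measurable_coverField hf 0
  have hκm : ∀ n : ℕ, AEStronglyMeasurable
      (fun t : Eucl ν => 6 * min (meanOverlap Q t) (farIntensity Q n).toReal) := fun n =>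
    (((measurable_overlap Q).ennreal_toReal.min measurable_const).const_mul 6).aestronglyMeasurable
  have hκb : ∀ (n : ℕ) (t : Eucl ν),
      ‖6 * min (meanOverlap Q t) (farIntensity Q n).toReal‖ ≤ 6 * meanOverlap Q t := fun n t => by
    rw [Real.norm_of_nonneg (mul_nonneg (by norm_num)
      (le_min (meanOverlap_nonneg Q t) ENNReal.toReal_nonneg))]
    gcongr
    exact min_le_left _ _
  have hm6 := (integrable_meanOverlap Q hQ).const_mul 6
  refine tendsto_integral_cexp_fieldIntegral hν hφ hφi hφC (measurable_centred hX)
    (abs_centred_le_one hX fun _ _ => exceed_mem_Icc k _)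
    (h.integrable_covariance_coverField hQ hf (fun x => abs_exceed_le_one k _) 0)
    (fun a b => h.covariance_coverField_eq hQ hf 0 a b)
    (ζ := fun n => centred P (coverField u Ξ (fun x => exceed k x.1) n)) (r := fun n => 2 * n)
    (fun n => by positivity) (fun n => h.isFiniteRangeField_centred hQ k n)
    (κ := fun n t => 6 * min (meanOverlap Q t) (farIntensity Q n).toReal)
    (fun n => hm6.mono' (hκm n) (ae_of_all _ (hκb n))) ?_ (fun n a b => ?_) s
  · -- Dominated convergence, as `farIntensity Q n` tends to `0` and the mean overlap is integrable.
    have hlim := tendsto_integral_of_dominated_convergence (μ := (volume : Measure (Eucl ν)))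
      (F := fun (n : ℕ) t => 6 * min (meanOverlap Q t) (farIntensity Q n).toReal) (f := fun _ => 0)
      (fun t => 6 * meanOverlap Q t) hκm hm6 (fun n => ae_of_all _ (hκb n))
      (ae_of_all _ fun t => ?_)
    · simpa using hlim
    · have h1 : Tendsto (fun n : ℕ => (farIntensity Q n).toReal) atTop (𝓝 0) := by
        rw [← ENNReal.toReal_zero]
        exact (ENNReal.tendsto_toReal ENNReal.zero_ne_top).comp (tendsto_farIntensity Q hQ)
      have h2 := (tendsto_const_nhds (x := meanOverlap Q t)).min h1
      rw [min_eq_right (meanOverlap_nonneg Q t)] at h2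
      simpa using h2.const_mul 6
  · -- The difference of the fields is the centred covering field of `1(a ≥ k) - 1(b ≥ k)`.
    set g : ℝ × ℝ → ℝ := fun x => exceed k x.1 - exceed k x.2 with hg
    have hgm : Measurable g := hf1.sub hf
    have int : ∀ {f : ℝ × ℝ → ℝ}, Measurable f → (∀ x, |f x| ≤ 1) → ∀ t,
        Integrable (coverField u Ξ f n t) P := fun hf hb t =>
      Integrable.of_bound (h.measurable_coverField_apply hf n t).aestronglyMeasurable 1
        (ae_of_all _ fun ω => hb _)
    have e : ∀ t ω, centred P (coverField u Ξ (fun x => exceed k x.1) n) t ω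
        - centred P (coverField u Ξ (fun x => exceed k x.2) 0) t ω
        = coverField u Ξ g n t ω - ∫ ω', coverField u Ξ g n t ω' ∂P := by
      intro t ω
      have e1 : ∫ ω', coverField u Ξ g n t ω' ∂P
          = ∫ ω', coverField u Ξ (fun x => exceed k x.1) n t ω' ∂P
            - ∫ ω', coverField u Ξ (fun x => exceed k x.2) n t ω' ∂P :=
        integral_sub (int hf1 (fun _ => abs_exceed_le_one k _) t)
          (int hf (fun _ => abs_exceed_le_one k _) t)
      have e2 : coverField u Ξ (fun x => exceed k x.2) 0 t
          = coverField u Ξ (fun x => exceed k x.2) n t := rfl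
      have e3 : coverField u Ξ g n t ω = coverField u Ξ (fun x => exceed k x.1) n t ω
          - coverField u Ξ (fun x => exceed k x.2) n t ω := rfl
      rw [centred, centred, e1, e2, e3]
      ring
    simp_rw [e]
    have hcov : ∫ ω, (coverField u Ξ g n a ω - ∫ ω', coverField u Ξ g n a ω' ∂P)
        * (coverField u Ξ g n b ω - ∫ ω', coverField u Ξ g n b ω' ∂P) ∂P
        = covariance (coverField u Ξ g n a) (coverField u Ξ g n b) P := rfl
    rw [hcov, mul_min_of_nonneg _ _ (by norm_num)]
    refine le_min ?_ ?_
    · exact h.abs_covariance_coverField_le hQ hgm (fun _ => abs_exceed_sub_le_one k _ _) n a b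
    · exact h.abs_covariance_coverField_le_farIntensity hQ hgm
        (fun _ => abs_exceed_sub_le_one k _ _) (fun _ => sub_self _) n a b

end CoverFieldLimit

/-! ### Excursion functionals -/

section ExcursionLimit

variable {Ω : Type*} {ν : ℕ} {u : ℕ → Ω → Eucl ν}
  {Ξ : ℕ → Ω → ClosedSets ν}

lemma mem_shiftedGrain_iff {t : Eucl ν} {j : ℕ} {ω : Ω} :
    t ∈ shiftedGrain u Ξ j ω ↔ (u j ω, Ξ j ω) ∈ coverSet t := by
  rw [shiftedGrain, Set.mem_vadd_set_iff_neg_vadd_mem, vadd_eq_add, neg_add_eq_sub]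
  rfl

lemma grainField_eq (t : Eucl ν) (ω : Ω) :
    grainField u Ξ t ω = Set.encard {j | (u j ω, Ξ j ω) ∈ coverSet t} := by
  simp_rw [grainField, mem_shiftedGrain_iff]

lemma excursion_mem_Icc (k : ℕ) (t : Eucl ν) (ω : Ω) :
    excursion u Ξ k t ω ∈ Set.Icc (0 : ℝ) 1 := by
  unfold excursion
  by_cases h : ω ∈ {ω' | (k : ℕ∞) ≤ grainField u Ξ t ω'}
  · rw [Set.indicator_of_mem h]; simp
  · rw [Set.indicator_of_notMem h]; simp

lemma abs_excursion_le_one (k : ℕ) (t : Eucl ν) (ω : Ω) : |excursion u Ξ k t ω| ≤ 1 := by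
  rw [abs_of_nonneg (excursion_mem_Icc k t ω).1]
  exact (excursion_mem_Icc k t ω).2

/-- A bounded integrable function has a bounded measurable version. -/
lemma exists_bounded_version {φ : Eucl ν → ℝ} (hφ : MemLp φ ∞ volume) :
    ∃ ψ : Eucl ν → ℝ, Measurable ψ ∧ φ =ᵐ[volume] ψ ∧ ∃ C, ∀ t, |ψ t| ≤ C := by
  obtain ⟨C, hC⟩ : ∃ C : ℝ, ∀ᵐ t, ‖φ t‖ ≤ C := by
    have := ae_le_eLpNormEssSup (f := φ) (μ := volume)
    rw [← eLpNorm_exponent_top] at this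
    refine ⟨(eLpNorm φ ∞ volume).toReal, ?_⟩
    filter_upwards [this] with t ht
    rw [← toReal_enorm]
    exact ENNReal.toReal_mono hφ.2.ne ht
  have hg := hφ.1.stronglyMeasurable_mk.measurable
  set g := hφ.1.mk φ with hgdef
  have hS : MeasurableSet {t | |g t| ≤ C} := measurableSet_le hg.abs measurable_const
  refine ⟨{t | |g t| ≤ C}.indicator g, hg.indicator hS, ?_, |C|, fun t => ?_⟩
  · filter_upwards [hφ.1.ae_eq_mk, hC] with t ht hCt
    rw [Set.indicator_of_mem]
    · exact ht
    · rw [Set.mem_ofPred_eq, hgdef, ← ht]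
      exact hCt
  · by_cases ht : t ∈ {t | |g t| ≤ C}
    · rw [Set.indicator_of_mem ht]
      exact le_trans ht (le_abs_self C)
    · rw [Set.indicator_of_notMem ht, abs_zero]
      exact abs_nonneg C

/-- The functional only depends on the class of `φ` modulo null sets, except at the scale `0`. -/
lemma excursionFunctional_congr {φ ψ : Eucl ν → ℝ} (hφ : φ =ᵐ[volume] ψ) {l : ℝ} (hl : l ≠ 0)
    (k : ℕ) : excursionFunctional u Ξ l k φ = excursionFunctional u Ξ l k ψ := by
  ext ω
  refine integral_congr_ae ?_
  have hq := (Measure.quasiMeasurePreserving_smul (volume : Measure (Eucl ν))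
    (inv_ne_zero hl)).ae_eq_comp hφ
  filter_upwards [hq] with t ht
  simp only [Function.comp_apply] at ht
  rw [ht]

variable [MeasurableSpace Ω] {P : Measure Ω}

lemma measurable_excursion (hu : ∀ j, Measurable (u j)) (hΞ : ∀ j, Measurable (Ξ j)) (k : ℕ) :
    Measurable (Function.uncurry (excursion u Ξ k)) := by
  have h1 : Measurable fun q : Eucl ν × Ω =>
      Set.encard {j | (q.1, (u j q.2, Ξ j q.2)) ∈
        {q : Eucl ν × (Eucl ν × ClosedSets ν) | q.2 ∈ coverSet q.1}} := by
    refine measurable_encard_setOf_mem (y := fun j (q : Eucl ν × Ω) => (q.1, (u j q.2, Ξ j q.2)))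
      (fun j => ?_) measurableSet_setOf_mem_coverSet
    exact measurable_fst.prodMk (((hu j).comp measurable_snd).prodMk ((hΞ j).comp measurable_snd))
  have h2 : MeasurableSet {q : Eucl ν × Ω | (k : ℕ∞) ≤ grainField u Ξ q.1 q.2} := by
    simp_rw [grainField_eq]
    exact h1 (MeasurableSet.of_discrete (s := Set.Ici (k : ℕ∞)))
  exact measurable_const.indicator h2

variable {Q : Measure (ClosedSets ν)}

lemma IsBooleanModel.measurable_excursion (h : IsBooleanModel u Ξ Q P) (k : ℕ) :
    Measurable (Function.uncurry (excursion u Ξ k)) :=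
  BooleanModel.measurable_excursion h.germs.measurable h.grains_measurable k

lemma IsBooleanModel.measurable_excursionFunctional (h : IsBooleanModel u Ξ Q P) (l : ℝ) (k : ℕ)
    {φ : Eucl ν → ℝ} (hφ : MemLp φ ∞ volume) :
    Measurable (excursionFunctional u Ξ l k φ) := by
  have key : ∀ ψ : Eucl ν → ℝ, Measurable ψ → Measurable (excursionFunctional u Ξ l k ψ) :=
    fun ψ hψ => measurable_integral_left (F := fun t ω => ψ (l⁻¹ • t) * excursion u Ξ k t ω)
      ((hψ.comp (measurable_fst.const_smul l⁻¹)).mul (h.measurable_excursion k))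
  by_cases hl : l = 0
  · -- At `l = 0` the weight is the constant `φ 0`.
    have : excursionFunctional u Ξ l k φ = excursionFunctional u Ξ l k (fun _ => φ 0) := by
      ext ω
      simp [excursionFunctional, hl]
    rw [this]
    exact key _ measurable_const
  · obtain ⟨ψ, hψ, hφψ, -⟩ := exists_bounded_version hφ
    rw [excursionFunctional_congr hφψ hl]
    exact key ψ hψ

variable [IsProbabilityMeasure P] [IsProbabilityMeasure Q]

/-- Almost surely only finitely many grains cover `t`, so that counting in `ℕ∞` or in `ℝ` is the
same. -/
lemma IsBooleanModel.excursion_ae_eq (h : IsBooleanModel u Ξ Q P)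
    (hQ : ∫⁻ F, volume (F : Set (Eucl ν)) ^ 2 ∂Q < ∞) (k : ℕ) (t : Eucl ν) :
    excursion u Ξ k t =ᵐ[P] coverField u Ξ (fun x => exceed k x.2) 0 t := by
  filter_upwards [ae_finite_setOf_mem h.hasPoissonFunctional.measurable
    h.hasPoissonFunctional.intensity (measurableSet_coverSet t) (measure_coverSet_ne_top hQ t)]
    with ω hω
  have h1 : (k : ℕ∞) ≤ grainField u Ξ t ω ↔
      (k : ℝ) ≤ pointCount (fun j ω => (u j ω, Ξ j ω)) (coverSet t) ω := by
    rw [grainField_eq, pointCount, Nat.cast_le, ← ENat.natCast_toNat (Set.encard_ne_top_iff.2 hω),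
      Nat.cast_le, ENat.toNat_natCast]
  simp only [excursion, coverField, exceed]
  by_cases hk : (k : ℕ∞) ≤ grainField u Ξ t ω
  · rw [Set.indicator_of_mem (show ω ∈ {ω' | (k : ℕ∞) ≤ grainField u Ξ t ω'} from hk),
      Set.indicator_of_mem (Set.mem_Ici.2 (h1.1 hk))]
  · rw [Set.indicator_of_notMem (show ω ∉ {ω' | (k : ℕ∞) ≤ grainField u Ξ t ω'} from hk),
      Set.indicator_of_notMem (fun hc => hk (h1.2 (Set.mem_Ici.1 hc)))]

lemma IsBooleanModel.ae_ae_excursion_eq (h : IsBooleanModel u Ξ Q P)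
    (hQ : ∫⁻ F, volume (F : Set (Eucl ν)) ^ 2 ∂Q < ∞) (k : ℕ) :
    ∀ᵐ ω ∂P, ∀ᵐ t, excursion u Ξ k t ω = coverField u Ξ (fun x => exceed k x.2) 0 t ω := by
  have hm : MeasurableSet {q : Eucl ν × Ω |
      excursion u Ξ k q.1 q.2 = coverField u Ξ (fun x => exceed k x.2) 0 q.1 q.2} :=
    measurableSet_eq_fun (h.measurable_excursion k)
      (h.measurable_coverField ((measurable_exceed k).comp measurable_snd) 0)
  exact (Measure.ae_ae_comm hm).1 (ae_of_all _ fun t => h.excursion_ae_eq hQ k t)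

lemma IsBooleanModel.covariance_excursion_eq (h : IsBooleanModel u Ξ Q P)
    (hQ : ∫⁻ F, volume (F : Set (Eucl ν)) ^ 2 ∂Q < ∞) (k : ℕ) (s t : Eucl ν) :
    covariance (excursion u Ξ k s) (excursion u Ξ k t) P
      = covariance (coverField u Ξ (fun x => exceed k x.2) 0 s)
        (coverField u Ξ (fun x => exceed k x.2) 0 t) P :=
  covariance_congr_ae (h.excursion_ae_eq hQ k s) (h.excursion_ae_eq hQ k t)

lemma IsBooleanModel.integral_excursion_eq (h : IsBooleanModel u Ξ Q P)
    (hQ : ∫⁻ F, volume (F : Set (Eucl ν)) ^ 2 ∂Q < ∞) (k : ℕ) (t : Eucl ν) :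
    ∫ ω, excursion u Ξ k t ω ∂P = ∫ ω, excursion u Ξ k 0 ω ∂P := by
  rw [integral_congr_ae (h.excursion_ae_eq hQ k t), integral_congr_ae (h.excursion_ae_eq hQ k 0)]
  exact ((h.identDistrib_coverField hQ ((measurable_exceed k).comp measurable_snd) 0 t t).comp
    measurable_fst).integral_eq

lemma IsBooleanModel.integrable_covariance_excursion (h : IsBooleanModel u Ξ Q P)
    (hQ : ∫⁻ F, volume (F : Set (Eucl ν)) ^ 2 ∂Q < ∞) (k : ℕ) :
    Integrable fun t => covariance (excursion u Ξ k 0) (excursion u Ξ k t) P := by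
  simp_rw [h.covariance_excursion_eq hQ k]
  exact h.integrable_covariance_coverField hQ ((measurable_exceed k).comp measurable_snd)
    (fun x => abs_exceed_le_one k _) 0

/-- The asymptotic variance is nonnegative, as a limit of variances. -/
lemma IsBooleanModel.excursionVariance_nonneg (h : IsBooleanModel u Ξ Q P)
    (hQ : ∫⁻ F, volume (F : Set (Eucl ν)) ^ 2 ∂Q < ∞) (k : ℕ) :
    0 ≤ excursionVariance u Ξ P k := by
  have hf : Measurable fun x : ℝ × ℝ => exceed k x.2 := (measurable_exceed k).comp measurable_snd
  have hX := h.measurable_coverField hf 0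
  set φ : Eucl ν → ℝ := (Metric.ball (0 : Eucl ν) 1).indicator fun _ => 1 with hφ
  have hφm : Measurable φ := measurable_const.indicator measurableSet_ball
  have hφi : Integrable φ :=
    (integrable_indicator_iff measurableSet_ball).2 (integrableOn_const measure_ball_lt_top.ne)
  have hφ1 : ∀ t, |φ t| ≤ 1 := fun t => by
    by_cases ht : t ∈ Metric.ball (0 : Eucl ν) 1 <;> simp [hφ, ht]
  have hlim := tendsto_integral_fieldIntegral_sq (P := P) hφm hφi hφ1 (measurable_centred hX)
    (abs_centred_le_one hX fun _ _ => exceed_mem_Icc k _)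
    (h.integrable_covariance_coverField hQ hf (fun x => abs_exceed_le_one k _) 0)
    (fun a b => h.covariance_coverField_eq hQ hf 0 a b)
  have h0 := ge_of_tendsto' hlim fun l => integral_nonneg fun ω => sq_nonneg _
  have hsq : ∫ t, φ t ^ 2 = volume.real (Metric.ball (0 : Eucl ν) 1) := by
    have : ∀ t, φ t ^ 2 = φ t := fun t => by
      by_cases ht : t ∈ Metric.ball (0 : Eucl ν) 1 <;> simp [hφ, ht]
    simp_rw [this]
    rw [hφ, integral_indicator_const _ measurableSet_ball, smul_eq_mul, mul_one]
  have hpos : 0 < volume.real (Metric.ball (0 : Eucl ν) 1) :=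
    ENNReal.toReal_pos (Metric.measure_ball_pos volume 0 one_pos).ne' measure_ball_lt_top.ne
  rw [hsq] at h0
  rw [excursionVariance]
  simp_rw [h.covariance_excursion_eq hQ k]
  exact nonneg_of_mul_nonneg_left h0 hpos

/-- The normalized excursion functional is the weighted integral of the centred field. -/
lemma IsBooleanModel.excursionFunctional_sub_integral (h : IsBooleanModel u Ξ Q P)
    (hQ : ∫⁻ F, volume (F : Set (Eucl ν)) ^ 2 ∂Q < ∞) (k : ℕ) {φ : Eucl ν → ℝ}
    (hφ : Measurable φ) (hφi : Integrable φ) {l : ℝ} (hl : 0 < l) :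
    (fun ω => l ^ (-(ν : ℝ) / 2) * (excursionFunctional u Ξ l k φ ω
      - ∫ ω', excursionFunctional u Ξ l k φ ω' ∂P)) =ᵐ[P]
    fieldIntegral (scaledWeight φ l)
      (centred P (coverField u Ξ (fun x => exceed k x.2) 0)) := by
  set X := coverField u Ξ (fun x => exceed k x.2) 0 with hX
  set c := l ^ (-(ν : ℝ) / 2) with hc
  have hXm : Measurable (Function.uncurry X) :=
    h.measurable_coverField ((measurable_exceed k).comp measurable_snd) 0
  have hw : Integrable fun t => φ (l⁻¹ • t) := hφi.comp_smul (inv_ne_zero hl.ne')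
  have hEm : Measurable fun t => ∫ ω, X t ω ∂P :=
    (hXm.stronglyMeasurable.integral_prod_right' (ν := P)).measurable
  have hE1 : ∀ t, ‖∫ ω, X t ω ∂P‖ ≤ 1 := fun t =>
    (norm_integral_le_of_norm_le_const (μ := P) (C := 1)
      (ae_of_all P fun ω => abs_exceed_le_one k _)).trans_eq (by simp)
  have i1 : ∀ ω, Integrable fun t => φ (l⁻¹ • t) * X t ω := fun ω =>
    hw.mul_bdd (c := 1) hXm.of_uncurry_right.aestronglyMeasurable
      (ae_of_all _ fun t => abs_exceed_le_one k _)
  have i2 : Integrable fun t => φ (l⁻¹ • t) * ∫ ω, X t ω ∂P :=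
    hw.mul_bdd (c := 1) hEm.aestronglyMeasurable (ae_of_all _ hE1)
  have hae : (fun ω => excursionFunctional u Ξ l k φ ω)
      =ᵐ[P] fun ω => ∫ t, φ (l⁻¹ • t) * X t ω := by
    filter_upwards [h.ae_ae_excursion_eq hQ k] with ω hω
    refine integral_congr_ae ?_
    filter_upwards [hω] with t ht
    rw [ht]
  have hmean : ∫ ω, excursionFunctional u Ξ l k φ ω ∂P
      = ∫ t, φ (l⁻¹ • t) * ∫ ω, X t ω ∂P := by
    rw [integral_congr_ae hae, ← integral_integral_swap]
    · congr 1 with t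
      rw [integral_const_mul]
    · refine integrable_prod_of_bound (F := fun t ω => φ (l⁻¹ • t) * X t ω)
        (f := fun t => |φ (l⁻¹ • t)|) ?_ hw.abs fun t ω => ?_
      · exact ((hφ.comp (measurable_fst.const_smul l⁻¹)).mul hXm).aestronglyMeasurable
      · rw [norm_mul]
        exact mul_le_of_le_one_right (norm_nonneg _) (abs_exceed_le_one k _)
  filter_upwards [hae] with ω hω
  rw [hω, hmean, fieldIntegral, ← integral_sub (i1 ω) i2, ← integral_const_mul]
  congr 1 with t
  rw [scaledWeight, centred]
  ring

lemma charFun_map_eq {Ω : Type*} [MeasurableSpace Ω] {μ : Measure Ω} {Y : Ω → ℝ}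
    (hY : AEMeasurable Y μ) (s : ℝ) :
    charFun (μ.map Y) s = ∫ ω, Complex.exp (((s * Y ω : ℝ) : ℂ) * Complex.I) ∂μ := by
  rw [charFun_apply_real, integral_map hY (Measurable.aestronglyMeasurable (by fun_prop))]
  simp_rw [Complex.ofReal_mul]

/-- Lévy's continuity theorem along a continuous parameter. -/
lemma tendstoInDistribution_of_tendsto_integral_cexp {Ω' : Type*} [MeasurableSpace Ω']
    {P' : Measure Ω'} [IsProbabilityMeasure P'] {X : ℝ → Ω → ℝ} (hX : ∀ l, AEMeasurable (X l) P)
    {Z : Ω' → ℝ} (hZ : AEMeasurable Z P')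
    (h : ∀ s : ℝ, Tendsto (fun l => ∫ ω, Complex.exp (((s * X l ω : ℝ) : ℂ) * Complex.I) ∂P) atTop
      (𝓝 (∫ w, Complex.exp (((s * Z w : ℝ) : ℂ) * Complex.I) ∂P'))) :
    TendstoInDistribution X atTop Z (fun _ => P) P' where
  forall_aemeasurable := hX
  aemeasurable_limit := hZ
  tendsto := by
    refine tendsto_of_seq_tendsto fun x hx => ?_
    refine ProbabilityMeasure.tendsto_of_tendsto_charFun fun s => ?_
    change Tendsto (fun n => charFun (P.map (X (x n))) s) atTop (𝓝 (charFun (P'.map Z) s))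
    rw [charFun_map_eq hZ]
    simp_rw [charFun_map_eq (hX _)]
    exact (h s).comp hx

lemma integral_cexp_gaussianReal (v : ℝ≥0) (s c : ℝ) :
    ∫ w, Complex.exp (((s * (c * w) : ℝ) : ℂ) * Complex.I) ∂(gaussianReal 0 v)
      = Complex.exp ((-(s ^ 2 * (c ^ 2 * v) / 2) : ℝ) : ℂ) := by
  have h1 := charFun_gaussianReal (μ := 0) (v := v) (s * c)
  rw [charFun_apply_real] at h1
  have h2 : ∀ w : ℝ, ((s * (c * w) : ℝ) : ℂ) * Complex.I
      = ((s * c : ℝ) : ℂ) * (w : ℂ) * Complex.I := fun w => by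
    push_cast
    ring
  simp_rw [h2]
  rw [h1]
  congr 1
  push_cast
  ring

/-- **Central limit theorem for excursion functionals**, for a test function with `∫ φ² = v`. -/
theorem IsBooleanModel.tendstoInDistribution_excursionFunctional (h : IsBooleanModel u Ξ Q P)
    (hQ : ∫⁻ F, volume (F : Set (Eucl ν)) ^ 2 ∂Q < ∞) (hν : 1 ≤ ν) (k : ℕ) {φ : Eucl ν → ℝ}
    (hφ1 : MemLp φ 1 volume) (hφ : MemLp φ ∞ volume) {v : ℝ≥0} (hv : ∫ t, φ t ^ 2 = v) :
    TendstoInDistribution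
      (fun (l : ℝ) (ω : Ω) => l ^ (-(ν : ℝ) / 2) *
        (excursionFunctional u Ξ l k φ ω - ∫ ω', excursionFunctional u Ξ l k φ ω' ∂P))
      atTop (fun w : ℝ => √(excursionVariance u Ξ P k) * w) (fun _ => P) (gaussianReal 0 v) := by
  refine tendstoInDistribution_of_tendsto_integral_cexp (fun l => ?_)
    (measurable_const.mul measurable_id).aemeasurable fun s => ?_
  · exact (((h.measurable_excursionFunctional l k hφ).sub_const _).const_mul _).aemeasurable
  · obtain ⟨ψ, hψ, hφψ, C, hC⟩ := exists_bounded_version hφ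
    have hψi : Integrable ψ := (memLp_one_iff_integrable.1 hφ1).congr hφψ
    have hψv : ∫ t, ψ t ^ 2 = v := by
      rw [← hv]
      refine integral_congr_ae ?_
      filter_upwards [hφψ] with t ht
      rw [ht]
    rw [integral_cexp_gaussianReal, Real.sq_sqrt (h.excursionVariance_nonneg hQ k)]
    have hlim := h.tendsto_integral_cexp_coverField hQ hν k hψ hψi hC s
    simp_rw [← h.covariance_excursion_eq hQ k] at hlim
    rw [hψv] at hlim
    refine hlim.congr' ?_
    filter_upwards [eventually_gt_atTop 0] with l hl
    rw [excursionFunctional_congr hφψ hl.ne']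
    refine integral_congr_ae ?_
    filter_upwards [h.excursionFunctional_sub_integral hQ k hψ hψi hl] with ω hω
    rw [hω]

end ExcursionLimit

/-! ### The volume fraction -/

section VolumeFraction

variable {Ω : Type*} {ν : ℕ} {u : ℕ → Ω → Eucl ν} {Ξ : ℕ → Ω → ClosedSets ν}

lemma booleanIndicator_eq_excursion (t : Eucl ν) (ω : Ω) :
    booleanIndicator u Ξ t ω = excursion u Ξ 1 t ω := by
  have h : t ∈ booleanSet u Ξ ω ↔ ω ∈ {ω' | ((1 : ℕ) : ℕ∞) ≤ grainField u Ξ t ω'} := by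
    rw [Set.mem_ofPred_eq, Nat.cast_one, grainField, Set.one_le_encard_iff_nonempty, booleanSet,
      Set.mem_iUnion]
    rfl
  unfold booleanIndicator excursion
  by_cases ht : t ∈ booleanSet u Ξ ω
  · rw [Set.indicator_of_mem ht, Set.indicator_of_mem (h.1 ht)]
  · rw [Set.indicator_of_notMem ht, Set.indicator_of_notMem (fun hc => ht (h.2 hc))]

lemma excursion_one_eq_one_sub (t : Eucl ν) (ω : Ω) :
    excursion u Ξ 1 t ω
      = 1 - {ω | ∀ j, (u j ω, Ξ j ω) ∉ coverSet t}.indicator (fun _ => (1 : ℝ)) ω := by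
  rw [← booleanIndicator_eq_excursion, booleanIndicator]
  have h : t ∈ booleanSet u Ξ ω ↔ ¬ ω ∈ {ω | ∀ j, (u j ω, Ξ j ω) ∉ coverSet t} := by
    rw [booleanSet, Set.mem_iUnion, Set.mem_ofPred_eq, not_forall]
    simp_rw [mem_shiftedGrain_iff, not_not]
  by_cases ht : t ∈ booleanSet u Ξ ω
  · rw [Set.indicator_of_mem ht, Set.indicator_of_notMem (h.1 ht), sub_zero]
  · rw [Set.indicator_of_notMem ht, Set.indicator_of_mem (not_not.1 fun hc => ht (h.2 hc)),
      sub_self]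

/-- The volume of the Boolean set in a window as the integral of the excursion indicator. -/
lemma volume_real_booleanSet_inter {B : Set (Eucl ν)} (hB : MeasurableSet B) {ω : Ω}
    (hω : Measurable fun t => excursion u Ξ 1 t ω) :
    volume.real (booleanSet u Ξ ω ∩ B) = ∫ t, B.indicator (fun _ => (1 : ℝ)) t *
      excursion u Ξ 1 t ω := by
  have hS : MeasurableSet (booleanSet u Ξ ω) := by
    have : booleanSet u Ξ ω = (fun t => excursion u Ξ 1 t ω) ⁻¹' {1} := by
      ext t
      simp only [Set.mem_preimage, Set.mem_singleton_iff, ← booleanIndicator_eq_excursion,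
        booleanIndicator]
      by_cases ht : t ∈ booleanSet u Ξ ω <;> simp [ht]
    rw [this]
    exact hω (measurableSet_singleton 1)
  have h1 : ∀ t, B.indicator (fun _ => (1 : ℝ)) t * excursion u Ξ 1 t ω
      = (booleanSet u Ξ ω ∩ B).indicator (fun _ => (1 : ℝ)) t := by
    intro t
    rw [← booleanIndicator_eq_excursion, booleanIndicator, mul_comm, ← Set.inter_indicator_mul]
    simp
  simp_rw [h1]
  rw [integral_indicator_const _ (hS.inter hB), smul_eq_mul, mul_one]

lemma volume_real_unitCube : volume.real (unitCube ν) = 1 := by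
  have h : unitCube ν = (@WithLp.ofLp 2 (Fin ν → ℝ)) ⁻¹' Set.univ.pi fun _ => Set.Ioc 0 1 := by
    ext t
    simp [unitCube, Set.mem_pi]
  rw [Measure.real, h, (PiLp.volume_preserving_ofLp (Fin ν)).measure_preimage
    (MeasurableSet.univ_pi fun _ => measurableSet_Ioc).nullMeasurableSet, Real.volume_pi_Ioc]
  simp

lemma measurableSet_unitCube : MeasurableSet (unitCube ν) := by
  have h : unitCube ν = ⋂ i, {t : Eucl ν | 0 < t i ∧ t i ≤ 1} := by
    ext t
    simp [unitCube]
  rw [h]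
  refine MeasurableSet.iInter fun i => ?_
  have hi : Measurable fun t : Eucl ν => t i := by fun_prop
  exact (measurableSet_lt measurable_const hi).inter (measurableSet_le hi measurable_const)

lemma measurableSet_smul {A : Set (Eucl ν)} (hA : MeasurableSet A) (l : ℝ) :
    MeasurableSet (l • A) := by
  by_cases hl : l = 0
  · rw [hl]
    exact (Set.Subsingleton.anti Set.subsingleton_singleton
      (Set.zero_smul_set_subset A)).measurableSet
  · exact hA.const_smul₀ l

variable [MeasurableSpace Ω] {P : Measure Ω} {Q : Measure (ClosedSets ν)}

lemma IsBooleanModel.measurable_volume_real_booleanSet_inter (h : IsBooleanModel u Ξ Q P)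
    {B : Set (Eucl ν)} (hB : MeasurableSet B) :
    Measurable fun ω => volume.real (booleanSet u Ξ ω ∩ B) := by
  have hm := h.measurable_excursion 1
  simp_rw [fun ω => volume_real_booleanSet_inter hB (hm.of_uncurry_right (y := ω))]
  exact measurable_integral_left (F := fun t ω => B.indicator (fun _ => (1 : ℝ)) t *
    excursion u Ξ 1 t ω) (((measurable_const.indicator hB).comp measurable_fst).mul hm)

lemma volumeVariance_eq_excursionVariance :
    volumeVariance u Ξ P = excursionVariance u Ξ P 1 := by
  have e : booleanIndicator u Ξ = excursion u Ξ 1 := by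
    ext t ω
    exact booleanIndicator_eq_excursion t ω
  rw [volumeVariance, excursionVariance, e]

variable [IsProbabilityMeasure P] [IsProbabilityMeasure Q]

lemma IsBooleanModel.integral_volume_real_booleanSet_inter (h : IsBooleanModel u Ξ Q P)
    (hQ : ∫⁻ F, volume (F : Set (Eucl ν)) ^ 2 ∂Q < ∞) {B : Set (Eucl ν)} (hB : MeasurableSet B)
    (hB' : volume B ≠ ∞) :
    ∫ ω, volume.real (booleanSet u Ξ ω ∩ B) ∂P
      = (∫ ω, excursion u Ξ 1 0 ω ∂P) * volume.real B := by
  have hm := h.measurable_excursion 1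
  have hBi : Integrable (B.indicator fun _ => (1 : ℝ)) :=
    (integrable_indicator_iff hB).2 (integrableOn_const hB')
  simp_rw [fun ω => volume_real_booleanSet_inter hB (hm.of_uncurry_right (y := ω))]
  rw [← integral_integral_swap]
  · simp_rw [integral_const_mul, h.integral_excursion_eq hQ 1]
    rw [integral_mul_const, integral_indicator_const _ hB, smul_eq_mul, mul_one, mul_comm]
  · refine integrable_prod_of_bound (F := fun t ω => B.indicator (fun _ => (1 : ℝ)) t *
      excursion u Ξ 1 t ω) (f := fun t => |B.indicator (fun _ => (1 : ℝ)) t|)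
      (((measurable_const.indicator hB).comp measurable_fst).mul hm).aestronglyMeasurable
      hBi.abs fun t ω => ?_
    rw [norm_mul]
    exact mul_le_of_le_one_right (norm_nonneg _) (abs_excursion_le_one 1 t ω)

lemma IsBooleanModel.volumeFraction_eq (h : IsBooleanModel u Ξ Q P)
    (hQ : ∫⁻ F, volume (F : Set (Eucl ν)) ^ 2 ∂Q < ∞) :
    volumeFraction u Ξ P = ∫ ω, excursion u Ξ 1 0 ω ∂P := by
  have hfin : volume (unitCube ν) ≠ ∞ := fun hc => by
    have := volume_real_unitCube (ν := ν)
    rw [Measure.real, hc] at this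
    simp at this
  rw [volumeFraction, h.integral_volume_real_booleanSet_inter hQ measurableSet_unitCube hfin,
    volume_real_unitCube, mul_one]

/-- The covariance function of the Boolean set, from the probabilities that no grain covers one
point or one of two points. -/
lemma IsBooleanModel.covariance_excursion_one (h : IsBooleanModel u Ξ Q P)
    (hQ : ∫⁻ F, volume (F : Set (Eucl ν)) ^ 2 ∂Q < ∞) (t : Eucl ν) :
    covariance (excursion u Ξ 1 0) (excursion u Ξ 1 t) P
      = Real.exp (-2 * meanVolume Q) * (Real.exp (meanOverlap Q t) - 1) := by
  set M := (volume : Measure (Eucl ν)).prod Q with hM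
  set V : Eucl ν → Set Ω := fun t => {ω | ∀ j, (u j ω, Ξ j ω) ∉ coverSet t} with hV
  have hy := h.hasPoissonFunctional
  have hVm : ∀ t, MeasurableSet (V t) := by
    intro t
    have : V t = ⋂ j, ((fun ω => (u j ω, Ξ j ω)) ⁻¹' coverSet t)ᶜ := by
      ext ω
      simp [hV]
    rw [this]
    exact MeasurableSet.iInter fun j => (hy.measurable j (measurableSet_coverSet t)).compl
  have hMc : ∀ t, M.real (coverSet t) = meanVolume Q := fun t => by
    rw [Measure.real, measure_coverSet, meanVolume]
  have hP1 : ∀ t, P.real (V t) = Real.exp (-meanVolume Q) := fun t => by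
    rw [← hMc t]
    exact hy.measureReal_forall_notMem (measurableSet_coverSet t) (measure_coverSet_ne_top hQ t)
  have hP2 : P.real (V 0 ∩ V t) = Real.exp (-(2 * meanVolume Q - meanOverlap Q t)) := by
    have e1 : V 0 ∩ V t = {ω | ∀ j, (u j ω, Ξ j ω) ∉ coverSet 0 ∪ coverSet t} := by
      ext ω
      simp only [hV, Set.mem_inter_iff, Set.mem_ofPred_eq, Set.mem_union, not_or, forall_and]
    have hfin : M (coverSet 0 ∪ coverSet t) ≠ ∞ :=
      ((measure_union_le _ _).trans_lt (ENNReal.add_lt_top.2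
        ⟨(measure_coverSet_ne_top hQ 0).lt_top, (measure_coverSet_ne_top hQ t).lt_top⟩)).ne
    have e2 := measureReal_union_add_inter (μ := M) (s := coverSet 0) (measurableSet_coverSet t)
      (measure_coverSet_ne_top hQ 0) (measure_coverSet_ne_top hQ t)
    have e3 : M.real (coverSet 0 ∩ coverSet t) = meanOverlap Q t := by
      rw [Measure.real, measure_coverSet_inter, sub_zero, meanOverlap_eq]
    rw [hMc, hMc, e3] at e2
    rw [e1, hy.measureReal_forall_notMem
      ((measurableSet_coverSet 0).union (measurableSet_coverSet t)) hfin]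
    congr 2
    linarith
  set X : Eucl ν → Ω → ℝ := fun t => (V t).indicator fun _ => 1 with hX
  have hXi : ∀ t, Integrable (X t) P := fun t => (integrable_const 1).indicator (hVm t)
  have hX2 : ∀ t, MemLp (X t) 2 P := fun t => (memLp_const 1).indicator (hVm t)
  have hE : ∀ t, excursion u Ξ 1 t = fun ω => 1 - X t ω := fun t => by
    ext ω
    exact excursion_one_eq_one_sub t ω
  have hprod : X 0 * X t = (V 0 ∩ V t).indicator fun _ => 1 := by
    ext ω
    rw [hX, Pi.mul_apply, ← Set.inter_indicator_mul]
    simp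
  have hmean : ∀ t, ∫ ω, X t ω ∂P = Real.exp (-meanVolume Q) := fun t => by
    rw [hX, integral_indicator_const _ (hVm t), hP1, smul_eq_mul, mul_one]
  rw [hE, hE, covariance_const_sub_left (hXi 0), covariance_const_sub_right (hXi t), neg_neg,
    covariance_eq_sub (hX2 0) (hX2 t), hmean, hmean, hprod,
    integral_indicator_const _ ((hVm 0).inter (hVm t)), hP2, smul_eq_mul, mul_one, mul_sub,
    ← Real.exp_add, ← Real.exp_add]
  congr 2 <;> ring_nf

lemma IsBooleanModel.integrable_exp_meanOverlap_sub_one (h : IsBooleanModel u Ξ Q P)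
    (hQ : ∫⁻ F, volume (F : Set (Eucl ν)) ^ 2 ∂Q < ∞) :
    Integrable fun t => Real.exp (meanOverlap Q t) - 1 := by
  have h1 := h.integrable_covariance_excursion hQ 1
  simp_rw [h.covariance_excursion_one hQ] at h1
  exact (integrable_const_mul_iff (IsUnit.mk0 _ (Real.exp_pos _).ne') _).1 h1

/-- The central limit theorem for the sample volume fraction is the one for the functional of the
indicator function of the window. -/
theorem IsBooleanModel.tendstoInDistribution_sampleVolumeFraction (h : IsBooleanModel u Ξ Q P)
    (hQ : ∫⁻ F, volume (F : Set (Eucl ν)) ^ 2 ∂Q < ∞) (hν : 1 ≤ ν) {A : Set (Eucl ν)}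
    (hA : MeasurableSet A) (hA0 : 0 < volume A) (hA' : volume A ≠ ∞) :
    TendstoInDistribution
      (fun (l : ℝ) (ω : Ω) => l ^ ((ν : ℝ) / 2) *
        (sampleVolumeFraction u Ξ l A ω - volumeFraction u Ξ P))
      atTop (fun w : ℝ => √(volumeVariance u Ξ P) * w / volume.real A)
      (fun _ => P) (gaussianReal 0 (volume A).toNNReal) := by
  set φ : Eucl ν → ℝ := A.indicator fun _ => 1 with hφ
  have hφ1 : MemLp φ 1 volume := memLp_indicator_const 1 hA 1 (Or.inr hA')
  have hφt : MemLp φ ∞ volume := (memLp_top_const 1).indicator hA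
  have hφ2 : ∫ t, φ t ^ 2 = ((volume A).toNNReal : ℝ) := by
    have : ∀ t, φ t ^ 2 = φ t := fun t => by
      by_cases ht : t ∈ A <;> simp [hφ, ht]
    simp_rw [this]
    rw [hφ, integral_indicator_const _ hA, smul_eq_mul, mul_one]
    rfl
  have hApos : 0 < volume.real A := ENNReal.toReal_pos hA0.ne' hA'
  have hlim := (h.tendstoInDistribution_excursionFunctional hQ hν 1 hφ1 hφt hφ2).continuous_comp
    (g := fun x => x / volume.real A) (continuous_id.div_const _)
  rw [volumeVariance_eq_excursionVariance]
  have hm : ∀ l, Measurable fun ω => l ^ ((ν : ℝ) / 2) *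
      (sampleVolumeFraction u Ξ l A ω - volumeFraction u Ξ P) := fun l =>
    (((h.measurable_volume_real_booleanSet_inter (measurableSet_smul hA l)).div_const _).sub_const
      _).const_mul _
  refine ⟨fun l => (hm l).aemeasurable, hlim.aemeasurable_limit, hlim.tendsto.congr' ?_⟩
  filter_upwards [eventually_gt_atTop 0] with l hl
  refine Subtype.ext ?_
  change P.map _ = P.map _
  congr 1
  ext ω
  have hlA : volume.real (l • A) = l ^ ν * volume.real A := by
    rw [Measure.real, Measure.addHaar_smul_of_nonneg _ hl.le, ENNReal.toReal_mul,
      ENNReal.toReal_ofReal (pow_nonneg hl.le _), finrank_euclideanSpace_fin, Measure.real]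
  have hlA' : volume (l • A) ≠ ∞ := by
    rw [Measure.addHaar_smul_of_nonneg _ hl.le]
    exact ENNReal.mul_ne_top ENNReal.ofReal_ne_top hA'
  have hF : ∀ ω, excursionFunctional u Ξ l 1 φ ω = volume.real (booleanSet u Ξ ω ∩ l • A) := by
    intro ω
    rw [volume_real_booleanSet_inter (measurableSet_smul hA l)
      ((h.measurable_excursion 1).of_uncurry_right), excursionFunctional]
    congr 1 with t
    have : t ∈ l • A ↔ l⁻¹ • t ∈ A := Set.mem_smul_set_iff_inv_smul_mem₀ hl.ne' A t
    by_cases ht : l⁻¹ • t ∈ A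
    · rw [hφ, Set.indicator_of_mem ht, Set.indicator_of_mem (this.2 ht)]
    · rw [hφ, Set.indicator_of_notMem ht, Set.indicator_of_notMem (fun hc => ht (this.1 hc))]
  have hpow : l ^ ((ν : ℝ) / 2) = l ^ (-(ν : ℝ) / 2) * l ^ ν := by
    rw [← Real.rpow_natCast, ← Real.rpow_add hl]
    congr 1
    ring
  have hlν : l ^ ν ≠ 0 := (pow_pos hl ν).ne'
  simp only [Function.comp_apply]
  simp_rw [hF]
  rw [h.integral_volume_real_booleanSet_inter hQ (measurableSet_smul hA l) hlA',
    sampleVolumeFraction, h.volumeFraction_eq hQ, hlA, hpow]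
  field_simp

end VolumeFraction

end BooleanModel

end

theorem theorem2 {Ω : Type*} [MeasurableSpace Ω] (P : Measure Ω) [IsProbabilityMeasure P]
    (ν : ℕ) (hν : 1 ≤ ν)
    (Q : Measure (BooleanModel.ClosedSets ν)) [IsProbabilityMeasure Q]
    (u : ℕ → Ω → BooleanModel.Eucl ν) (Ξ : ℕ → Ω → BooleanModel.ClosedSets ν)
    (hmodel : BooleanModel.IsBooleanModel u Ξ Q P)
    (hQ : ∫⁻ F, volume (F : Set (BooleanModel.Eucl ν)) ^ 2 ∂Q < ∞) :
    (∀ k : ℕ, 1 ≤ k →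
      Integrable (fun t => covariance (BooleanModel.excursion u Ξ k 0)
        (BooleanModel.excursion u Ξ k t) P) volume ∧
      0 ≤ BooleanModel.excursionVariance u Ξ P k ∧
      ∀ φ : BooleanModel.Eucl ν → ℝ, MemLp φ 1 volume → MemLp φ ∞ volume →
        TendstoInDistribution
          (fun (l : ℝ) (ω : Ω) => l ^ (-(ν : ℝ) / 2) *
            (BooleanModel.excursionFunctional u Ξ l k φ ω
              - ∫ ω', BooleanModel.excursionFunctional u Ξ l k φ ω' ∂P))
          atTop
          (fun w : ℝ => √(BooleanModel.excursionVariance u Ξ P k) * w)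
          (fun _ => P) (BooleanModel.whiteNoiseLaw φ)) ∧
    (Integrable (fun t => covariance (BooleanModel.booleanIndicator u Ξ 0)
        (BooleanModel.booleanIndicator u Ξ t) P) volume ∧
      0 ≤ BooleanModel.volumeVariance u Ξ P ∧
      Integrable (fun t => Real.exp (BooleanModel.meanOverlap Q t) - 1) volume ∧
      BooleanModel.volumeVariance u Ξ P =
        Real.exp (-2 * BooleanModel.meanVolume Q) *
          ∫ t, (Real.exp (BooleanModel.meanOverlap Q t) - 1)) ∧
    (∀ A : Set (BooleanModel.Eucl ν), MeasurableSet A → Bornology.IsBounded A → 0 < volume A →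
      TendstoInDistribution
        (fun (l : ℝ) (ω : Ω) => l ^ ((ν : ℝ) / 2) *
          (BooleanModel.sampleVolumeFraction u Ξ l A ω - BooleanModel.volumeFraction u Ξ P))
        atTop
        (fun w : ℝ => √(BooleanModel.volumeVariance u Ξ P) * w / volume.real A)
        (fun _ => P) (gaussianReal 0 (volume A).toNNReal)) := by
  refine ⟨fun k _ => ⟨hmodel.integrable_covariance_excursion hQ k,
    hmodel.excursionVariance_nonneg hQ k, fun φ hφ1 hφ =>
      hmodel.tendstoInDistribution_excursionFunctional hQ hν k hφ1 hφ
        (Real.coe_toNNReal _ (integral_nonneg fun _ => sq_nonneg _)).symm⟩,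
    ⟨?_, ?_, hmodel.integrable_exp_meanOverlap_sub_one hQ, ?_⟩, fun A hA hAb hA0 =>
      hmodel.tendstoInDistribution_sampleVolumeFraction hQ hν hA hA0 hAb.measure_lt_top.ne⟩
  · have e : BooleanModel.booleanIndicator u Ξ = BooleanModel.excursion u Ξ 1 := by
      ext t ω
      exact BooleanModel.booleanIndicator_eq_excursion t ω
    rw [e]
    exact hmodel.integrable_covariance_excursion hQ 1
  · rw [BooleanModel.volumeVariance_eq_excursionVariance]
    exact hmodel.excursionVariance_nonneg hQ 1
  · rw [BooleanModel.volumeVariance_eq_excursionVariance, BooleanModel.excursionVariance]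
    simp_rw [hmodel.covariance_excursion_one hQ]
    exact integral_const_mul _ _
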